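/- Theorem 1. There is an absolute constant $A$ such that the following holds. Let $X_1,X_2,\dots$ be independent, identically distributed real random variables with $\mathbb{E}X_1=0$, $\mathbb{E}X_1^2=\sigma^2\in(0,\infty)$, $\sigma>0$, and $\mathbb{E}|X_1|^3<\infty$. Let $S_0=0$, $S_n=X_1+\dots+X_n$ for $n\ge 1$, and let $\tau=\inf\{n\ge 1: S_n\le 0\}$ be the first time at which the walk is non-positive. Then $\tau<\infty$ almost surely, $S_\tau$ is integrable with $\mathbb{E}S_\tau\ne 0$, and $\mathbb{P}(\tau>n)>0$ for every $n\ge 1$. Moreover, for every $n\ge 1$ and every $x\ge 0$, $$ \left|\mathbb{P}\left(\frac{S_n}{\sigma\sqrt{n}}\ge x\,\middle|\,\tau>n\right)-e^{-x^2/2}\right| \le A\,\frac{(\mathbb{E}|X_1|^3)^3}{\sigma^9\sqrt{n}}, $$ and, for every $n\ge 1$, $$ \left|\frac{\mathbb{P}(\tau>n)}{\sqrt{\frac{2}{\pi}}\;\frac{|\mathbb{E}S_\tau|}{\sigma}\,n^{-1/2}}-1\right| \le A\,\frac{(\mathbb{E}|X_1|^3)^3}{\sigma^9\sqrt{n}}.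 $$ -/

import Mathlib

open MeasureTheory ProbabilityTheory

noncomputable section

/-- The random walk `S n = X 0 + ⋯ + X (n - 1)` with `S 0 = 0`; the increments are indexed from
`0`, so that `X 0` plays the role of the first increment. -/
def walk {Ω : Type*} (X : ℕ → Ω → ℝ) (n : ℕ) (ω : Ω) : ℝ :=
  ∑ i ∈ Finset.range n, X i ω

/-- The first time `n ≥ 1` at which the walk is non-positive, with value `⊤` if there is none. -/
def exitTime {Ω : Type*} (X : ℕ → Ω → ℝ) : Ω → WithTop ℕ :=
  hittingAfter (walk X) (Set.Iic 0) 1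

/-- The position of the walk at the exit time (an arbitrary value of the walk where the exit time
is infinite). -/
def exitValue {Ω : Type*} (X : ℕ → Ω → ℝ) : Ω → ℝ :=
  stoppedValue (walk X) (exitTime X)

end

/-! After division by `σ` the increments have a law `μ` with mean zero, unit variance and third
absolute moment `L ≥ 1`. Let κ = E|S_τ|; in the code this is `exitMean μ`. Everything follows from
one estimate on the killed walk: for `z ≥ 0` and n at least of order L², P(S_n ≥ z, τ > n) = 2
φ(z/√n)/√n · κ + O(L³ κ / n), with φ the normal density (`abs_alive_dirac_real_Ici_sub_le`).
Division by √(2/π) κ/√n gives the survival asymptotics at `z = 0`, and the quotient of the cases z =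
x√n and z = 0 gives the Rayleigh limit. The error must carry the factor κ, which may be as small as
1/(2L); otherwise the relative error would be worse than L³/√n. For smaller n crude bounds suffice,
because √n is then at most a multiple of L.

The estimate is obtained by splitting time at n/2.

In the first half the Brownian survival function `killedHeat`, evaluated at the remaining time, is
followed along the killed walk. It vanishes at the starting point 0. A step changes its mean by a
Lindeberg error, and an exit at w ≤ 0 contributes the normal derivative at 0 times |w|. Summation
over the steps gives 2φ(z/√n)/√n times the mean overshoot collected so far
(`abs_integral_killedHeat_alive_sub_le`).

In the second half only the mass κ/√n of the survivors matters, so an error O(1/√n) per unit mass is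
enough. It comes from the reflection principle (`abs_alive_real_Ici_sub_le`): the mass above z minus
the mass below -z is compared for the free walk and for the walk restarted at its exit. By
Berry–Esseen each restart is nearly symmetric, up to a term governed by the overshoot.

Three facts about exits are needed, uniformly in the starting law. The mean overshoot is O(L), by a
concave test function that bounds the Green function (`meanOvershoot_le`). The survival probability
from u is O((u + L)/√n), because survival is positively associated with large values of the walk
(`real_Ici_mul_alive_le`) while the mean of the surviving walk is known from the martingale
property. An exit at time k + 1 has probability O(L²/(k + 1)), by time reversal
(`integral_exitLaw_le`). Berry–Esseen itself is proved by Lindeberg replacement and induction on n.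
-/

/-! ### The standard normal law -/

/-- The standard normal density. -/
noncomputable def stdPdf (x : ℝ) : ℝ := (√(2 * Real.pi))⁻¹ * Real.exp (-x ^ 2 / 2)

/-- The standard normal distribution function. -/
noncomputable def stdCdf (x : ℝ) : ℝ := (gaussianReal 0 1).real (Set.Iic x)

/-- The second derivative of the standard normal density. -/
noncomputable def stdPdf₂ (x : ℝ) : ℝ := (x ^ 2 - 1) * stdPdf x

/-- The third derivative of the standard normal density. -/
noncomputable def stdPdf₃ (x : ℝ) : ℝ := (3 * x - x ^ 3) * stdPdf x

lemma stdPdf_eq : gaussianPDFReal 0 1 = stdPdf := by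
  ext x; simp [gaussianPDFReal_def, stdPdf]

lemma stdPdf_nonneg (x : ℝ) : 0 ≤ stdPdf x := by unfold stdPdf; positivity

lemma inv_sqrt_two_pi_le : (√(2 * Real.pi))⁻¹ ≤ 1 / 2 := by
  rw [one_div]
  apply inv_anti₀ (by norm_num)
  apply Real.le_sqrt_of_sq_le
  nlinarith [Real.pi_gt_three]

lemma exp_neg_half_sq_le (x : ℝ) : Real.exp (-x ^ 2 / 2) ≤ (1 + x ^ 2 / 2)⁻¹ := by
  rw [show -x ^ 2 / 2 = -(x ^ 2 / 2) by ring, Real.exp_neg]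
  apply inv_anti₀ (by positivity)
  linarith [Real.add_one_le_exp (x ^ 2 / 2)]

/-- The bounds exp(x²/2) ≥ 1 + x²/2 and √(2π) ≥ 2 absorb any factor of quadratic growth. Only
uniform bounds on the first derivatives of the density are needed, so the value 1 is a convenience.
-/
lemma abs_mul_stdPdf_le {p : ℝ → ℝ} {x : ℝ} (h : |p x| ≤ 2 * (1 + x ^ 2 / 2)) :
    |p x * stdPdf x| ≤ 1 := by
  have h1 : stdPdf x ≤ 1 / 2 * (1 + x ^ 2 / 2)⁻¹ :=
    mul_le_mul inv_sqrt_two_pi_le (exp_neg_half_sq_le x) (Real.exp_pos _).le (by norm_num)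
  rw [abs_mul, abs_of_nonneg (stdPdf_nonneg x)]
  calc |p x| * stdPdf x ≤ (2 * (1 + x ^ 2 / 2)) * (1 / 2 * (1 + x ^ 2 / 2)⁻¹) := by
        gcongr
        exact stdPdf_nonneg x
    _ = 1 := by field_simp

lemma stdPdf_le_one (x : ℝ) : stdPdf x ≤ 1 := by
  have := abs_mul_stdPdf_le (p := fun _ => 1) (x := x) (by rw [abs_one]; nlinarith [sq_nonneg x])
  simpa [abs_of_nonneg (stdPdf_nonneg x)] using this

lemma abs_id_mul_stdPdf_le (x : ℝ) : |x * stdPdf x| ≤ 1 :=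
  abs_mul_stdPdf_le (p := fun x => x)
    (abs_le.2 ⟨by nlinarith [sq_nonneg (x + 1)], by nlinarith [sq_nonneg (x - 1)]⟩)

lemma abs_stdPdf₂_le (x : ℝ) : |stdPdf₂ x| ≤ 1 :=
  abs_mul_stdPdf_le (p := fun x => x ^ 2 - 1)
    (abs_le.2 ⟨by nlinarith [sq_nonneg x], by nlinarith [sq_nonneg x]⟩)

lemma hasDerivAt_stdPdf (x : ℝ) : HasDerivAt stdPdf (-x * stdPdf x) x := by
  have h : HasDerivAt (fun x : ℝ => -x ^ 2 / 2) (-x) x := by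
    have := ((hasDerivAt_pow 2 x).neg).div_const 2
    exact this.congr_deriv (by norm_num; ring)
  have := (h.exp).const_mul (√(2 * Real.pi))⁻¹
  exact this.congr_deriv (by unfold stdPdf; ring)

lemma hasDerivAt_neg_mul_stdPdf (x : ℝ) :
    HasDerivAt (fun x => -x * stdPdf x) (stdPdf₂ x) x := by
  have := ((hasDerivAt_id x).neg).mul (hasDerivAt_stdPdf x)
  exact this.congr_deriv (by unfold stdPdf₂; simp; ring)

lemma hasDerivAt_stdPdf₂ (x : ℝ) : HasDerivAt stdPdf₂ (stdPdf₃ x) x := by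
  have := (((hasDerivAt_pow 2 x).sub_const 1)).mul (hasDerivAt_stdPdf x)
  exact this.congr_deriv (by unfold stdPdf₃; simp; ring)

lemma continuous_stdPdf : Continuous stdPdf := by unfold stdPdf; fun_prop
lemma continuous_stdPdf₂ : Continuous stdPdf₂ := by
  unfold stdPdf₂; exact (by fun_prop : Continuous fun x : ℝ => x ^ 2 - 1).mul continuous_stdPdf

lemma integrable_stdPdf : Integrable stdPdf := by
  rw [← stdPdf_eq]; exact integrable_gaussianPDFReal 0 1

lemma stdCdf_eq (x : ℝ) : stdCdf x = ∫ t in Set.Iic x, stdPdf t := by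
  unfold stdCdf
  rw [Measure.real, gaussianReal_apply_eq_integral 0 one_ne_zero, stdPdf_eq,
    ENNReal.toReal_ofReal (integral_nonneg fun t => stdPdf_nonneg t)]

lemma hasDerivAt_stdCdf (x : ℝ) : HasDerivAt stdCdf (stdPdf x) x := by
  have h : stdCdf = fun x => (∫ t in Set.Iic (0 : ℝ), stdPdf t) + ∫ t in (0 : ℝ)..x, stdPdf t := by
    ext x
    rw [stdCdf_eq, ← intervalIntegral.integral_Iic_sub_Iic integrable_stdPdf.integrableOn
      integrable_stdPdf.integrableOn]
    ring
  rw [h]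
  exact (intervalIntegral.integral_hasDerivAt_right (integrable_stdPdf.intervalIntegrable)
    (continuous_stdPdf.stronglyMeasurableAtFilter _ _) continuous_stdPdf.continuousAt).const_add _

lemma stdCdf_nonneg (x : ℝ) : 0 ≤ stdCdf x := measureReal_nonneg
lemma stdCdf_le_one (x : ℝ) : stdCdf x ≤ 1 := measureReal_le_one

lemma stdCdf_neg (x : ℝ) : stdCdf (-x) = 1 - stdCdf x := by
  unfold stdCdf
  have h1 : (gaussianReal 0 1).real (Set.Iic (-x)) = (gaussianReal 0 1).real (Set.Ioi x) := by
    have := gaussianReal_map_neg (μ := 0) (v := 1)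
    rw [neg_zero] at this
    conv_lhs => rw [← this]
    rw [map_measureReal_apply (by fun_prop) measurableSet_Iic]
    have h2 : (fun x : ℝ => -x) ⁻¹' Set.Iic (-x) = Set.Ici x := by ext y; simp
    rw [h2]
    have := nullSingletonClass_gaussianReal (μ := 0) (v := 1) one_ne_zero
    exact (measureReal_congr Ioi_ae_eq_Ici).symm
  rw [h1, ← Set.compl_Iic, probReal_compl_eq_one_sub measurableSet_Iic]

lemma abs_stdCdf_sub_le (x y : ℝ) : |stdCdf x - stdCdf y| ≤ |x - y| := by
  have := Convex.norm_image_sub_le_of_norm_hasDerivWithin_le (s := Set.univ) (x := y) (y := x)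
    (C := 1) (fun x _ => (hasDerivAt_stdCdf x).hasDerivWithinAt)
    (fun x _ => by rw [Real.norm_of_nonneg (stdPdf_nonneg x)]; exact stdPdf_le_one x)
    convex_univ trivial trivial
  simpa using this

lemma integrable_stdPdf₃ : Integrable stdPdf₃ := by
  have h (k : ℕ) : Integrable fun x : ℝ => x ^ k * stdPdf x := by
    have := integrable_rpow_mul_exp_neg_mul_sq (b := 1 / 2) (by norm_num) (s := k)
      (by have : (0 : ℝ) ≤ k := k.cast_nonneg
          linarith)
    refine (this.const_mul (√(2 * Real.pi))⁻¹).congr (.of_forall fun x => ?_)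
    simp only [stdPdf, Real.rpow_natCast]
    rw [show -x ^ 2 / 2 = -(1 / 2) * x ^ 2 by ring]; ring
  refine (((h 1).const_mul 3).sub (h 3)).congr (.of_forall fun x => ?_)
  simp [stdPdf₃]; ring

/-- Writing the second derivative as an integral over a half-line lets Fubini turn an integral
against a measure into one against its distribution function. -/
lemma stdPdf₂_eq (x : ℝ) : stdPdf₂ x = ∫ t in Set.Iic x, stdPdf₃ t := by
  have hlim : Filter.Tendsto stdPdf₂ Filter.atBot (nhds 0) := by
    have hb : ∀ x : ℝ, |stdPdf₂ x| ≤ 8 * (1 + |x|)⁻¹ := fun x => by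
      -- The exponent is split in two equal halves: one absorbs the quadratic polynomial, the other
      -- supplies the decay at infinity.
      have h1 : Real.exp (-x ^ 2 / 2) ≤ ((1 + x ^ 2 / 4) ^ 2)⁻¹ := by
        rw [show -x ^ 2 / 2 = -(x ^ 2 / 4 + x ^ 2 / 4) by ring, Real.exp_neg, Real.exp_add]
        apply inv_anti₀ (by positivity)
        have := Real.add_one_le_exp (x ^ 2 / 4)
        nlinarith [sq_nonneg x]
      have h2 : |x ^ 2 - 1| ≤ 4 * (1 + x ^ 2 / 4) :=
        abs_le.2 ⟨by nlinarith [sq_nonneg x], by nlinarith [sq_nonneg x]⟩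
      have h3 : 1 + |x| ≤ 4 * (1 + x ^ 2 / 4) := by
        rw [← sq_abs]; nlinarith [sq_nonneg (|x| - 1)]
      have h0 := abs_nonneg x
      unfold stdPdf₂ stdPdf
      rw [abs_mul, abs_of_nonneg (a := (√(2 * Real.pi))⁻¹ * _) (by positivity)]
      calc _ ≤ (4 * (1 + x ^ 2 / 4)) * (1 / 2 * ((1 + x ^ 2 / 4) ^ 2)⁻¹) := by
            gcongr
            exact inv_sqrt_two_pi_le
        _ = 8 * (4 * (1 + x ^ 2 / 4))⁻¹ := by field_simp; norm_num
        _ ≤ _ := by gcongr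
    apply squeeze_zero_norm hb
    have : Filter.Tendsto (fun x : ℝ => 1 + |x|) Filter.atBot Filter.atTop :=
      Filter.tendsto_atTop_add_const_left _ _ Filter.tendsto_abs_atBot_atTop
    simpa using this.inv_tendsto_atTop.const_mul 8
  have := integral_Iic_of_hasDerivAt_of_tendsto (a := x)
    continuous_stdPdf₂.continuousWithinAt (fun x _ => hasDerivAt_stdPdf₂ x)
    integrable_stdPdf₃.integrableOn hlim
  rw [this, sub_zero]

lemma integral_id_gauss : ∫ x, x ∂gaussianReal 0 1 = 0 := integral_id_gaussianReal

lemma integrable_pow_gauss (k : ℕ) : Integrable (fun x : ℝ => |x| ^ k) (gaussianReal 0 1) := by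
  have := (memLp_id_gaussianReal' (μ := 0) (v := 1) (k : ENNReal) (by simp)).integrable_norm_pow'
  simpa using this

lemma integral_sq_gauss : ∫ x, x ^ 2 ∂gaussianReal 0 1 = 1 := by
  have h := variance_fun_id_gaussianReal (μ := 0) (v := 1)
  rw [variance_eq_integral (by fun_prop)] at h
  simpa [integral_id_gauss] using h

lemma gaussianReal_real_Iic {v : NNReal} (hv : v ≠ 0) (x : ℝ) :
    (gaussianReal 0 v).real (Set.Iic x) = stdCdf (x / √v) := by
  have hv' : 0 < √(v : ℝ) := Real.sqrt_pos.2 (by positivity)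
  have := gaussianReal_map_const_mul (μ := 0) (v := 1) (√v)
  rw [mul_zero, mul_one] at this
  have h2 : NNReal.mk ((√(v : ℝ)) ^ 2) (sq_nonneg _) = v := by
    ext; simp
  rw [h2] at this
  rw [← this, map_measureReal_apply (by fun_prop) measurableSet_Iic, stdCdf]
  congr 1
  ext y
  simp [le_div_iff₀ hv', mul_comm]

/-- Both sides are the distribution function of a sum of independent centred normals with variances
s and v. Gaussian averaging therefore only changes the scale. -/
lemma integral_stdCdf_gaussianReal {s : ℝ} (hs : 0 < s) (v : NNReal) (b : ℝ) :
    ∫ w, stdCdf ((b - w) / √s) ∂gaussianReal 0 v = stdCdf (b / √(s + v)) := by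
  lift s to NNReal using hs.le
  have hs' : s ≠ 0 := by rintro rfl; simp at hs
  have h := gaussianReal_conv_gaussianReal (m₁ := 0) (m₂ := 0) (v₁ := v) (v₂ := s)
  rw [zero_add] at h
  have h2 : (gaussianReal 0 v ∗ gaussianReal 0 s).real (Set.Iic b)
      = ∫ w, (gaussianReal 0 s).real (Set.Iic (b - w)) ∂gaussianReal 0 v := by
    rw [← integral_indicator_one measurableSet_Iic, integral_conv]
    · congr 1; ext w
      rw [← integral_indicator_one measurableSet_Iic]
      congr 1; ext y
      simp [Set.indicator, le_sub_iff_add_le']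
    · exact (integrable_const 1).indicator measurableSet_Iic
  rw [h, gaussianReal_real_Iic (by simp [hs'])] at h2
  simp_rw [gaussianReal_real_Iic hs'] at h2
  rw [← h2, add_comm]; simp

/-! ### Standardised laws and the Lindeberg comparison -/

/-- Laws on the line with mean zero, unit variance and a finite third absolute moment. -/
class IsStdLaw (μ : Measure ℝ) : Prop extends IsProbabilityMeasure μ where
  integrable_cube : Integrable (fun x => |x| ^ 3) μ
  mean : ∫ x, x ∂μ = 0
  sq : ∫ x, x ^ 2 ∂μ = 1

/-- The third absolute moment. -/
noncomputable def thirdMoment (μ : Measure ℝ) : ℝ := ∫ x, |x| ^ 3 ∂μ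

instance : IsStdLaw (gaussianReal 0 1) where
  integrable_cube := integrable_pow_gauss 3
  mean := integral_id_gauss
  sq := integral_sq_gauss

namespace IsStdLaw

variable (μ : Measure ℝ) [IsStdLaw μ]

lemma integrable_sq : Integrable (fun x : ℝ => x ^ 2) μ := by
  refine ((integrable_const 1).add (integrable_cube (μ := μ))).mono' (by fun_prop)
    (.of_forall fun x => ?_)
  simp only [Pi.add_apply, norm_pow, Real.norm_eq_abs]
  rcases le_total |x| 1 with h | h
  · nlinarith [abs_nonneg x, pow_nonneg (abs_nonneg x) 3]
  · nlinarith [abs_nonneg x, pow_nonneg (abs_nonneg x) 2]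

lemma integrable_abs : Integrable (fun x : ℝ => |x|) μ := by
  refine ((integrable_const 1).add (integrable_sq μ)).mono' (by fun_prop)
    (.of_forall fun x => ?_)
  simp only [Pi.add_apply, Real.norm_eq_abs, abs_abs]
  rw [← sq_abs]
  nlinarith [sq_nonneg (|x| - 1)]

lemma integrable_id : Integrable (fun x : ℝ => x) μ :=
  (integrable_abs μ).mono' (by fun_prop) (.of_forall fun _ => le_rfl)

lemma one_le_thirdMoment : 1 ≤ thirdMoment μ := by
  -- Pointwise this is (|x| - 1)²(2|x| + 1) ≥ 0.
  have h : ∫ x, 3 * x ^ 2 ∂μ ≤ ∫ x, 2 * |x| ^ 3 + 1 ∂μ := by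
    refine integral_mono ((integrable_sq μ).const_mul 3)
      ((integrable_cube.const_mul 2).add (integrable_const 1)) fun x => ?_
    simp only
    rw [← sq_abs]
    nlinarith [mul_nonneg (sq_nonneg (|x| - 1)) (by positivity : 0 ≤ 2 * |x| + 1)]
  rw [integral_const_mul, sq, integral_add (integrable_cube.const_mul 2) (integrable_const 1),
    integral_const_mul] at h
  simp only [integral_const, probReal_univ, smul_eq_mul] at h
  unfold thirdMoment
  linarith

end IsStdLaw

lemma abs_sub_le_of_hasDerivAt_le {f f' : ℝ → ℝ} {C r x : ℝ} (hf : ∀ y, HasDerivAt f (f' y) y)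
    (hx : |x| ≤ r) (hb : ∀ y, |y| ≤ r → |f' y| ≤ C) : |f x - f 0| ≤ C * |x| := by
  have h0 : 0 ≤ r := (abs_nonneg x).trans hx
  have := (convex_Icc (-r) r).norm_image_sub_le_of_norm_hasDerivWithin_le (x := 0) (y := x) (C := C)
    (fun y _ => (hf y).hasDerivWithinAt) (fun y hy => hb y (abs_le.2 hy))
    ⟨by linarith, h0⟩ (abs_le.1 hx)
  simpa using this

lemma abs_sub_taylor_one_le {f f₁ f₂ : ℝ → ℝ} {B : ℝ} (h : ∀ y, HasDerivAt f (f₁ y) y)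
    (h₁ : ∀ y, HasDerivAt f₁ (f₂ y) y) (hB : ∀ y, |f₂ y| ≤ B) (x : ℝ) :
    |f x - f 0 - f₁ 0 * x| ≤ B * x ^ 2 := by
  have hB0 : 0 ≤ B := (abs_nonneg _).trans (hB 0)
  have hd : ∀ y, HasDerivAt (fun y => f y - f₁ 0 * y) (f₁ y - f₁ 0) y := fun y => by
    exact ((h y).sub ((hasDerivAt_id y).const_mul (f₁ 0))).congr_deriv (by simp)
  have := abs_sub_le_of_hasDerivAt_le (C := B * |x|) hd (le_refl |x|) fun y hy =>
    (abs_sub_le_of_hasDerivAt_le h₁ hy fun z _ => hB z).trans (by gcongr)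
  rw [mul_assoc, ← sq, sq_abs] at this
  convert this using 2
  ring

lemma abs_sub_taylor_two_le {f f₁ f₂ f₃ : ℝ → ℝ} {B : ℝ} (h : ∀ y, HasDerivAt f (f₁ y) y)
    (h₁ : ∀ y, HasDerivAt f₁ (f₂ y) y) (h₂ : ∀ y, HasDerivAt f₂ (f₃ y) y)
    (hB : ∀ y, |f₃ y| ≤ B) (x : ℝ) :
    |f x - (f 0 + f₁ 0 * x + f₂ 0 / 2 * x ^ 2)| ≤ B * |x| ^ 3 := by
  have hB0 : 0 ≤ B := (abs_nonneg _).trans (hB 0)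
  have hd : ∀ y, HasDerivAt (fun y => f y - (f₁ 0 * y + f₂ 0 / 2 * y ^ 2))
      (f₁ y - f₁ 0 - f₂ 0 * y) y := fun y => by
    refine ((h y).sub (((hasDerivAt_id y).const_mul (f₁ 0)).add
      ((hasDerivAt_pow 2 y).const_mul (f₂ 0 / 2)))).congr_deriv ?_
    simp; ring
  have := abs_sub_le_of_hasDerivAt_le (C := B * |x| ^ 2) hd (le_refl |x|) fun y hy =>
    (abs_sub_taylor_one_le h₁ h₂ hB y).trans (by rw [← sq_abs y]; gcongr)
  rw [mul_assoc, ← pow_succ] at this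
  convert this using 2
  ring

/-- Lindeberg's comparison of two standardised laws on a function with bounded third derivative. -/
lemma abs_integral_sub_integral_le_of_stdLaw (μ ν : Measure ℝ) [IsStdLaw μ] [IsStdLaw ν]
    {f f₁ f₂ f₃ : ℝ → ℝ} {B : ℝ} (h : ∀ y, HasDerivAt f (f₁ y) y)
    (h₁ : ∀ y, HasDerivAt f₁ (f₂ y) y) (h₂ : ∀ y, HasDerivAt f₂ (f₃ y) y)
    (hB : ∀ y, |f₃ y| ≤ B) :
    |∫ x, f x ∂μ - ∫ x, f x ∂ν| ≤ B * (thirdMoment μ + thirdMoment ν) := by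
  have hf : Continuous f := continuous_iff_continuousAt.2 fun x => (h x).continuousAt
  -- The second-order Taylor polynomial at 0 has the same integral under every standardised law, so
  -- both laws are compared with that number.
  have key : ∀ (ρ : Measure ℝ) [IsStdLaw ρ],
      |∫ x, f x ∂ρ - (f 0 + f₂ 0 / 2)| ≤ B * thirdMoment ρ := fun ρ _ => by
    set T : ℝ → ℝ := fun x => f 0 + f₁ 0 * x + f₂ 0 / 2 * x ^ 2
    have i1 : Integrable (fun x => f 0 + f₁ 0 * x) ρ :=
      (integrable_const _).add ((IsStdLaw.integrable_id ρ).const_mul _)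
    have i2 : Integrable (fun x => f₂ 0 / 2 * x ^ 2) ρ := (IsStdLaw.integrable_sq ρ).const_mul _
    have hT : Integrable T ρ := i1.add i2
    have hTi : ∫ x, T x ∂ρ = f 0 + f₂ 0 / 2 := by
      simp only [T]
      rw [integral_add i1 i2, integral_add (integrable_const _)
        ((IsStdLaw.integrable_id ρ).const_mul _), integral_const_mul, integral_const_mul,
        IsStdLaw.mean, IsStdLaw.sq]
      simp
    have hb := abs_sub_taylor_two_le h h₁ h₂ hB
    have hd : Integrable (fun x => f x - T x) ρ :=
      (IsStdLaw.integrable_cube.const_mul B).mono' (by fun_prop)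
      (.of_forall fun x => by simpa only [Real.norm_eq_abs] using hb x)
    have hfi : Integrable f ρ := (hd.add hT).congr (.of_forall fun x => by simp)
    rw [← hTi, ← integral_sub hfi hT, thirdMoment, ← integral_const_mul]
    exact norm_integral_le_of_norm_le (G := ℝ) (IsStdLaw.integrable_cube.const_mul B)
      (.of_forall hb)
  have h1 := abs_le.1 (key μ)
  have h2 := abs_le.1 (key ν)
  exact abs_le.2 ⟨by linarith, by linarith⟩

/-! ### Smoothing a finite measure by a Gaussian -/

lemma hasDerivAt_integral_comp_sub (ρ : Measure ℝ) [IsFiniteMeasure ρ] {f f' : ℝ → ℝ} {A A' : ℝ}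
    (h : ∀ y, HasDerivAt f (f' y) y) (hA : ∀ y, |f y| ≤ A) (hA' : ∀ y, |f' y| ≤ A') (a : ℝ) :
    HasDerivAt (fun a => ∫ w, f (a - w) ∂ρ) (∫ w, f' (a - w) ∂ρ) a := by
  have hf : Continuous f := continuous_iff_continuousAt.2 fun x => (h x).continuousAt
  have hf' : Measurable f' := by
    have : f' = deriv f := funext fun x => (h x).deriv.symm
    rw [this]; exact measurable_deriv f
  refine (hasDerivAt_integral_of_dominated_loc_of_deriv_le (F := fun a w => f (a - w))
    (F' := fun a w => f' (a - w)) (bound := fun _ => A') Filter.univ_mem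
    (.of_forall fun x => (by fun_prop)) ?_ ?_ (.of_forall fun w x _ => hA' _)
    (integrable_const _) (.of_forall fun w x _ => ?_)).2
  · exact (integrable_const A).mono' (by fun_prop) (.of_forall fun w => hA _)
  · exact (hf'.comp (measurable_const.sub measurable_id)).aestronglyMeasurable
  · simpa using (h (x - w)).comp_sub_const x w

/-- The normal distribution function with standard deviation `r`. -/
noncomputable def scaledCdf (r : ℝ) (y : ℝ) : ℝ := stdCdf (y / r)

/-- The first derivative of `scaledCdf r`. -/
noncomputable def scaledCdf₁ (r : ℝ) (y : ℝ) : ℝ := stdPdf (y / r) / r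

/-- The second derivative of `scaledCdf r`. -/
noncomputable def scaledCdf₂ (r : ℝ) (y : ℝ) : ℝ := -(y / r) * stdPdf (y / r) / r ^ 2

/-- The third derivative of `scaledCdf r`. -/
noncomputable def scaledCdf₃ (r : ℝ) (y : ℝ) : ℝ := stdPdf₂ (y / r) / r ^ 3

lemma hasDerivAt_scaledCdf {r : ℝ} (y : ℝ) : HasDerivAt (scaledCdf r) (scaledCdf₁ r y) y := by
  have := (hasDerivAt_stdCdf (y / r)).comp y ((hasDerivAt_id y).div_const r)
  exact this.congr_deriv (by simp [scaledCdf₁]; ring)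

lemma hasDerivAt_scaledCdf₁ {r : ℝ} (hr : 0 < r) (y : ℝ) : HasDerivAt (scaledCdf₁ r) (scaledCdf₂ r y) y := by
  have := ((hasDerivAt_stdPdf (y / r)).comp y ((hasDerivAt_id y).div_const r)).div_const r
  exact this.congr_deriv (by simp only [scaledCdf₂]; field_simp)

lemma hasDerivAt_scaledCdf₂ {r : ℝ} (hr : 0 < r) (y : ℝ) : HasDerivAt (scaledCdf₂ r) (scaledCdf₃ r y) y := by
  have := ((hasDerivAt_neg_mul_stdPdf (y / r)).comp y
    ((hasDerivAt_id y).div_const r)).div_const (r ^ 2)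
  exact this.congr_deriv (by simp only [scaledCdf₃]; field_simp)

lemma abs_scaledCdf_le {r : ℝ} (y : ℝ) : |scaledCdf r y| ≤ 1 := by
  rw [scaledCdf, abs_of_nonneg (stdCdf_nonneg _)]; exact stdCdf_le_one _

lemma abs_scaledCdf₁_le {r : ℝ} (hr : 0 < r) (y : ℝ) : |scaledCdf₁ r y| ≤ 1 / r := by
  rw [scaledCdf₁, abs_div, abs_of_pos hr, abs_of_nonneg (stdPdf_nonneg _)]
  gcongr; exact stdPdf_le_one _

lemma abs_scaledCdf₂_le {r : ℝ} (hr : 0 < r) (y : ℝ) : |scaledCdf₂ r y| ≤ 1 / r ^ 2 := by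
  rw [scaledCdf₂, abs_div, abs_of_pos (a := r ^ 2) (by positivity), neg_mul, abs_neg]
  gcongr; exact abs_id_mul_stdPdf_le _

lemma abs_scaledCdf₃_le {r : ℝ} (hr : 0 < r) (y : ℝ) : |scaledCdf₃ r y| ≤ 1 / r ^ 3 := by
  rw [scaledCdf₃, abs_div, abs_of_pos (a := r ^ 3) (by positivity)]
  gcongr; exact abs_stdPdf₂_le _

lemma continuous_scaledCdf {r : ℝ} : Continuous (scaledCdf r) :=
  continuous_iff_continuousAt.2 fun x => (hasDerivAt_scaledCdf x).continuousAt

lemma integrable_scaledCdf_sub {r : ℝ} (ρ : Measure ℝ) [IsFiniteMeasure ρ] (a : ℝ) :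
    Integrable (fun w => scaledCdf r (a - w)) ρ :=
  (integrable_const (1 : ℝ)).mono'
    (by have := continuous_scaledCdf (r := r); exact (by fun_prop : Continuous _).aestronglyMeasurable)
    (.of_forall fun _ => abs_scaledCdf_le _)

/-- Lindeberg's comparison for a Gaussian-smoothed measure. -/
lemma lindeberg_smoothed {r : ℝ} (hr : 0 < r) (μ ρ : Measure ℝ) [IsStdLaw μ] [IsFiniteMeasure ρ] {B : ℝ}
    (hB : ∀ a, |∫ w, scaledCdf₃ r (a - w) ∂ρ| ≤ B) (z : ℝ) :
    |(∫ x, ∫ w, scaledCdf r (z - x - w) ∂ρ ∂μ)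
      - ∫ x, ∫ w, scaledCdf r (z - x - w) ∂ρ ∂gaussianReal 0 1|
      ≤ B * (thirdMoment μ + thirdMoment (gaussianReal 0 1)) := by
  have d0 := hasDerivAt_integral_comp_sub ρ (hasDerivAt_scaledCdf) abs_scaledCdf_le
    (abs_scaledCdf₁_le hr)
  have d1 := hasDerivAt_integral_comp_sub ρ (hasDerivAt_scaledCdf₁ hr) (abs_scaledCdf₁_le hr)
    (abs_scaledCdf₂_le hr)
  have d2 := hasDerivAt_integral_comp_sub ρ (hasDerivAt_scaledCdf₂ hr) (abs_scaledCdf₂_le hr)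
    (abs_scaledCdf₃_le hr)
  -- The test function is already averaged over `ρ`, and its third derivative is bounded as an
  -- average. A supremum inside the integral would lose the smoothing that `ρ` itself provides.
  refine abs_integral_sub_integral_le_of_stdLaw μ (gaussianReal 0 1)
    (f₁ := fun x => -∫ w, scaledCdf₁ r (z - x - w) ∂ρ)
    (f₂ := fun x => ∫ w, scaledCdf₂ r (z - x - w) ∂ρ)
    (f₃ := fun x => -∫ w, scaledCdf₃ r (z - x - w) ∂ρ)
    (fun y => (d0 (z - y)).comp_const_sub z y)
    (fun y => ((d1 (z - y)).comp_const_sub z y).neg.congr_deriv (by simp))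
    (fun y => (d2 (z - y)).comp_const_sub z y)
    (fun y => by rw [abs_neg]; exact hB _)

/-- Variances add at the level of distribution functions; the identity is then differentiated three
times in `a`, using uniqueness of derivatives. -/
lemma integral_scaledCdf₃_gaussianReal {r : ℝ} (hr : 0 < r) (v : NNReal) (a : ℝ) :
    ∫ w, scaledCdf₃ r (a - w) ∂gaussianReal 0 v = scaledCdf₃ (√(r ^ 2 + v)) a := by
  set q := √(r ^ 2 + v)
  have hq : 0 < q := by positivity
  have e0 : ∀ a, ∫ w, scaledCdf r (a - w) ∂gaussianReal 0 v = scaledCdf q a := fun a => by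
    have := integral_stdCdf_gaussianReal (s := r ^ 2) (by positivity) v a
    rw [Real.sqrt_sq hr.le] at this
    exact this
  have e1 : ∀ a, ∫ w, scaledCdf₁ r (a - w) ∂gaussianReal 0 v = scaledCdf₁ q a := fun a => by
    have d0 := hasDerivAt_integral_comp_sub (gaussianReal 0 v) (hasDerivAt_scaledCdf)
      abs_scaledCdf_le (abs_scaledCdf₁_le hr) a
    rw [funext e0] at d0
    exact d0.unique (hasDerivAt_scaledCdf a)
  have e2 : ∀ a, ∫ w, scaledCdf₂ r (a - w) ∂gaussianReal 0 v = scaledCdf₂ q a := fun a => by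
    have d0 := hasDerivAt_integral_comp_sub (gaussianReal 0 v) (hasDerivAt_scaledCdf₁ hr)
      (abs_scaledCdf₁_le hr) (abs_scaledCdf₂_le hr) a
    rw [funext e1] at d0
    exact d0.unique (hasDerivAt_scaledCdf₁ hq a)
  have d0 := hasDerivAt_integral_comp_sub (gaussianReal 0 v) (hasDerivAt_scaledCdf₂ hr)
    (abs_scaledCdf₂_le hr) (abs_scaledCdf₃_le hr) a
  rw [funext e2] at d0
  exact d0.unique (hasDerivAt_scaledCdf₂ hq a)

lemma scaledCdf_integral_gaussianReal_one {r : ℝ} (hr : 0 < r) (a : ℝ) :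
    ∫ x, scaledCdf r (a - x) ∂gaussianReal 0 1 = scaledCdf (√(r ^ 2 + 1)) a := by
  have := integral_stdCdf_gaussianReal (s := r ^ 2) (by positivity) 1 a
  rw [Real.sqrt_sq hr.le] at this
  simpa [scaledCdf] using this

/-- The total variation of the second derivative of the normal density. -/
noncomputable def stdPdf₂Var : ℝ := ∫ t, |stdPdf₃ t|

lemma stdPdf₂Var_nonneg : 0 ≤ stdPdf₂Var := integral_nonneg fun _ => abs_nonneg _

/-- Integration by parts in the form of Fubini: `ρ` now enters only through its distribution
function, so Kolmogorov distance controls the change when `ρ` is replaced. -/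
lemma integral_scaledCdf₃_eq {r : ℝ} (hr : 0 < r) (ρ : Measure ℝ) [IsFiniteMeasure ρ] (a : ℝ) :
    ∫ w, scaledCdf₃ r (a - w) ∂ρ = (∫ t, stdPdf₃ t * ρ.real (Set.Iic (a - t * r))) / r ^ 3 := by
  have hset : MeasurableSet {p : ℝ × ℝ | p.2 ≤ (a - p.1) / r} :=
    measurableSet_le (by fun_prop) (by fun_prop)
  have hswap : ∫ w, (∫ t, ({p : ℝ × ℝ | p.2 ≤ (a - p.1) / r}.indicator
        (fun p => stdPdf₃ p.2) (w, t))) ∂ρ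
      = ∫ t, (∫ w, ({p : ℝ × ℝ | p.2 ≤ (a - p.1) / r}.indicator
        (fun p => stdPdf₃ p.2) (w, t)) ∂ρ) := by
    apply integral_integral_swap
    exact (integrable_stdPdf₃.comp_snd ρ).indicator hset
  have h1 : ∀ w, (∫ t, ({p : ℝ × ℝ | p.2 ≤ (a - p.1) / r}.indicator
        (fun p => stdPdf₃ p.2) (w, t))) = stdPdf₂ ((a - w) / r) := fun w => by
    rw [stdPdf₂_eq, ← integral_indicator measurableSet_Iic]
    rfl
  have h2 : ∀ t, (∫ w, ({p : ℝ × ℝ | p.2 ≤ (a - p.1) / r}.indicator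
        (fun p => stdPdf₃ p.2) (w, t)) ∂ρ) = stdPdf₃ t * ρ.real (Set.Iic (a - t * r)) := fun t => by
    have : (fun w => ({p : ℝ × ℝ | p.2 ≤ (a - p.1) / r}.indicator (fun p => stdPdf₃ p.2) (w, t)))
        = (Set.Iic (a - t * r)).indicator (fun _ => stdPdf₃ t) := by
      ext w
      simp only [Set.indicator, Set.mem_ofPred_eq, Set.mem_Iic, le_div_iff₀ hr]
      congr 1
      exact propext ⟨fun h => by linarith, fun h => by linarith⟩
    rw [this, integral_indicator_const _ measurableSet_Iic, smul_eq_mul, mul_comm]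
  simp_rw [h1, h2] at hswap
  rw [← hswap]
  simp_rw [scaledCdf₃]
  rw [integral_div]

lemma abs_integral_scaledCdf₃_sub_le {r : ℝ} (hr : 0 < r) (ρ ν : Measure ℝ) [IsFiniteMeasure ρ] [IsFiniteMeasure ν]
    {D : ℝ} (hD : ∀ x, |ρ.real (Set.Iic x) - ν.real (Set.Iic x)| ≤ D) (a : ℝ) :
    |∫ w, scaledCdf₃ r (a - w) ∂ρ - ∫ w, scaledCdf₃ r (a - w) ∂ν| ≤ D * stdPdf₂Var / r ^ 3 := by
  have hi : ∀ (ρ : Measure ℝ) [IsFiniteMeasure ρ],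
      Integrable fun t => stdPdf₃ t * ρ.real (Set.Iic (a - t * r)) := fun ρ _ => by
    refine integrable_stdPdf₃.mul_bdd (c := ρ.real Set.univ) ?_ (.of_forall fun t => ?_)
    · have : Monotone fun x => ρ.real (Set.Iic x) := fun x y h =>
        measureReal_mono (Set.Iic_subset_Iic.2 h)
      exact (this.measurable.comp (by fun_prop : Measurable fun t => a - t * r)).aestronglyMeasurable
    · rw [Real.norm_of_nonneg measureReal_nonneg]
      exact measureReal_mono (Set.subset_univ _)
  rw [integral_scaledCdf₃_eq hr, integral_scaledCdf₃_eq hr, ← sub_div, abs_div,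
    abs_of_pos (a := r ^ 3) (by positivity), ← integral_sub (hi ρ) (hi ν)]
  gcongr
  rw [stdPdf₂Var, ← integral_const_mul]
  refine norm_integral_le_of_norm_le (G := ℝ) (integrable_stdPdf₃.abs.const_mul D)
    (.of_forall fun t => ?_)
  rw [← mul_sub, norm_mul, mul_comm, Real.norm_eq_abs, Real.norm_eq_abs]
  gcongr
  exact hD _

/-! ### Convolution powers and the Berry–Esseen inequality -/

/-- The `n`-fold convolution power of a measure. -/
noncomputable def convPow (μ : Measure ℝ) : ℕ → Measure ℝ
  | 0 => Measure.dirac 0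
  | n + 1 => convPow μ n ∗ μ

instance convPow.isProbabilityMeasure (μ : Measure ℝ) [IsProbabilityMeasure μ] (n : ℕ) :
    IsProbabilityMeasure (convPow μ n) := by
  induction n with
  | zero => unfold convPow; infer_instance
  | succ n ih => unfold convPow; infer_instance

lemma conv_real_Iic (ρ ν : Measure ℝ) [IsFiniteMeasure ρ] [IsFiniteMeasure ν] (z : ℝ) :
    (ρ ∗ ν).real (Set.Iic z) = ∫ w, ν.real (Set.Iic (z - w)) ∂ρ := by
  rw [← integral_indicator_one measurableSet_Iic, integral_conv]
  · congr 1; ext w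
    rw [← integral_indicator_one measurableSet_Iic]
    congr 1; ext y
    simp [Set.indicator, le_sub_iff_add_le']
  · exact (integrable_const 1).indicator measurableSet_Iic

lemma measurable_real_Iic (ρ : Measure ℝ) [IsFiniteMeasure ρ] :
    Measurable fun x => ρ.real (Set.Iic x) :=
  Monotone.measurable fun _ _ h => measureReal_mono (Set.Iic_subset_Iic.2 h)

lemma conv_gaussianReal_real_Iic (ρ : Measure ℝ) [IsFiniteMeasure ρ] {v : NNReal} (hv : v ≠ 0)
    (z : ℝ) : (ρ ∗ gaussianReal 0 v).real (Set.Iic z) = ∫ w, scaledCdf (√v) (z - w) ∂ρ := by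
  rw [conv_real_Iic]
  simp_rw [gaussianReal_real_Iic hv, scaledCdf]

lemma sum_inv_sqrt_cube_le {e : ℝ} (he : 1 ≤ e) (n : ℕ) :
    ∑ j ∈ Finset.range n, 1 / √(j + e) ^ 3 ≤ 6 / √e := by
  -- A telescoping majorant. With x = √a and y = √(a+1) one has y - x = 1/(x + y) and y ≤ 2x, whence
  -- y(x + y) ≤ 6x²; this is the source of 6.
  have key : ∀ a : ℝ, 1 ≤ a → 1 / √a ^ 3 ≤ 6 / √a - 6 / √(a + 1) := fun a ha => by
    set x := √a
    set y := √(a + 1)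
    have hx : 1 ≤ x := Real.one_le_sqrt.2 ha
    have hxy : x ≤ y := Real.sqrt_le_sqrt (by linarith)
    have e1 : x ^ 2 = a := Real.sq_sqrt (by linarith)
    have e2 : y ^ 2 = a + 1 := Real.sq_sqrt (by linarith)
    have h1 : (y - x) * (x + y) = 1 := by linarith [e1, e2, sq_nonneg x]
    have h2 : y ≤ 2 * x := by nlinarith
    rw [div_sub_div _ _ (by positivity) (by positivity), div_le_div_iff₀ (by positivity)
      (by positivity)]
    have h3 : y * (x + y) ≤ 6 * x ^ 2 := by nlinarith
    have h4 : y ≤ 6 * x ^ 2 * (y - x) := by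
      calc y = y * (x + y) * (y - x) := by linear_combination (-y) * h1
        _ ≤ _ := by gcongr
    calc 1 * (x * y) = x * y := by ring
      _ ≤ x * (6 * x ^ 2 * (y - x)) := by gcongr
      _ = _ := by ring
  have : ∑ j ∈ Finset.range n, 1 / √(j + e) ^ 3 ≤ 6 / √e - 6 / √(n + e) := by
    induction n with
    | zero => simp
    | succ n ih =>
      rw [Finset.sum_range_succ]
      have := key (n + e) (by have : (0 : ℝ) ≤ n := n.cast_nonneg
                              linarith)
      rw [Nat.cast_succ, show (n : ℝ) + 1 + e = n + e + 1 by ring]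
      linarith
  have h0 : 0 ≤ 6 / √(n + e) := by positivity
  linarith

section BerryEsseen

/-- Chebyshev's inequality through a quadratic minorant: g(z - y) ≥ A - (A + D) y²/(4v) holds within
two standard deviations, where g ≥ A, and beyond them, where g ≥ -D. The integral of y² is v. -/
lemma integral_ge_of_ge_near {g : ℝ → ℝ} {A D z : ℝ} {v : NNReal} (hv : v ≠ 0) (hA : 0 ≤ A)
    (hg : Measurable g) (hD : ∀ t, |g t| ≤ D) (hgA : ∀ y, |y| ≤ 2 * √v → A ≤ g (z - y)) :
    A - (A + D) / 4 ≤ ∫ y, g (z - y) ∂gaussianReal 0 v := by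
  have hv' : 0 < (v : ℝ) := by positivity
  have hD0 : 0 ≤ D := (abs_nonneg _).trans (hD 0)
  have hsq : ∫ y, y ^ 2 ∂gaussianReal 0 v = v := by
    have h := variance_fun_id_gaussianReal (μ := 0) (v := v)
    rw [variance_eq_integral (by fun_prop)] at h
    simpa [integral_id_gaussianReal] using h
  have hi : Integrable (fun y : ℝ => y ^ 2) (gaussianReal 0 v) := by
    have := (memLp_id_gaussianReal' (μ := 0) (v := v) 2 (by simp)).integrable_sq
    simpa using this
  have hi2 : Integrable (fun y : ℝ => A - (A + D) / (4 * v) * y ^ 2) (gaussianReal 0 v) :=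
    (integrable_const _).sub (hi.const_mul _)
  have : ∫ y, (A - (A + D) / (4 * v) * y ^ 2) ∂gaussianReal 0 v = A - (A + D) / 4 := by
    rw [integral_sub (integrable_const _) (hi.const_mul _), integral_const_mul, hsq]
    simp; field_simp
  rw [← this]
  refine integral_mono hi2 ?_ fun y => ?_
  · exact (integrable_const D).mono'
      (hg.comp (measurable_const.sub measurable_id)).aestronglyMeasurable
      (.of_forall fun y => hD _)
  · simp only
    rcases le_or_gt |y| (2 * √v) with h | h
    · have := hgA y h
      have h2 : 0 ≤ (A + D) / (4 * v) * y ^ 2 := by positivity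
      linarith
    · have h1 := (abs_le.1 (hD (z - y))).1
      have h2 : 4 * v ≤ y ^ 2 := by
        rw [← sq_abs]
        have := Real.sq_sqrt hv'.le
        nlinarith [Real.sqrt_nonneg (v : ℝ)]
      have h3 : A + D ≤ (A + D) / (4 * v) * y ^ 2 := by
        rw [div_mul_eq_mul_div, le_div_iff₀ (by positivity)]
        gcongr
      linarith

/-- Removing the Gaussian smoothing from a bound on the distance to a normal law. -/
lemma abs_real_Iic_sub_le_of_smoothed (ρ : Measure ℝ) [IsProbabilityMeasure ρ] {v w : NNReal}
    (hv : v ≠ 0) (hw : w ≠ 0) {δ : ℝ}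
    (hδ : ∀ z, |(ρ ∗ gaussianReal 0 v).real (Set.Iic z)
      - (gaussianReal 0 w ∗ gaussianReal 0 v).real (Set.Iic z)| ≤ δ) (x : ℝ) :
    |ρ.real (Set.Iic x) - (gaussianReal 0 w).real (Set.Iic x)| ≤ 2 * δ + 6 * √v / √w := by
  set Δ : ℝ → ℝ := fun x => ρ.real (Set.Iic x) - (gaussianReal 0 w).real (Set.Iic x)
  have hw' : 0 < √(w : ℝ) := Real.sqrt_pos.2 (by positivity)
  have hΔm : Measurable Δ := (measurable_real_Iic ρ).sub (measurable_real_Iic _)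
  have hΔ1 : ∀ x, |Δ x| ≤ 1 := fun x => abs_sub_le_iff.2
    ⟨by linarith [measureReal_le_one (μ := ρ) (s := Set.Iic x),
        measureReal_nonneg (μ := gaussianReal 0 w) (s := Set.Iic x)],
      by linarith [measureReal_nonneg (μ := ρ) (s := Set.Iic x),
        measureReal_le_one (μ := gaussianReal 0 w) (s := Set.Iic x)]⟩
  have hint : ∀ (ρ : Measure ℝ) [IsProbabilityMeasure ρ] (z : ℝ),
      Integrable (fun y => ρ.real (Set.Iic (z - y))) (gaussianReal 0 v) := fun ρ _ z =>
    (integrable_const (1 : ℝ)).mono'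
      ((measurable_real_Iic ρ).comp (measurable_const.sub measurable_id)).aestronglyMeasurable
      (.of_forall fun y => by
        rw [Real.norm_of_nonneg measureReal_nonneg]; exact measureReal_le_one)
  have hsm : ∀ z, |∫ y, Δ (z - y) ∂gaussianReal 0 v| ≤ δ := fun z => by
    have := hδ z
    rw [Measure.conv_comm ρ, Measure.conv_comm (gaussianReal 0 w), conv_real_Iic, conv_real_Iic,
      ← integral_sub (hint ρ z) (hint _ z)] at this
    exact this
  have hδ0 : 0 ≤ δ := (abs_nonneg _).trans (hδ 0)
  set D := ⨆ x, |Δ x|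
  have hbdd : BddAbove (Set.range fun x => |Δ x|) := ⟨1, by rintro _ ⟨x, rfl⟩; exact hΔ1 x⟩
  have hD : ∀ x, |Δ x| ≤ D := fun x => le_ciSup hbdd x
  have hD0 : 0 ≤ D := (abs_nonneg _).trans (hD 0)
  set η := 4 * √v / √w
  have hη : 0 ≤ η := by positivity
  have hlip : ∀ s t : ℝ, s ≤ t → t ≤ s + 4 * √v →
      (gaussianReal 0 w).real (Set.Iic t) ≤ (gaussianReal 0 w).real (Set.Iic s) + η := by
    intro s t hst hts
    rw [gaussianReal_real_Iic hw, gaussianReal_real_Iic hw]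
    have h1 := (abs_le.1 (abs_stdCdf_sub_le (t / √w) (s / √w))).2
    rw [← sub_div, abs_div, abs_of_pos hw', abs_of_nonneg (sub_nonneg.2 hst)] at h1
    have h2 : (t - s) / √w ≤ η := by simp only [η]; gcongr; linarith
    linarith
  -- A large discrepancy persists on a window of length 4√v: to the right of x if positive, to the
  -- left if negative, since one distribution function is monotone and the normal one varies by at
  -- most η there. Smoothing at the centre of the window keeps 3A/4 - D/4, where A = |Δ x| - η, and
  -- this is at most δ. The term D/3 is absorbed afterwards by taking the supremum over x.
  have hmain : ∀ x, |Δ x| ≤ 4 / 3 * δ + D / 3 + η := fun x => by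
    refine abs_le.2 ⟨?_, ?_⟩
    · by_contra! hcon
      have := integral_ge_of_ge_near (g := fun t => -Δ t) (A := -Δ x - η) (D := D)
        (z := x - 2 * √v) hv (by linarith) hΔm.neg (fun t => by rw [abs_neg]; exact hD t)
        fun y hy => by
          obtain ⟨h1, h2⟩ := abs_le.1 hy
          have h3 := hlip (x - 2 * √v - y) x (by linarith) (by linarith)
          have h4 : ρ.real (Set.Iic (x - 2 * √v - y)) ≤ ρ.real (Set.Iic x) :=
            measureReal_mono (Set.Iic_subset_Iic.2 (by linarith))
          simp only [Δ]; linarith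
      rw [integral_neg] at this
      have h5 := (abs_le.1 (hsm (x - 2 * √v))).1
      linarith
    · by_contra! hcon
      have := integral_ge_of_ge_near (g := Δ) (A := Δ x - η) (D := D)
        (z := x + 2 * √v) hv (by linarith) hΔm hD
        fun y hy => by
          obtain ⟨h1, h2⟩ := abs_le.1 hy
          have h3 := hlip x (x + 2 * √v - y) (by linarith) (by linarith)
          have h4 : ρ.real (Set.Iic x) ≤ ρ.real (Set.Iic (x + 2 * √v - y)) :=
            measureReal_mono (Set.Iic_subset_Iic.2 (by linarith))
          simp only [Δ]; linarith
      have h5 := (abs_le.1 (hsm (x + 2 * √v))).2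
      linarith
  have hDle : D ≤ 4 / 3 * δ + D / 3 + η := ciSup_le hmain
  have h6 : 6 * √v / √w = 3 / 2 * η := by simp only [η]; ring
  rw [h6]
  have := hD x
  linarith

/-- One Lindeberg replacement in the presence of k unreplaced summands. Exchanging these for a
normal law of variance k costs the distance D against the weak smoothing v; after the exchange the
smoothing has variance v + k. -/
lemma convPow_conv_gaussianReal_step (μ : Measure ℝ) [IsStdLaw μ] (k : ℕ) {v : NNReal}
    (hv : v ≠ 0) {D : ℝ}
    (hD : ∀ x, |(convPow μ k).real (Set.Iic x) - (gaussianReal 0 k).real (Set.Iic x)| ≤ D)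
    (z : ℝ) :
    |(convPow μ (k + 1) ∗ gaussianReal 0 v).real (Set.Iic z)
      - (convPow μ k ∗ gaussianReal 0 (v + 1)).real (Set.Iic z)|
      ≤ (D * stdPdf₂Var / √v ^ 3 + 1 / √(v + k) ^ 3)
        * (thirdMoment μ + thirdMoment (gaussianReal 0 1)) := by
  have hv' : 0 < (v : ℝ) := by positivity
  have hr : 0 < √(v : ℝ) := Real.sqrt_pos.2 hv'
  have hcomm : ∀ ν : Measure ℝ, IsProbabilityMeasure ν →
      ((convPow μ k ∗ ν) ∗ gaussianReal 0 v).real (Set.Iic z)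
        = ∫ x, ∫ w, scaledCdf (√v) (z - x - w) ∂convPow μ k ∂ν := fun ν _ => by
    rw [Measure.conv_comm (convPow μ k), Measure.conv_assoc, conv_real_Iic]
    simp_rw [conv_gaussianReal_real_Iic _ hv]
  have h1 : gaussianReal 0 (v + 1) = gaussianReal 0 1 ∗ gaussianReal 0 v := by
    rw [gaussianReal_conv_gaussianReal, add_comm v]; simp
  rw [h1, ← Measure.conv_assoc, convPow, hcomm μ inferInstance, hcomm _ inferInstance]
  apply lindeberg_smoothed hr
  intro a
  have h2 := abs_integral_scaledCdf₃_sub_le hr (convPow μ k) (gaussianReal 0 k) hD a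
  have h3 := integral_scaledCdf₃_gaussianReal hr k a
  rw [Real.sq_sqrt hv'.le] at h3
  have h4 : 0 < √((v : ℝ) + k) := Real.sqrt_pos.2 (by positivity)
  have h5 := abs_scaledCdf₃_le h4 a
  simp only [NNReal.coe_natCast] at h3
  rw [h3] at h2
  have h6 := abs_sub_abs_le_abs_sub (∫ w, scaledCdf₃ (√v) (a - w) ∂convPow μ k)
    (scaledCdf₃ (√(v + k)) a)
  linarith

/-- The Berry–Esseen inequality. -/
theorem exists_berryEsseen : ∃ K : ℝ, 1 ≤ K ∧ ∀ (μ : Measure ℝ) [IsStdLaw μ] (n : ℕ), 1 ≤ n →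
    ∀ x, |(convPow μ n).real (Set.Iic x) - stdCdf (x / √n)| ≤ K * thirdMoment μ / √n := by
  set c₀ := stdPdf₂Var
  have hc₀ : 0 ≤ c₀ := stdPdf₂Var_nonneg
  set G := thirdMoment (gaussianReal 0 1)
  have hG : 1 ≤ G := IsStdLaw.one_le_thirdMoment _
  set c₁ := 1 + G
  have hc₁ : 2 ≤ c₁ := by simp only [c₁]; linarith
  -- `K` solves K = 2c₁ + 6c₁c₀ + K/2 + 288c₁(c₀ + 1): the term K/2 comes from the induction
  -- hypothesis and the last one from removing the smoothing, which costs 6ε/√n.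
  set K := 2 * (2 * c₁ + 6 * c₁ * c₀ + 288 * c₁ * (c₀ + 1))
  have hK : 1 ≤ K := by
    have : 0 ≤ c₁ * c₀ := by positivity
    simp only [K]; nlinarith
  refine ⟨K, hK, fun μ _ n => ?_⟩
  set L := thirdMoment μ
  have hL : 1 ≤ L := IsStdLaw.one_le_thirdMoment μ
  induction n using Nat.strong_induction_on with
  | _ n ih =>
  intro hn x
  have hn' : (1 : ℝ) ≤ n := by exact_mod_cast hn
  -- The standard deviation of the auxiliary smoothing, of order L and independent of n. It is just
  -- large enough for 12 c₁ c₀ L / ε ≤ 1/4, which makes the induction hypothesis enter with a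
  -- contracting factor.
  set ε := 48 * c₁ * (c₀ + 1) * L
  have hε : 1 ≤ ε := by
    have : 1 ≤ c₁ * (c₀ + 1) := by nlinarith
    simp only [ε]; nlinarith
  set e : NNReal := ⟨ε ^ 2, sq_nonneg _⟩
  have hecoe : (e : ℝ) = ε ^ 2 := rfl
  have hsqe : √(e : ℝ) = ε := by rw [hecoe, Real.sqrt_sq (by linarith)]
  have he1 : (1 : ℝ) ≤ e := by rw [hecoe]; nlinarith
  have he0 : e ≠ 0 := by rintro h; rw [h] at he1; norm_num at he1
  set q := √(n : ℝ)
  have hq : 0 < q := by positivity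
  have hq2 : q ^ 2 = n := Real.sq_sqrt (by linarith)
  -- each swap
  have hstep : ∀ z, ∀ k ∈ Finset.range n,
      |(convPow μ (k + 1) ∗ gaussianReal 0 (((n - (k + 1) : ℕ) : NNReal) + e)).real (Set.Iic z)
        - (convPow μ k ∗ gaussianReal 0 (((n - k : ℕ) : NNReal) + e)).real (Set.Iic z)|
      ≤ c₁ * L * (c₀ * (3 / q ^ 3 + 2 * K * L / q * (1 / √((n - (k + 1) : ℕ) + e) ^ 3))
        + 1 / q ^ 3) := by
    intro z k hk
    rw [Finset.mem_range] at hk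
    have hs : ((n - (k + 1) : ℕ) : ℝ) = n - k - 1 := by
      rw [Nat.cast_sub hk]; push_cast; ring
    set v : NNReal := ((n - (k + 1) : ℕ) : NNReal) + e
    have hvcoe : (v : ℝ) = n - k - 1 + e := by simp only [v]; rw [NNReal.coe_add, NNReal.coe_natCast, hs]
    have hv0 : v ≠ 0 := by simp [v, he0]
    have hvs : ((n - k : ℕ) : NNReal) + e = v + 1 := by
      simp only [v]
      have : n - k = n - (k + 1) + 1 := by omega
      rw [this]; push_cast; ring
    have hkn : (k : ℝ) + 1 ≤ n := by exact_mod_cast hk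
    have hsv : 0 < √(v : ℝ) := Real.sqrt_pos.2 (NNReal.coe_pos.2 (pos_iff_ne_zero.2 hv0))
    -- distance bound for the k-fold convolution
    obtain ⟨D, hD0, hD, hDb⟩ : ∃ D : ℝ, 0 ≤ D ∧ (∀ x, |(convPow μ k).real (Set.Iic x)
        - (gaussianReal 0 k).real (Set.Iic x)| ≤ D) ∧
        D / √v ^ 3 ≤ 3 / q ^ 3 + 2 * K * L / q * (1 / √v ^ 3) := by
      rcases Nat.eq_zero_or_pos k with rfl | hkpos
      · refine ⟨0, le_rfl, fun x => ?_, by rw [zero_div]; positivity⟩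
        simp [convPow]
      have hkpos' : (1 : ℝ) ≤ k := by exact_mod_cast hkpos
      -- For k ≤ n/2 the normal part already has variance at least n/2 and the trivial distance 1
      -- suffices. For larger k the induction hypothesis applies with √k comparable to √n.
      rcases le_or_gt (2 * k) n with h2 | h2
      · refine ⟨1, zero_le_one, fun x => abs_sub_le_iff.2 ⟨?_, ?_⟩, ?_⟩
        · linarith [measureReal_le_one (μ := convPow μ k) (s := Set.Iic x),
            measureReal_nonneg (μ := gaussianReal 0 (k : NNReal)) (s := Set.Iic x)]
        · linarith [measureReal_le_one (μ := gaussianReal 0 (k : NNReal)) (s := Set.Iic x),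
            measureReal_nonneg (μ := convPow μ k) (s := Set.Iic x)]
        · have h3 : (n : ℝ) / 2 ≤ v := by
            have : (2 * k : ℝ) ≤ n := by exact_mod_cast h2
            rw [hvcoe]; linarith
          have h4 : q * 0.7 ≤ √(v : ℝ) := by
            apply Real.le_sqrt_of_sq_le; nlinarith
          have h5 : (q * 0.7) ^ 3 ≤ √(v : ℝ) ^ 3 := by gcongr
          have h6 : 1 / √(v : ℝ) ^ 3 ≤ 3 / q ^ 3 := by
            rw [div_le_div_iff₀ (by positivity) (by positivity)]
            have : 0 < q ^ 3 := by positivity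
            nlinarith
          have : 0 ≤ 2 * K * L / q * (1 / √(v : ℝ) ^ 3) := by positivity
          linarith
      · refine ⟨K * L / √k, by positivity, fun x => ?_, ?_⟩
        · have := ih k hk hkpos x
          rwa [gaussianReal_real_Iic (by positivity)]
        · have h3 : q / 2 ≤ √(k : ℝ) := by
            apply Real.le_sqrt_of_sq_le
            have : (n : ℝ) < 2 * k := by exact_mod_cast h2
            nlinarith
          have h4 : K * L / √(k : ℝ) ≤ 2 * K * L / q := by
            rw [div_le_div_iff₀ (by positivity) (by positivity)]
            have : 0 ≤ K * L := by positivity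
            nlinarith
          have h5 : K * L / √(k : ℝ) / √(v : ℝ) ^ 3 ≤ 2 * K * L / q * (1 / √(v : ℝ) ^ 3) := by
            rw [mul_one_div]; gcongr
          have : 0 ≤ 3 / q ^ 3 := by positivity
          linarith
    have h1 := convPow_conv_gaussianReal_step μ k hv0 hD z
    rw [hvs]
    refine h1.trans ?_
    have h2 : q ≤ √((v : ℝ) + k) := Real.sqrt_le_sqrt (by rw [hvcoe]; linarith)
    have h3 : 1 / √((v : ℝ) + k) ^ 3 ≤ 1 / q ^ 3 := by gcongr
    have h4 : L + G ≤ c₁ * L := by simp only [c₁]; nlinarith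
    have h5 : D * c₀ / √(v : ℝ) ^ 3 = c₀ * (D / √(v : ℝ) ^ 3) := by ring
    rw [h5, mul_comm]
    have hvs' : ((n - (k + 1) : ℕ) : ℝ) + e = v := by rw [hs, hvcoe]
    rw [hvs']
    gcongr
  -- summation
  have hsum : ∀ z, |(convPow μ n ∗ gaussianReal 0 e).real (Set.Iic z)
      - (gaussianReal 0 n ∗ gaussianReal 0 e).real (Set.Iic z)|
      ≤ (c₁ * L + 3 * c₁ * c₀ * L + K * L / 4) / q := by
    intro z
    -- Interpolation between the two laws: k summands with law `μ`, the other n - k normal, and the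
    -- smoothing throughout.
    set E : ℕ → ℝ := fun k =>
      (convPow μ k ∗ gaussianReal 0 (((n - k : ℕ) : NNReal) + e)).real (Set.Iic z)
    have hEn : E n = (convPow μ n ∗ gaussianReal 0 e).real (Set.Iic z) := by simp [E]
    have hE0 : E 0 = (gaussianReal 0 n ∗ gaussianReal 0 e).real (Set.Iic z) := by
      simp only [E, convPow, Measure.dirac_zero_conv, Nat.sub_zero]
      rw [gaussianReal_conv_gaussianReal, add_zero]
    rw [← hEn, ← hE0, ← Finset.sum_range_sub]
    refine (Finset.abs_sum_le_sum_abs _ _).trans ((Finset.sum_le_sum (hstep z)).trans ?_)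
    rw [← Finset.mul_sum, Finset.sum_add_distrib, ← Finset.mul_sum, Finset.sum_add_distrib,
      ← Finset.mul_sum]
    have h1 : ∑ k ∈ Finset.range n, 1 / √(((n - (k + 1) : ℕ) : ℝ) + e) ^ 3 ≤ 6 / ε := by
      have := sum_inv_sqrt_cube_le he1 n
      rw [← Finset.sum_range_reflect, hsqe] at this
      refine le_trans (le_of_eq (Finset.sum_congr rfl fun k _ => ?_)) this
      rw [show n - 1 - k = n - (k + 1) by omega]
    simp only [Finset.sum_const, Finset.card_range, nsmul_eq_mul]
    have h2 : (n : ℝ) * (3 / q ^ 3) = 3 / q := by rw [← hq2]; field_simp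
    have h3 : (n : ℝ) * (1 / q ^ 3) = 1 / q := by rw [← hq2]; field_simp
    rw [h2, h3]
    calc c₁ * L * (c₀ * (3 / q + 2 * K * L / q
          * ∑ k ∈ Finset.range n, 1 / √(((n - (k + 1) : ℕ) : ℝ) + e) ^ 3) + 1 / q)
        ≤ c₁ * L * (c₀ * (3 / q + 2 * K * L / q * (6 / ε)) + 1 / q) := by gcongr
      _ = (c₁ * L + 3 * c₁ * c₀ * L + K * L * (12 * c₁ * c₀ * L / ε)) / q := by
          field_simp; ring
      _ ≤ (c₁ * L + 3 * c₁ * c₀ * L + K * L * (1 / 4)) / q := by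
          have h4 : 12 * c₁ * c₀ * L / ε ≤ 1 / 4 := by
            rw [div_le_div_iff₀ (by linarith) (by norm_num)]
            simp only [ε]
            have : 0 ≤ c₁ * L := by positivity
            nlinarith
          gcongr
      _ = _ := by ring
  have := abs_real_Iic_sub_le_of_smoothed (convPow μ n) he0 (w := n) (by positivity) hsum x
  rw [gaussianReal_real_Iic (by positivity), hsqe] at this
  refine this.trans (le_of_eq ?_)
  simp only [NNReal.coe_natCast, K, ε, q]
  field_simp
  ring

end BerryEsseen

/-- A constant for which the Berry–Esseen inequality holds. -/
noncomputable def beConst : ℝ := exists_berryEsseen.choose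

lemma one_le_beConst : 1 ≤ beConst := exists_berryEsseen.choose_spec.1

lemma berryEsseen_Iic (μ : Measure ℝ) [IsStdLaw μ] {n : ℕ} (hn : 1 ≤ n) (x : ℝ) :
    |(convPow μ n).real (Set.Iic x) - stdCdf (x / √n)| ≤ beConst * thirdMoment μ / √n :=
  exists_berryEsseen.choose_spec.2 μ n hn x

/-! ### Reflection of a law -/

/-- The law of `-X` when `μ` is the law of `X`. -/
noncomputable def reflectLaw (μ : Measure ℝ) : Measure ℝ := μ.map fun x => -x

lemma integral_reflectLaw (μ : Measure ℝ) (f : ℝ → ℝ) :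
    ∫ x, f x ∂reflectLaw μ = ∫ x, f (-x) ∂μ :=
  integral_map_equiv (MeasurableEquiv.neg ℝ) f

instance (μ : Measure ℝ) [IsStdLaw μ] : IsStdLaw (reflectLaw μ) where
  toIsProbabilityMeasure := Measure.isProbabilityMeasure_map (by fun_prop)
  integrable_cube := by
    refine (integrable_map_equiv (MeasurableEquiv.neg ℝ) _).2 ?_
    refine (IsStdLaw.integrable_cube (μ := μ)).congr (.of_forall fun x => ?_)
    simp
  mean := by rw [integral_reflectLaw, integral_neg, IsStdLaw.mean, neg_zero]
  sq := by rw [integral_reflectLaw]; simpa using IsStdLaw.sq (μ := μ)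

lemma thirdMoment_reflectLaw (μ : Measure ℝ) : thirdMoment (reflectLaw μ) = thirdMoment μ := by
  rw [thirdMoment, integral_reflectLaw]; simp [thirdMoment]

lemma convPow_reflectLaw (μ : Measure ℝ) [IsProbabilityMeasure μ] (n : ℕ) :
    convPow (reflectLaw μ) n = (convPow μ n).map fun x => -x := by
  induction n with
  | zero => simp [convPow, Measure.map_dirac]
  | succ n ih =>
    rw [convPow, ih, convPow]
    exact (Measure.map_conv_addMonoidHom (negAddMonoidHom (α := ℝ)) measurable_neg).symm

lemma convPow_real_Ici (μ : Measure ℝ) [IsProbabilityMeasure μ] (n : ℕ) (x : ℝ) :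
    (convPow μ n).real (Set.Ici x) = (convPow (reflectLaw μ) n).real (Set.Iic (-x)) := by
  rw [convPow_reflectLaw, map_measureReal_apply (by fun_prop) measurableSet_Iic]
  congr 1; ext y; simp

lemma berryEsseen_Ici (μ : Measure ℝ) [IsStdLaw μ] {n : ℕ} (hn : 1 ≤ n) (x : ℝ) :
    |(convPow μ n).real (Set.Ici x) - stdCdf (-x / √n)| ≤ beConst * thirdMoment μ / √n := by
  rw [convPow_real_Ici, ← thirdMoment_reflectLaw]
  exact berryEsseen_Iic (reflectLaw μ) hn (-x)

/-- The concentration inequality that follows from Berry–Esseen. -/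
lemma convPow_real_Ioc_le (μ : Measure ℝ) [IsStdLaw μ] {n : ℕ} (hn : 1 ≤ n) {a b : ℝ}
    (hab : a ≤ b) :
    (convPow μ n).real (Set.Ioc a b) ≤ (b - a + 2 * beConst * thirdMoment μ) / √n := by
  have hq : 0 < √(n : ℝ) := by positivity
  have h1 : (convPow μ n).real (Set.Ioc a b)
      = (convPow μ n).real (Set.Iic b) - (convPow μ n).real (Set.Iic a) := by
    rw [← Set.Iic_sdiff_Iic, measureReal_sdiff (Set.Iic_subset_Iic.2 hab) measurableSet_Iic]
  have h2 := abs_le.1 (berryEsseen_Iic μ hn b)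
  have h3 := abs_le.1 (berryEsseen_Iic μ hn a)
  have h4 := (abs_le.1 (abs_stdCdf_sub_le (b / √n) (a / √n))).2
  rw [← sub_div, abs_div, abs_of_pos hq, abs_of_nonneg (sub_nonneg.2 hab)] at h4
  rw [h1, add_div]
  have : 2 * beConst * thirdMoment μ / √(n : ℝ) = 2 * (beConst * thirdMoment μ / √n) := by ring
  linarith

/-! ### The walk killed on leaving the positive half-line -/

/-- One step of the walk, killed when it becomes non-positive. -/
noncomputable def kill (μ ν : Measure ℝ) : Measure ℝ := (ν ∗ μ).restrict (Set.Ioi 0)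

/-- The law at time `n`, with initial law `ν`, of the walk killed when it becomes non-positive. -/
noncomputable def alive (μ ν : Measure ℝ) (n : ℕ) : Measure ℝ := (kill μ)^[n] ν

/-- The law of the exit position on the event that the exit happens at time `k + 1`. -/
noncomputable def exitLaw (μ ν : Measure ℝ) (k : ℕ) : Measure ℝ :=
  (alive μ ν k ∗ μ).restrict (Set.Iic 0)

lemma alive_zero (μ ν : Measure ℝ) : alive μ ν 0 = ν := rfl

lemma alive_succ (μ ν : Measure ℝ) (n : ℕ) :
    alive μ ν (n + 1) = (alive μ ν n ∗ μ).restrict (Set.Ioi 0) :=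
  Function.iterate_succ_apply' _ _ _

lemma alive_add (μ ν : Measure ℝ) (m n : ℕ) :
    alive μ ν (m + n) = alive μ (alive μ ν m) n := by
  rw [alive, add_comm, Function.iterate_add_apply]; rfl

lemma exitLaw_add (μ ν : Measure ℝ) (m n : ℕ) :
    exitLaw μ ν (m + n) = exitLaw μ (alive μ ν m) n := by
  rw [exitLaw, alive_add, exitLaw]

instance (μ ν : Measure ℝ) [IsFiniteMeasure μ] [IsFiniteMeasure ν] (n : ℕ) :
    IsFiniteMeasure (alive μ ν n) := by
  induction n with
  | zero => rw [alive_zero]; infer_instance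
  | succ n ih => rw [alive_succ]; infer_instance

instance (μ ν : Measure ℝ) [IsFiniteMeasure μ] [IsFiniteMeasure ν] (n : ℕ) :
    IsFiniteMeasure (exitLaw μ ν n) := by
  unfold exitLaw; infer_instance

lemma alive_succ_add_exitLaw (μ ν : Measure ℝ) (n : ℕ) :
    alive μ ν (n + 1) + exitLaw μ ν n = alive μ ν n ∗ μ := by
  rw [alive_succ, exitLaw, ← Set.compl_Ioi, Measure.restrict_add_restrict_compl measurableSet_Ioi]

lemma alive_succ_Iic (μ ν : Measure ℝ) (n : ℕ) : alive μ ν (n + 1) (Set.Iic 0) = 0 := by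
  rw [alive_succ, Measure.restrict_apply measurableSet_Iic]
  rw [Set.Iic_inter_Ioi, Set.Ioc_self, measure_empty]

lemma alive_Iio (μ : Measure ℝ) {ν : Measure ℝ} (hν : ν (Set.Iio 0) = 0) (n : ℕ) :
    alive μ ν n (Set.Iio 0) = 0 := by
  cases n with
  | zero => exact hν
  | succ n => exact measure_mono_null Set.Iio_subset_Iic_self (alive_succ_Iic μ ν n)

lemma ae_alive_nonneg (μ : Measure ℝ) {ν : Measure ℝ} (hν : ν (Set.Iio 0) = 0) (n : ℕ) :
    ∀ᵐ w ∂alive μ ν n, 0 ≤ w := by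
  rw [ae_iff]; simpa [Set.Iio_def, not_le] using alive_Iio μ hν n

lemma ae_exitLaw_nonpos (μ ν : Measure ℝ) (n : ℕ) : ∀ᵐ w ∂exitLaw μ ν n, w ≤ 0 :=
  ae_restrict_mem measurableSet_Iic

lemma conv_real_univ (μ ν : Measure ℝ) [IsProbabilityMeasure μ] [SFinite ν] :
    (ν ∗ μ).real Set.univ = ν.real Set.univ := by
  rw [Measure.conv, map_measureReal_apply (by fun_prop) .univ, Set.preimage_univ,
    ← Set.univ_prod_univ, Measure.real, Measure.prod_prod, measure_univ (μ := μ), mul_one]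
  rfl

section

variable (μ ν : Measure ℝ) [IsProbabilityMeasure μ] [IsFiniteMeasure ν]

lemma alive_real_univ_succ_add (n : ℕ) :
    (alive μ ν (n + 1)).real Set.univ + (exitLaw μ ν n).real Set.univ
      = (alive μ ν n).real Set.univ := by
  rw [← measureReal_add_apply, alive_succ_add_exitLaw, conv_real_univ]

lemma alive_real_univ_antitone : Antitone fun n => (alive μ ν n).real Set.univ :=
  antitone_nat_of_succ_le fun n => by
    rw [← alive_real_univ_succ_add μ ν n]
    linarith [measureReal_nonneg (μ := exitLaw μ ν n) (s := Set.univ)]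

lemma alive_real_univ_le (n : ℕ) : (alive μ ν n).real Set.univ ≤ ν.real Set.univ :=
  alive_real_univ_antitone μ ν (Nat.zero_le n)

lemma alive_real_univ_add_sum (n : ℕ) :
    (alive μ ν n).real Set.univ + ∑ k ∈ Finset.range n, (exitLaw μ ν k).real Set.univ
      = ν.real Set.univ := by
  induction n with
  | zero => simp [alive_zero]
  | succ n ih =>
    rw [Finset.sum_range_succ, ← ih, ← alive_real_univ_succ_add μ ν n]; ring

lemma sum_exitLaw_real_univ_le (n : ℕ) :
    ∑ k ∈ Finset.range n, (exitLaw μ ν k).real Set.univ ≤ ν.real Set.univ := by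
  have := alive_real_univ_add_sum μ ν n
  linarith [measureReal_nonneg (μ := alive μ ν n) (s := Set.univ)]

/-- Decomposition of the free walk according to the exit time. -/
lemma alive_add_sum_exitLaw_conv (n : ℕ) :
    alive μ ν n + ∑ k ∈ Finset.range n, exitLaw μ ν k ∗ convPow μ (n - 1 - k)
      = ν ∗ convPow μ n := by
  induction n with
  | zero => simp [alive_zero, convPow, Measure.conv_dirac_zero]
  | succ n ih =>
    have hsum : (∑ k ∈ Finset.range n, exitLaw μ ν k ∗ convPow μ (n - 1 - k)) ∗ μ
        = ∑ k ∈ Finset.range n, exitLaw μ ν k ∗ convPow μ (n - k) := by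
      have : ∀ s : Finset ℕ, (∑ k ∈ s, exitLaw μ ν k ∗ convPow μ (n - 1 - k)) ∗ μ
          = ∑ k ∈ s, exitLaw μ ν k ∗ convPow μ (n - 1 - k) ∗ μ := fun s => by
        induction s using Finset.induction_on with
        | empty => simp
        | insert a s ha ih' =>
          rw [Finset.sum_insert ha, Finset.sum_insert ha, ← ih', Measure.add_conv,
            Measure.conv_assoc]
      rw [this]
      refine Finset.sum_congr rfl fun k hk => ?_
      rw [Finset.mem_range] at hk
      rw [show n - k = (n - 1 - k) + 1 by omega, convPow]
    rw [convPow, ← Measure.conv_assoc, ← ih, Measure.add_conv, hsum, ← alive_succ_add_exitLaw,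
      Finset.sum_range_succ]
    simp only [Nat.add_sub_cancel, Nat.sub_self, convPow, Measure.conv_dirac_zero]
    abel

lemma alive_real_add_sum (n : ℕ) (B : Set ℝ) :
    (alive μ ν n).real B + ∑ k ∈ Finset.range n, (exitLaw μ ν k ∗ convPow μ (n - 1 - k)).real B
      = (ν ∗ convPow μ n).real B := by
  rw [← alive_add_sum_exitLaw_conv μ ν n]
  have : IsFiniteMeasure (∑ k ∈ Finset.range n, exitLaw μ ν k ∗ convPow μ (n - 1 - k)) := by
    infer_instance
  have h : (∑ k ∈ Finset.range n, exitLaw μ ν k ∗ convPow μ (n - 1 - k)).real B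
      = ∑ k ∈ Finset.range n, (exitLaw μ ν k ∗ convPow μ (n - 1 - k)).real B := by
    rw [Measure.real, Measure.finsetSum_apply, ENNReal.toReal_sum fun _ _ => measure_ne_top _ _]
    rfl
  rw [measureReal_add_apply, h]

end

/-! ### First moments of the killed walk -/

lemma integrable_conv_of_le {μ ν : Measure ℝ} [IsFiniteMeasure μ] [IsFiniteMeasure ν]
    {f a b : ℝ → ℝ} (hf : Measurable f) (ha : Integrable a ν) (hb : Integrable b μ)
    (h : ∀ x y, |f (x + y)| ≤ a x + b y) : Integrable f (ν ∗ μ) := by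
  rw [Measure.conv, integrable_map_measure hf.aestronglyMeasurable (by fun_prop)]
  exact ((ha.comp_fst μ).add (hb.comp_snd ν)).mono' (hf.comp measurable_add).aestronglyMeasurable
    (.of_forall fun p => h p.1 p.2)

lemma integrable_abs_conv {μ ν : Measure ℝ} [IsFiniteMeasure μ] [IsFiniteMeasure ν]
    (hν : Integrable (fun x => |x|) ν) (hμ : Integrable (fun x => |x|) μ) :
    Integrable (fun x => |x|) (ν ∗ μ) :=
  integrable_conv_of_le (by fun_prop) hν hμ fun x y => by rw [abs_abs]; exact abs_add_le x y

/-- A jump x from w ≥ 0 to w + x ≤ 0 satisfies w ≤ |x| and |w + x| ≤ |x|. The overshoot is thus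
dominated by the jump, and summing over times leaves the Green function of [0, |x|]. -/
lemma sum_lintegral_exitLaw_le (μ : Measure ℝ) [IsProbabilityMeasure μ] {ν : Measure ℝ}
    [IsFiniteMeasure ν] (hν0 : ν (Set.Iio 0) = 0)
    {ψ : ℝ → ENNReal} (hψ : Monotone ψ) (n : ℕ) :
    ∑ k ∈ Finset.range n, ∫⁻ w, ψ |w| ∂exitLaw μ ν k
      ≤ ∫⁻ x, ψ |x| * ∑ k ∈ Finset.range n, alive μ ν k (Set.Icc 0 |x|) ∂μ := by
  have hψm : Measurable ψ := hψ.measurable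
  have hset : MeasurableSet {p : ℝ × ℝ | p.1 ∈ Set.Icc 0 |p.2|} :=
    (measurableSet_le measurable_const measurable_fst).inter
      (measurableSet_le measurable_fst (by fun_prop))
  have hm : ∀ k, Measurable fun x => alive μ ν k (Set.Icc 0 |x|) := fun k =>
    (measurable_measure_prodMk_right (μ := alive μ ν k) hset :)
  simp_rw [Finset.mul_sum]
  have hψa : Measurable fun x => ψ |x| := hψm.comp (by fun_prop)
  rw [lintegral_finsetSum (f := fun k x => ψ |x| * alive μ ν k (Set.Icc 0 |x|)) _
    fun k _ => hψa.mul (hm k)]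
  refine Finset.sum_le_sum fun k _ => ?_
  have h1 : ∫⁻ w, ψ |w| ∂exitLaw μ ν k
      = ∫⁻ w, ∫⁻ x, (Set.Iic 0).indicator (fun y => ψ |y|) (w + x) ∂μ ∂alive μ ν k := by
    rw [exitLaw, ← lintegral_indicator measurableSet_Iic, Measure.lintegral_conv]
    exact hψa.indicator measurableSet_Iic
  rw [h1]
  calc _ ≤ ∫⁻ w, ∫⁻ x, {p : ℝ × ℝ | p.1 ∈ Set.Icc 0 |p.2|}.indicator (fun p => ψ |p.2|) (w, x)
          ∂μ ∂alive μ ν k := by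
        refine lintegral_mono_ae ((ae_alive_nonneg μ hν0 k).mono fun w hw => lintegral_mono
          fun x => ?_)
        by_cases h : w + x ≤ 0
        · have hx : x ≤ 0 := by linarith
          rw [Set.indicator_of_mem (by exact h), Set.indicator_of_mem
            (show (w, x) ∈ {p : ℝ × ℝ | p.1 ∈ Set.Icc 0 |p.2|} from
              ⟨hw, by rw [abs_of_nonpos hx]; simp only; linarith⟩)]
          refine hψ ?_
          rw [abs_of_nonpos h, abs_of_nonpos hx]
          linarith
        · rw [Set.indicator_of_notMem (by simpa using h)]
          exact zero_le
    _ = ∫⁻ x, ∫⁻ w, {p : ℝ × ℝ | p.1 ∈ Set.Icc 0 |p.2|}.indicator (fun p => ψ |p.2|) (w, x)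
          ∂alive μ ν k ∂μ := by
        apply lintegral_lintegral_swap
        exact ((hψa.comp measurable_snd).indicator hset).aemeasurable
    _ = _ := by
        refine lintegral_congr fun x => ?_
        have : (fun w => {p : ℝ × ℝ | p.1 ∈ Set.Icc 0 |p.2|}.indicator (fun p => ψ |p.2|) (w, x))
            = (Set.Icc 0 |x|).indicator fun _ => ψ |x| := by
          ext w; simp [Set.indicator]
        rw [this, lintegral_indicator_const measurableSet_Icc]

section Moments

variable (μ : Measure ℝ) [IsStdLaw μ] {ν : Measure ℝ} [IsFiniteMeasure ν]

lemma integrable_abs_alive (hν : Integrable (fun x => |x|) ν) (n : ℕ) :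
    Integrable (fun x => |x|) (alive μ ν n) := by
  induction n with
  | zero => exact hν
  | succ n ih =>
    rw [alive_succ]
    exact (integrable_abs_conv ih (IsStdLaw.integrable_abs μ)).restrict

lemma integrable_abs_exitLaw (hν : Integrable (fun x => |x|) ν) (n : ℕ) :
    Integrable (fun x => |x|) (exitLaw μ ν n) :=
  (integrable_abs_conv (integrable_abs_alive μ hν n) (IsStdLaw.integrable_abs μ)).restrict

lemma integral_alive_succ_add_exitLaw {f : ℝ → ℝ} {n : ℕ} (hf : Integrable f (alive μ ν n ∗ μ)) :
    ∫ w, f w ∂alive μ ν (n + 1) + ∫ w, f w ∂exitLaw μ ν n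
      = ∫ w, ∫ x, f (w + x) ∂μ ∂alive μ ν n := by
  rw [← integral_conv hf, ← alive_succ_add_exitLaw, integral_add_measure]
  · rw [alive_succ]; exact hf.restrict
  · exact hf.restrict

/-- The total mean overshoot of the walk that exits by time `n`. -/
noncomputable def meanOvershoot (μ ν : Measure ℝ) (n : ℕ) : ℝ :=
  ∑ k ∈ Finset.range n, ∫ w, |w| ∂exitLaw μ ν k

lemma meanOvershoot_nonneg (μ ν : Measure ℝ) (n : ℕ) : 0 ≤ meanOvershoot μ ν n :=
  Finset.sum_nonneg fun _ _ => integral_nonneg fun _ => abs_nonneg _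

lemma integral_abs_exitLaw (μ ν : Measure ℝ) (k : ℕ) :
    ∫ w, |w| ∂exitLaw μ ν k = -∫ w, w ∂exitLaw μ ν k := by
  rw [← integral_neg]
  exact integral_congr_ae ((ae_exitLaw_nonpos μ ν k).mono fun w hw => abs_of_nonpos hw)

/-- Optional stopping at the minimum of n and the exit time: the negative mean carried away by the
exits is compensated by the survivors. -/
lemma integral_id_alive (hν : Integrable (fun x => |x|) ν) (n : ℕ) :
    ∫ w, w ∂alive μ ν n = ∫ w, w ∂ν + meanOvershoot μ ν n := by
  induction n with
  | zero => simp [alive_zero, meanOvershoot]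
  | succ n ih =>
    have hi : Integrable (fun x => x) (alive μ ν n ∗ μ) :=
      (integrable_abs_conv (integrable_abs_alive μ hν n) (IsStdLaw.integrable_abs μ)).mono'
        (by fun_prop) (.of_forall fun x => le_rfl)
    have h := integral_alive_succ_add_exitLaw μ hi
    have h2 : ∀ w, ∫ x, (w + x) ∂μ = w := fun w => by
      rw [integral_add (integrable_const _) (IsStdLaw.integrable_id μ), IsStdLaw.mean]
      simp
    simp_rw [h2] at h
    rw [meanOvershoot, Finset.sum_range_succ, integral_abs_exitLaw, ← meanOvershoot]
    linarith

/-! ### The Green function and the overshoot -/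

/-- A concave function, linear below `-b`, constant above `r + b` and with second derivative
`-1` in between. -/
noncomputable def concaveTest (r b w : ℝ) : ℝ :=
  (r + b) ^ 2 / 2 - (max (r + b - w) 0) ^ 2 / 2 + (max (-b - w) 0) ^ 2 / 2

section
variable {r b : ℝ}

lemma concaveTest_nonneg {w : ℝ} (hr : 0 ≤ r) (hb : 0 < b) (hw : 0 ≤ w) :
    0 ≤ concaveTest r b w := by
  unfold concaveTest
  have : max (r + b - w) 0 ≤ r + b := max_le (by linarith) (by linarith)
  have h0 := le_max_right (r + b - w) 0
  nlinarith [sq_nonneg (max (-b - w) 0)]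

lemma concaveTest_le {w : ℝ} (hb : 0 < b) (hw : 0 ≤ w) :
    concaveTest r b w ≤ (r + b) ^ 2 / 2 := by
  unfold concaveTest
  rw [max_eq_right (a := -b - w) (by linarith)]
  nlinarith [sq_nonneg (max (r + b - w) 0)]

lemma concaveTest_ge {w : ℝ} (hr : 0 ≤ r) (hb : 0 < b) (hw : w ≤ 0) :
    (r + 2 * b) * w ≤ concaveTest r b w := by
  unfold concaveTest
  rw [max_eq_left (a := r + b - w) (by linarith)]
  rcases le_total (-b - w) 0 with h | h
  · rw [max_eq_right h]; nlinarith
  · rw [max_eq_left h]; nlinarith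

lemma concaveTest_zero (hr : 0 ≤ r) (hb : 0 < b) : concaveTest r b 0 = 0 := by
  unfold concaveTest
  rw [max_eq_left (by linarith), max_eq_right (by linarith)]; ring

lemma concaveTest_le_of_nonpos {w : ℝ} (hr : 0 ≤ r) (hb : 0 < b) (hw : w ≤ 0) :
    concaveTest r b w ≤ 0 := by
  unfold concaveTest
  rw [max_eq_left (a := r + b - w) (by linarith)]
  rcases le_total (-b - w) 0 with h | h
  · rw [max_eq_right h]; nlinarith
  · rw [max_eq_left h]; nlinarith

lemma abs_concaveTest_le (hr : 0 ≤ r) (hb : 0 < b) (w : ℝ) :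
    |concaveTest r b w| ≤ (r + b) ^ 2 / 2 + (r + 2 * b) * |w| := by
  rcases le_total 0 w with hw | hw
  · rw [abs_of_nonneg (concaveTest_nonneg hr hb hw)]
    have : 0 ≤ (r + 2 * b) * |w| := by positivity
    linarith [concaveTest_le (r := r) hb hw]
  · rw [abs_of_nonpos (concaveTest_le_of_nonpos hr hb hw), abs_of_nonpos hw]
    have := concaveTest_ge hr hb hw
    nlinarith [sq_nonneg (r + b)]

lemma measurable_concaveTest : Measurable (concaveTest r b) := by
  unfold concaveTest; fun_prop

/-- A concave function lies below its tangent at w; the slope there is max(r + b - w, 0) because w ≥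
0 is above the kink at -b. -/
lemma concaveTest_add_le {w : ℝ} (hr : 0 ≤ r) (hb : 0 < b) (hw : 0 ≤ w) (x : ℝ) :
    concaveTest r b (w + x) ≤ concaveTest r b w + max (r + b - w) 0 * x := by
  unfold concaveTest
  rw [max_eq_right (a := -b - w) (by linarith)]
  rcases le_total (-b - (w + x)) 0 with h | h
  · rw [max_eq_right h]
    rcases le_total (r + b - w) 0 with h1 | h1
    · rw [max_eq_right h1]
      nlinarith [sq_nonneg (max (r + b - (w + x)) 0)]
    · rw [max_eq_left h1]
      rcases le_total (r + b - (w + x)) 0 with h2 | h2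
      · rw [max_eq_right h2]; nlinarith [sq_nonneg (r + b - w)]
      · rw [max_eq_left h2]; nlinarith [sq_nonneg x]
  · rw [max_eq_left h]
    rw [max_eq_left (a := r + b - (w + x)) (by linarith)]
    rcases le_total (r + b - w) 0 with h1 | h1
    · rw [max_eq_right h1]; nlinarith
    · rw [max_eq_left h1]; nlinarith

/-- A jump of size at most b from [0, r] stays in the range where the function is exactly quadratic,
giving -x²/2. For a larger jump x² ≤ |x|³/b, the correction has the favourable sign, and the tangent
bound is enough. -/
lemma concaveTest_add_le_sub {w : ℝ} (hb : 0 < b) (hw : 0 ≤ w) (hwr : w ≤ r) (x : ℝ) :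
    concaveTest r b (w + x)
      ≤ concaveTest r b w + (r + b - w) * x - (x ^ 2 - |x| ^ 3 / b) / 2 := by
  rcases le_or_gt |x| b with h | h
  · have h3 : 0 ≤ |x| ^ 3 / b := by positivity
    obtain ⟨h1, h2⟩ := abs_le.1 h
    unfold concaveTest
    rw [max_eq_right (a := -b - w) (by linarith), max_eq_right (a := -b - (w + x)) (by linarith),
      max_eq_left (a := r + b - w) (by linarith), max_eq_left (a := r + b - (w + x)) (by linarith)]
    nlinarith
  · have h1 := concaveTest_add_le (hw.trans hwr) hb hw x
    rw [max_eq_left (by linarith)] at h1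
    have h2 : x ^ 2 ≤ |x| ^ 3 / b := by
      rw [le_div_iff₀ hb, ← sq_abs]
      nlinarith [sq_nonneg |x|, abs_nonneg x]
    linarith

end

/-- The Green function of the killed walk on `[0, r]`. -/
lemma sum_alive_real_Icc_le (hν : Integrable (fun x => |x|) ν) (hν0 : ν (Set.Iio 0) = 0) {r : ℝ}
    (hr : 0 ≤ r) (n : ℕ) :
    ∑ k ∈ Finset.range n, (alive μ ν k).real (Set.Icc 0 r)
      ≤ 4 * (∫ w, concaveTest r (2 * thirdMoment μ) w ∂ν
        + (r + 4 * thirdMoment μ) * meanOvershoot μ ν n) := by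
  set L := thirdMoment μ
  have hL : 1 ≤ L := IsStdLaw.one_le_thirdMoment μ
  -- With this margin the mean of (x² - |x|³/b)/2 is (1 - 1/2)/2 = 1/4, the guaranteed downward
  -- drift on [0, r].
  set b := 2 * L
  have hb : 0 < b := by positivity
  set f := concaveTest r b
  have hfi : ∀ (ρ : Measure ℝ) [IsFiniteMeasure ρ], Integrable (fun x => |x|) ρ →
      Integrable f ρ := fun ρ _ h =>
    ((integrable_const ((r + b) ^ 2 / 2)).add (h.const_mul (r + 2 * b))).mono'
      measurable_concaveTest.aestronglyMeasurable (.of_forall fun w => abs_concaveTest_le hr hb w)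
  -- The test function is a supermartingale losing 1/4 at each visit to [0, r]. Stopping at an exit
  -- position w discards a negative value, of modulus at most (r + 4L)|w|.
  have hstep : ∀ k, (alive μ ν k).real (Set.Icc 0 r) / 4
      ≤ ∫ w, f w ∂alive μ ν k - ∫ w, f w ∂alive μ ν (k + 1)
        + (r + 4 * L) * ∫ w, |w| ∂exitLaw μ ν k := fun k => by
    have hik := integrable_abs_alive μ hν k
    have hconv := integrable_abs_conv hik (IsStdLaw.integrable_abs μ)
    have h1 := integral_alive_succ_add_exitLaw μ (hfi _ hconv)
    have h2 : -((r + 4 * L) * ∫ w, |w| ∂exitLaw μ ν k) ≤ ∫ w, f w ∂exitLaw μ ν k := by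
      rw [← integral_const_mul, ← integral_neg]
      refine integral_mono_ae ((integrable_abs_exitLaw μ hν k).const_mul _).neg
        (hfi _ (integrable_abs_exitLaw μ hν k)) ((ae_exitLaw_nonpos μ ν k).mono fun w hw => ?_)
      have := concaveTest_ge hr hb hw
      simp only [abs_of_nonpos hw]
      simp only [f]
      have e : r + 4 * L = r + 2 * b := by simp only [b]; ring
      rw [e]; linarith
    have h3 : ∫ w, ∫ x, f (w + x) ∂μ ∂alive μ ν k
        ≤ ∫ w, f w ∂alive μ ν k - (alive μ ν k).real (Set.Icc 0 r) / 4 := by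
      have e : (alive μ ν k).real (Set.Icc 0 r) / 4
          = ∫ w, (Set.Icc 0 r).indicator (fun _ => (1 / 4 : ℝ)) w ∂alive μ ν k := by
        rw [integral_indicator_const _ measurableSet_Icc, smul_eq_mul]; ring
      have hind : Integrable ((Set.Icc 0 r).indicator (fun _ => (1 / 4 : ℝ))) (alive μ ν k) :=
        (integrable_const _).indicator measurableSet_Icc
      rw [e, ← integral_sub (hfi _ hik) hind]
      refine integral_mono_ae ?_ ((hfi _ hik).sub hind) ((ae_alive_nonneg μ hν0 k).mono
        fun w hw => ?_)
      · have := (hfi _ hconv)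
        rw [Measure.conv, integrable_map_measure measurable_concaveTest.aestronglyMeasurable
          (by fun_prop)] at this
        exact this.integral_prod_left
      · have hfw : Integrable (fun x => f (w + x)) μ :=
          ((integrable_const ((r + b) ^ 2 / 2 + (r + 2 * b) * |w|)).add
            ((IsStdLaw.integrable_abs μ).const_mul (r + 2 * b))).mono'
            (measurable_concaveTest.comp (measurable_const_add w)).aestronglyMeasurable
            (.of_forall fun x => (abs_concaveTest_le hr hb (w + x)).trans (by
              have : (r + 2 * b) * |w + x| ≤ (r + 2 * b) * (|w| + |x|) := by
                gcongr; exact abs_add_le w x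
              simp only [Pi.add_apply]; linarith))
        have hlin : ∀ d, Integrable (fun x => f w + d * x) μ := fun d =>
          (integrable_const _).add ((IsStdLaw.integrable_id μ).const_mul d)
        have hlin' : ∀ d, ∫ x, (f w + d * x) ∂μ = f w := fun d => by
          rw [integral_add (integrable_const _) ((IsStdLaw.integrable_id μ).const_mul d),
            integral_const_mul, IsStdLaw.mean]
          simp
        simp only
        rcases le_or_gt w r with hwr | hwr
        · rw [Set.indicator_of_mem (Set.mem_Icc.2 ⟨hw, hwr⟩)]
          have hq : Integrable (fun x => (x ^ 2 - |x| ^ 3 / b) / 2) μ :=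
            ((IsStdLaw.integrable_sq μ).sub (IsStdLaw.integrable_cube.div_const b)).div_const 2
          calc ∫ x, f (w + x) ∂μ
              ≤ ∫ x, (f w + (r + b - w) * x - (x ^ 2 - |x| ^ 3 / b) / 2) ∂μ :=
                integral_mono hfw ((hlin _).sub hq) fun x => concaveTest_add_le_sub hb hw hwr x
            _ = f w - 1 / 4 := by
                rw [integral_sub (hlin _) hq, hlin', integral_div, integral_sub
                  (IsStdLaw.integrable_sq μ) (IsStdLaw.integrable_cube.div_const b),
                  IsStdLaw.sq, integral_div, ← thirdMoment]
                change _ - (1 - L / (2 * L)) / 2 = _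
                field_simp; ring
        · rw [Set.indicator_of_notMem (by simp [hwr]), sub_zero]
          calc ∫ x, f (w + x) ∂μ ≤ ∫ x, (f w + max (r + b - w) 0 * x) ∂μ :=
                integral_mono hfw (hlin _) fun x => concaveTest_add_le hr hb hw x
            _ = f w := hlin' _
    linarith
  have hsum := Finset.sum_le_sum fun k (_ : k ∈ Finset.range n) => hstep k
  rw [← Finset.sum_div, Finset.sum_add_distrib, ← Finset.mul_sum, Finset.sum_range_sub'] at hsum
  have hn : 0 ≤ ∫ w, f w ∂alive μ ν n :=
    integral_nonneg_of_ae ((ae_alive_nonneg μ hν0 n).mono fun w hw => concaveTest_nonneg hr hb hw)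
  rw [alive_zero] at hsum
  unfold meanOvershoot
  linarith

lemma sum_alive_Icc_le_ofReal (hν : Integrable (fun x => |x|) ν) (hν0 : ν (Set.Iio 0) = 0) {r : ℝ}
    (hr : 0 ≤ r) (n : ℕ) {c : ℝ} (hc : ∫ w, concaveTest r (2 * thirdMoment μ) w ∂ν ≤ c) :
    ∑ k ∈ Finset.range n, alive μ ν k (Set.Icc 0 r)
      ≤ ENNReal.ofReal (4 * (c + (r + 4 * thirdMoment μ) * meanOvershoot μ ν n)) := by
  have h := sum_alive_real_Icc_le μ hν hν0 hr n
  have e : ∑ k ∈ Finset.range n, alive μ ν k (Set.Icc 0 r)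
      = ENNReal.ofReal (∑ k ∈ Finset.range n, (alive μ ν k).real (Set.Icc 0 r)) := by
    rw [ENNReal.ofReal_sum_of_nonneg fun _ _ => measureReal_nonneg]
    exact Finset.sum_congr rfl fun k _ => (ofReal_measureReal).symm
  rw [e]
  exact ENNReal.ofReal_le_ofReal (by linarith)

/-- The mean overshoot is at most a multiple of the third moment, uniformly in the starting
point. -/
theorem meanOvershoot_le (hν : Integrable (fun x => |x|) ν) (hν0 : ν (Set.Iio 0) = 0) (n : ℕ) :
    meanOvershoot μ ν n ≤ 48 * thirdMoment μ * ν.real Set.univ := by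
  set L := thirdMoment μ
  have hL : 1 ≤ L := IsStdLaw.one_le_thirdMoment μ
  set M := ν.real Set.univ
  have hM : 0 ≤ M := measureReal_nonneg
  set g := meanOvershoot μ ν n
  have hg : 0 ≤ g := meanOvershoot_nonneg μ ν n
  -- A self-bounding argument. Overshoots below the threshold contribute at most h M. Those above it
  -- need a jump exceeding h, and the Green function bounds them by 8 M L + 8 g L / h = 8 M L + g/2.
  -- The finite number g is then absorbed.
  set h := 16 * L
  set ψ : ℝ → ENNReal := fun a => if h < a then ENNReal.ofReal a else 0
  have hψ : Monotone ψ := fun a a' haa => by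
    simp only [ψ]
    split_ifs with h1 h2
    · exact ENNReal.ofReal_le_ofReal haa
    · exact absurd (h1.trans_le haa) h2
    · exact zero_le
    · exact le_rfl
  have h1 : ENNReal.ofReal g
      ≤ ENNReal.ofReal (h * M) + ∑ k ∈ Finset.range n, ∫⁻ w, ψ |w| ∂exitLaw μ ν k := by
    have e1 : ∀ k, ENNReal.ofReal (∫ w, |w| ∂exitLaw μ ν k)
        ≤ ENNReal.ofReal (h * (exitLaw μ ν k).real Set.univ) + ∫⁻ w, ψ |w| ∂exitLaw μ ν k :=
      fun k => by
        rw [ofReal_integral_eq_lintegral_ofReal (integrable_abs_exitLaw μ hν k)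
          (.of_forall fun _ => abs_nonneg _), ENNReal.ofReal_mul (by positivity),
          ofReal_measureReal, ← lintegral_const, ← lintegral_add_left measurable_const]
        refine lintegral_mono fun w => ?_
        simp only [ψ]
        split_ifs with hw
        · exact le_add_self
        · rw [add_zero]; exact ENNReal.ofReal_le_ofReal (not_lt.1 hw)
    calc ENNReal.ofReal g = ∑ k ∈ Finset.range n, ENNReal.ofReal (∫ w, |w| ∂exitLaw μ ν k) :=
          ENNReal.ofReal_sum_of_nonneg fun _ _ => integral_nonneg fun _ => abs_nonneg _
      _ ≤ _ := Finset.sum_le_sum fun k _ => e1 k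
      _ = ENNReal.ofReal (h * ∑ k ∈ Finset.range n, (exitLaw μ ν k).real Set.univ)
          + ∑ k ∈ Finset.range n, ∫⁻ w, ψ |w| ∂exitLaw μ ν k := by
          rw [Finset.sum_add_distrib, Finset.mul_sum,
            ENNReal.ofReal_sum_of_nonneg fun _ _ => by positivity]
      _ ≤ _ := by
          gcongr
          exact sum_exitLaw_real_univ_le μ ν n
  have h2 : ∑ k ∈ Finset.range n, ∫⁻ w, ψ |w| ∂exitLaw μ ν k
      ≤ ENNReal.ofReal ((8 * M + 8 * g / h) * L) := by
    refine (sum_lintegral_exitLaw_le μ hν0 hψ n).trans ?_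
    rw [show L = ∫ x, |x| ^ 3 ∂μ from rfl, ← integral_const_mul,
      ofReal_integral_eq_lintegral_ofReal (IsStdLaw.integrable_cube.const_mul _)
        (.of_forall fun _ => by positivity)]
    refine lintegral_mono fun x => ?_
    simp only [ψ]
    split_ifs with hx
    · have hc : ∫ w, concaveTest |x| (2 * L) w ∂ν ≤ (|x| + 2 * L) ^ 2 / 2 * M := by
        calc _ ≤ ∫ _, (|x| + 2 * L) ^ 2 / 2 ∂ν :=
              integral_mono_of_nonneg
                ((ae_alive_nonneg μ hν0 0).mono fun w hw =>
                  concaveTest_nonneg (abs_nonneg x) (by positivity) hw)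
                (integrable_const _)
                ((ae_alive_nonneg μ hν0 0).mono fun w hw => concaveTest_le (by positivity) hw)
          _ = _ := by rw [integral_const, smul_eq_mul, mul_comm]
      refine (mul_le_mul_right (sum_alive_Icc_le_ofReal μ hν hν0 (abs_nonneg x) n hc) _).trans ?_
      rw [← ENNReal.ofReal_mul (abs_nonneg x)]
      apply ENNReal.ofReal_le_ofReal
      have hx' : 16 * L < |x| := hx
      have e1 : (|x| + 2 * L) ^ 2 / 2 ≤ 2 * |x| ^ 2 := by nlinarith
      have e2 : |x| + 4 * L ≤ 2 * |x| := by linarith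
      have e3 : |x| ^ 2 ≤ |x| ^ 3 / h := by
        rw [le_div_iff₀ (by positivity)]
        nlinarith [sq_nonneg |x|]
      calc |x| * (4 * ((|x| + 2 * L) ^ 2 / 2 * M + (|x| + 4 * L) * g))
          ≤ |x| * (4 * (2 * |x| ^ 2 * M + 2 * |x| * g)) := by gcongr
        _ = 8 * M * |x| ^ 3 + 8 * g * |x| ^ 2 := by ring
        _ ≤ 8 * M * |x| ^ 3 + 8 * g * (|x| ^ 3 / h) := by gcongr
        _ = _ := by ring
    · rw [zero_mul]; exact zero_le
  have h3 := h1.trans (add_le_add_right h2 _)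
  rw [← ENNReal.ofReal_add (by positivity) (by positivity),
    ENNReal.ofReal_le_ofReal_iff (by positivity)] at h3
  have h4 : 8 * g / h * L = g / 2 := by simp only [h]; field_simp; ring
  rw [add_mul, h4] at h3
  simp only [h] at h3
  linarith

/-- From the origin the initial value of the concave test function is zero, so the Green function of
[0, r] grows only linearly in r. A third moment of the jumps therefore controls the second moment of
the overshoot: 4g(L + 4L) = 20 L g. -/
lemma sum_lintegral_sq_exitLaw_dirac_le (n : ℕ) :
    ∑ k ∈ Finset.range n, ∫⁻ w, ENNReal.ofReal (w ^ 2) ∂exitLaw μ (Measure.dirac 0) k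
      ≤ ENNReal.ofReal (20 * thirdMoment μ * meanOvershoot μ (Measure.dirac 0) n) := by
  set L := thirdMoment μ
  have hL : 1 ≤ L := IsStdLaw.one_le_thirdMoment μ
  set g := meanOvershoot μ (Measure.dirac 0) n
  have hg : 0 ≤ g := meanOvershoot_nonneg μ _ n
  have hν : Integrable (fun x : ℝ => |x|) (Measure.dirac 0) := integrable_dirac (by simp)
  have hν0 : (Measure.dirac (0 : ℝ)) (Set.Iio 0) = 0 := by simp
  set ψ : ℝ → ENNReal := fun a => ENNReal.ofReal ((max a 0) ^ 2)
  have hψ : Monotone ψ := fun a a' haa => by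
    simp only [ψ]
    apply ENNReal.ofReal_le_ofReal
    have := le_max_right a 0
    gcongr
  have hψe : ∀ w : ℝ, ψ |w| = ENNReal.ofReal (w ^ 2) := fun w => by
    simp only [ψ, max_eq_left (abs_nonneg w), sq_abs]
  have h := sum_lintegral_exitLaw_le μ hν0 hψ n
  simp_rw [hψe] at h
  refine h.trans ?_
  have e : 20 * L * g = ∫ x, (4 * g * |x| ^ 3 + 16 * L * g * x ^ 2) ∂μ := by
    rw [integral_add (IsStdLaw.integrable_cube.const_mul _)
      ((IsStdLaw.integrable_sq μ).const_mul _), integral_const_mul, integral_const_mul,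
      IsStdLaw.sq, ← thirdMoment]
    simp only [L]; ring
  have hi : Integrable (fun x => 4 * g * |x| ^ 3 + 16 * L * g * x ^ 2) μ :=
    (IsStdLaw.integrable_cube.const_mul _).add ((IsStdLaw.integrable_sq μ).const_mul _)
  rw [e, ofReal_integral_eq_lintegral_ofReal hi (.of_forall fun _ => by positivity)]
  refine lintegral_mono fun x => ?_
  have hc : ∫ w, concaveTest |x| (2 * L) w ∂Measure.dirac 0 ≤ 0 := by
    rw [integral_dirac, concaveTest_zero (abs_nonneg x) (by positivity)]
  refine (mul_le_mul_right (sum_alive_Icc_le_ofReal μ hν hν0 (abs_nonneg x) n hc) _).trans ?_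
  rw [← ENNReal.ofReal_mul (sq_nonneg x)]
  apply ENNReal.ofReal_le_ofReal
  rw [← sq_abs]
  apply le_of_eq
  simp only [g, L]
  ring

end Moments

/-! ### Positive association of the walk with its survival -/

/-- Chebyshev's association inequality. -/
lemma lintegral_mul_lintegral_le_of_monotone (μ : Measure ℝ) [IsProbabilityMeasure μ]
    {f g : ℝ → ENNReal} (hf : Monotone f) (hg : Monotone g) :
    (∫⁻ x, f x ∂μ) * ∫⁻ x, g x ∂μ ≤ ∫⁻ x, f x * g x ∂μ := by
  -- This is (f x - f y)(g x - g y) ≥ 0 without subtraction. It is then integrated over two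
  -- independent copies.
  have hpt : ∀ x y, f x * g y + f y * g x ≤ f x * g x + f y * g y := by
    have : ∀ x y, x ≤ y → f x * g y + f y * g x ≤ f x * g x + f y * g y := fun x y hxy => by
      obtain ⟨c, hc⟩ := exists_add_of_le (hf hxy)
      obtain ⟨d, hd⟩ := exists_add_of_le (hg hxy)
      rw [hc, hd]
      calc _ ≤ f x * (g x + d) + (f x + c) * g x + c * d := le_self_add
        _ = _ := by ring
    intro x y
    rcases le_total x y with h | h
    · exact this x y h
    · have := this y x h
      rwa [add_comm, add_comm (f x * g x)]
  have hfm := hf.measurable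
  have hgm := hg.measurable
  have h := lintegral_mono (μ := μ) fun x => lintegral_mono (μ := μ) fun y => hpt x y
  have e1 : ∫⁻ x, ∫⁻ y, (f x * g y + f y * g x) ∂μ ∂μ
      = 2 * ((∫⁻ x, f x ∂μ) * ∫⁻ x, g x ∂μ) := by
    have : ∀ x, ∫⁻ y, (f x * g y + f y * g x) ∂μ
        = f x * ∫⁻ y, g y ∂μ + (∫⁻ y, f y ∂μ) * g x := fun x => by
      rw [lintegral_add_left (hgm.const_mul _), lintegral_const_mul _ hgm,
        lintegral_mul_const _ hfm]
    simp_rw [this]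
    rw [lintegral_add_left (hfm.mul_const _), lintegral_mul_const _ hfm,
      lintegral_const_mul _ hgm]
    ring
  have e2 : ∫⁻ x, ∫⁻ y, (f x * g x + f y * g y) ∂μ ∂μ = 2 * ∫⁻ x, f x * g x ∂μ := by
    have : ∀ x, ∫⁻ y, (f x * g x + f y * g y) ∂μ = f x * g x + ∫⁻ y, f y * g y ∂μ := fun x => by
      rw [lintegral_add_left measurable_const]; simp
    simp_rw [this]
    rw [lintegral_add_left (f := fun x => f x * g x) (hfm.mul hgm)]
    simp only [lintegral_const, measure_univ, mul_one]
    ring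
  rw [e1, e2] at h
  exact (ENNReal.mul_le_mul_iff_right two_ne_zero ENNReal.ofNat_ne_top).1 h

/-- The transition operator of the walk. -/
noncomputable def freeOp (μ : Measure ℝ) (f : ℝ → ENNReal) (w : ℝ) : ENNReal :=
  ∫⁻ x, f (w + x) ∂μ

/-- The transition operator of the walk killed when it becomes non-positive. -/
noncomputable def killOp (μ : Measure ℝ) (f : ℝ → ENNReal) (w : ℝ) : ENNReal :=
  ∫⁻ x, (Set.Ioi 0).indicator f (w + x) ∂μ

lemma monotone_freeOp (μ : Measure ℝ) {f : ℝ → ENNReal} (hf : Monotone f) :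
    Monotone (freeOp μ f) := fun _ _ h => lintegral_mono fun _ => hf (by linarith)

lemma monotone_indicator_Ioi {f : ℝ → ENNReal} (hf : Monotone f) :
    Monotone ((Set.Ioi (0 : ℝ)).indicator f) := fun x y h => by
  by_cases hx : 0 < x
  · rw [Set.indicator_of_mem (by exact hx), Set.indicator_of_mem (by exact hx.trans_le h)]
    exact hf h
  · rw [Set.indicator_of_notMem (by exact hx)]; exact zero_le

lemma monotone_killOp (μ : Measure ℝ) {f : ℝ → ENNReal} (hf : Monotone f) :
    Monotone (killOp μ f) := monotone_freeOp μ (monotone_indicator_Ioi hf)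

lemma monotone_killOp_iterate (μ : Measure ℝ) {f : ℝ → ENNReal} (hf : Monotone f) (n : ℕ) :
    Monotone ((killOp μ)^[n] f) := by
  induction n with
  | zero => exact hf
  | succ n ih => rw [Function.iterate_succ_apply']; exact monotone_killOp μ ih

lemma monotone_freeOp_iterate (μ : Measure ℝ) {f : ℝ → ENNReal} (hf : Monotone f) (n : ℕ) :
    Monotone ((freeOp μ)^[n] f) := by
  induction n with
  | zero => exact hf
  | succ n ih => rw [Function.iterate_succ_apply']; exact monotone_freeOp μ ih

lemma alive_succ_eq_alive_kill (μ ν : Measure ℝ) (n : ℕ) :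
    alive μ ν (n + 1) = alive μ (kill μ ν) n := Function.iterate_succ_apply _ _ _

lemma lintegral_alive (μ ν : Measure ℝ) [IsProbabilityMeasure μ] {f : ℝ → ENNReal}
    (hf : Monotone f) (n : ℕ) : ∫⁻ w, f w ∂alive μ ν n = ∫⁻ w, (killOp μ)^[n] f w ∂ν := by
  induction n generalizing ν with
  | zero => rfl
  | succ n ih =>
    have hm := (monotone_killOp_iterate μ hf n).measurable
    rw [alive_succ_eq_alive_kill, ih, kill, ← lintegral_indicator measurableSet_Ioi,
      Measure.lintegral_conv (hm.indicator measurableSet_Ioi), Function.iterate_succ_apply']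
    rfl

lemma lintegral_conv_convPow (μ ν : Measure ℝ) [IsProbabilityMeasure μ] {f : ℝ → ENNReal}
    (hf : Monotone f) (n : ℕ) :
    ∫⁻ w, f w ∂(ν ∗ convPow μ n) = ∫⁻ w, (freeOp μ)^[n] f w ∂ν := by
  induction n generalizing f with
  | zero => rw [Measure.lintegral_conv hf.measurable]; simp [convPow]
  | succ n ih =>
    rw [convPow, ← Measure.conv_assoc, Measure.lintegral_conv hf.measurable,
      Function.iterate_succ_apply, ← ih (monotone_freeOp μ hf)]
    rfl

/-- Conditioning on the first increment, both the free expectation of an increasing function and the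
survival probability are increasing in that increment. Association gives one step, and the induction
hypothesis applies pointwise. -/
lemma freeOp_mul_killOp_le (μ : Measure ℝ) [IsProbabilityMeasure μ] {f : ℝ → ENNReal}
    (hf : Monotone f) (n : ℕ) (w : ℝ) :
    (freeOp μ)^[n] f w * (killOp μ)^[n] 1 w ≤ (killOp μ)^[n] f w := by
  induction n generalizing w with
  | zero => simp
  | succ n ih =>
    simp only [Function.iterate_succ_apply']
    have h1 := monotone_freeOp_iterate μ hf n
    have h2 := monotone_indicator_Ioi
      (monotone_killOp_iterate μ (monotone_const : Monotone (1 : ℝ → ENNReal)) n)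
    have hw : Monotone fun x : ℝ => w + x := fun _ _ h => by simpa using h
    refine (lintegral_mul_lintegral_le_of_monotone μ (h1.comp hw) (h2.comp hw)).trans ?_
    refine lintegral_mono fun x => ?_
    simp only [Function.comp_apply]
    by_cases hx : 0 < w + x
    · rw [Set.indicator_of_mem (by exact hx), Set.indicator_of_mem (by exact hx)]
      exact ih _
    · rw [Set.indicator_of_notMem (by exact hx), mul_zero]; exact zero_le

/-- Survival makes the walk stochastically larger. -/
lemma real_Ici_mul_alive_le (μ : Measure ℝ) [IsProbabilityMeasure μ] (u b : ℝ) (n : ℕ) :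
    (convPow μ n).real (Set.Ici (b - u)) * (alive μ (Measure.dirac u) n).real Set.univ
      ≤ (alive μ (Measure.dirac u) n).real (Set.Ici b) := by
  have hf : Monotone ((Set.Ici b).indicator (1 : ℝ → ENNReal)) := fun x y h => by
    by_cases hx : b ≤ x
    · rw [Set.indicator_of_mem (by exact hx), Set.indicator_of_mem (by exact hx.trans h)]
      rfl
    · rw [Set.indicator_of_notMem (by exact hx)]; exact zero_le
  have h1 : Monotone (1 : ℝ → ENNReal) := monotone_const
  have h := freeOp_mul_killOp_le μ hf n u
  have e1 := lintegral_alive μ (Measure.dirac u) hf n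
  have e2 := lintegral_alive μ (Measure.dirac u) h1 n
  have e3 := lintegral_conv_convPow μ (Measure.dirac u) hf n
  rw [lintegral_dirac' _ (monotone_killOp_iterate μ hf n).measurable,
    lintegral_indicator_one measurableSet_Ici] at e1
  rw [lintegral_dirac' _ (monotone_killOp_iterate μ h1 n).measurable] at e2
  rw [lintegral_dirac' _ (monotone_freeOp_iterate μ hf n).measurable,
    lintegral_indicator_one measurableSet_Ici] at e3
  simp only [Pi.one_apply, lintegral_one] at e2
  rw [← e1, ← e2, ← e3] at h
  have e4 : (Measure.dirac u ∗ convPow μ n) (Set.Ici b) = convPow μ n (Set.Ici (b - u)) := by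
    rw [Measure.dirac_conv, Measure.map_apply (by fun_prop) measurableSet_Ici]
    congr 1; ext x; simp
  rw [e4] at h
  have := ENNReal.toReal_mono (measure_ne_top _ _) h
  rwa [ENNReal.toReal_mul] at this

/-! ### Survival probabilities -/

section Survival

variable (μ : Measure ℝ) [IsStdLaw μ]

lemma integrable_abs_dirac (u : ℝ) : Integrable (fun x : ℝ => |x|) (Measure.dirac u) :=
  integrable_dirac (by simp)

lemma dirac_Iio_zero {u : ℝ} (hu : 0 ≤ u) : Measure.dirac u (Set.Iio 0) = 0 := by
  simp [hu]

/-- By association a surviving walk exceeds √n/4 at least as often as the free walk does, and the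
latter probability is at least 1/2 - 1/4 - 1/8 = 1/8 by the Lipschitz bound on the normal law and
Berry–Esseen. Markov's inequality for the surviving walk, whose mean is u plus the overshoot, gives
32 = 4 · 8. -/
lemma alive_dirac_real_univ_le_meanOvershoot {u : ℝ} (hu : 0 ≤ u) {n : ℕ}
    (hn : 8 * beConst * thirdMoment μ ≤ √n) :
    (alive μ (Measure.dirac u) n).real Set.univ
      ≤ 32 * (u + meanOvershoot μ (Measure.dirac u) n) / √n := by
  set K := beConst
  have hK : 1 ≤ K := one_le_beConst
  set L := thirdMoment μ
  have hL : 1 ≤ L := IsStdLaw.one_le_thirdMoment μ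
  have hq : 0 < √(n : ℝ) := lt_of_lt_of_le (by positivity) hn
  have hn1 : 1 ≤ n := by
    by_contra! h
    have : n = 0 := by omega
    rw [this] at hq; simp at hq
  have h1 : 1 / 8 ≤ (convPow μ n).real (Set.Ici (√n / 4 - u)) := by
    have a1 : (convPow μ n).real (Set.Ici (√n / 4))
        ≤ (convPow μ n).real (Set.Ici (√n / 4 - u)) :=
      measureReal_mono (Set.Ici_subset_Ici.2 (by linarith))
    have a2 := (abs_le.1 (berryEsseen_Ici μ hn1 (√n / 4))).1
    have a3 : -(√(n : ℝ) / 4) / √n = -(1 / 4) := by field_simp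
    rw [a3] at a2
    have a4 : stdCdf 0 = 1 / 2 := by
      have := stdCdf_neg 0
      rw [neg_zero] at this; linarith
    have a5 := (abs_le.1 (abs_stdCdf_sub_le 0 (-(1 / 4)))).2
    rw [show |(0 : ℝ) - -(1 / 4)| = 1 / 4 by norm_num] at a5
    have a6 : K * L / √(n : ℝ) ≤ 1 / 8 := by
      rw [div_le_div_iff₀ hq (by norm_num)]; linarith
    linarith
  have h2 := real_Ici_mul_alive_le μ u (√n / 4) n
  have hint := integrable_abs_alive μ (integrable_abs_dirac u) n
  have h3 : √n / 4 * (alive μ (Measure.dirac u) n).real (Set.Ici (√n / 4))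
      ≤ u + meanOvershoot μ (Measure.dirac u) n := by
    have := integral_id_alive μ (integrable_abs_dirac u) n
    rw [integral_dirac] at this
    rw [← this, mul_comm, ← smul_eq_mul, ← integral_indicator_const _ measurableSet_Ici]
    refine integral_mono_ae ((integrable_const _).indicator measurableSet_Ici)
      (hint.mono' (by fun_prop) (.of_forall fun _ => le_rfl))
      ((ae_alive_nonneg μ (dirac_Iio_zero hu) n).mono fun w hw => ?_)
    by_cases h : √n / 4 ≤ w
    · rw [Set.indicator_of_mem (by exact h)]; exact h
    · rw [Set.indicator_of_notMem (by exact h)]; exact hw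
  have h4 : 0 ≤ (alive μ (Measure.dirac u) n).real Set.univ := measureReal_nonneg
  rw [le_div_iff₀ hq]
  have h5 : 1 / 8 * (alive μ (Measure.dirac u) n).real Set.univ
      ≤ (alive μ (Measure.dirac u) n).real (Set.Ici (√n / 4)) := by
    refine le_trans ?_ h2
    gcongr
  nlinarith

lemma alive_dirac_real_univ_le_one (u : ℝ) (n : ℕ) :
    (alive μ (Measure.dirac u) n).real Set.univ ≤ 1 := by
  have := alive_real_univ_le μ (Measure.dirac u) n
  rwa [probReal_univ (μ := Measure.dirac u)] at this

/-- The probability of surviving for `n` steps from a given starting point. -/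
lemma alive_dirac_real_univ_le {u : ℝ} (hu : 0 ≤ u) (n : ℕ) :
    (alive μ (Measure.dirac u) n).real Set.univ
      ≤ 3072 * beConst * (u + thirdMoment μ) / √(n + 1) := by
  set K := beConst
  have hK : 1 ≤ K := one_le_beConst
  set L := thirdMoment μ
  have hL : 1 ≤ L := IsStdLaw.one_le_thirdMoment μ
  have h1 := alive_dirac_real_univ_le_one μ u n
  have hq1 : √((n : ℝ) + 1) ≤ √(n : ℝ) + 1 := by
    refine Real.sqrt_le_iff.2 ⟨by positivity, ?_⟩
    nlinarith [Real.sq_sqrt (n.cast_nonneg : (0 : ℝ) ≤ n), Real.sqrt_nonneg (n : ℝ)]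
  have hKL : 1 ≤ K * L := one_le_mul_of_one_le_of_one_le hK hL
  have hKu : 0 ≤ K * u := by positivity
  rw [le_div_iff₀ (by positivity)]
  -- Small n are covered by the trivial bound 1, since then √n + 1 is at most a multiple of K L.
  rcases le_or_gt (8 * K * L) (√n) with h | h
  · have h2 := alive_dirac_real_univ_le_meanOvershoot μ hu h
    have h3 := meanOvershoot_le μ (integrable_abs_dirac u) (dirac_Iio_zero hu) n
    rw [probReal_univ (μ := Measure.dirac u), mul_one] at h3
    have hq : 0 < √(n : ℝ) := lt_of_lt_of_le (by positivity) h
    rw [le_div_iff₀ hq] at h2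
    have h4 : √((n : ℝ) + 1) ≤ 2 * √(n : ℝ) := by
      have : 8 ≤ 8 * K * L := by nlinarith
      linarith
    have h0 : 0 ≤ (alive μ (Measure.dirac u) n).real Set.univ := measureReal_nonneg
    calc _ ≤ (alive μ (Measure.dirac u) n).real Set.univ * (2 * √n) := by gcongr
      _ ≤ 2 * (32 * (u + 48 * L)) := by linarith
      _ ≤ 3072 * K * (u + L) := by nlinarith
  · calc _ ≤ 1 * (√n + 1) := by gcongr
      _ ≤ _ := by nlinarith

lemma inv_le_integral_abs : 1 / thirdMoment μ ≤ ∫ x, |x| ∂μ := by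
  set L := thirdMoment μ
  have hL : 1 ≤ L := IsStdLaw.one_le_thirdMoment μ
  -- Pointwise this is |x|(L - |x|)² ≥ 0. Integrated, it reads 1 ≤ (L/2) E|X| + 1/2.
  have h : ∫ x, x ^ 2 ∂μ ≤ ∫ x, (L / 2 * |x| + 1 / (2 * L) * |x| ^ 3) ∂μ := by
    refine integral_mono (IsStdLaw.integrable_sq μ)
      (((IsStdLaw.integrable_abs μ).const_mul _).add (IsStdLaw.integrable_cube.const_mul _))
      fun x => ?_
    simp only
    rw [← sq_abs]
    have h1 := mul_nonneg (abs_nonneg x) (sq_nonneg (L - |x|))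
    have h2 : L / 2 * |x| + 1 / (2 * L) * |x| ^ 3 - |x| ^ 2
        = |x| * (L - |x|) ^ 2 / (2 * L) := by field_simp; ring
    have : 0 ≤ |x| * (L - |x|) ^ 2 / (2 * L) := by positivity
    linarith
  rw [IsStdLaw.sq, integral_add ((IsStdLaw.integrable_abs μ).const_mul _)
    (IsStdLaw.integrable_cube.const_mul _), integral_const_mul, integral_const_mul,
    ← thirdMoment] at h
  have h2 : 1 / (2 * L) * L = 1 / 2 := by field_simp
  rw [h2] at h
  rw [div_le_iff₀ (by positivity)]
  linarith

/-- The exit at the very first step alone contributes the mean of the negative part, which is E|X|/2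
because the mean vanishes. -/
lemma le_meanOvershoot_dirac {n : ℕ} (hn : 1 ≤ n) :
    1 / (2 * thirdMoment μ) ≤ meanOvershoot μ (Measure.dirac 0) n := by
  have h1 : ∫ w, |w| ∂exitLaw μ (Measure.dirac 0) 0 ≤ meanOvershoot μ (Measure.dirac 0) n :=
    Finset.single_le_sum (f := fun k => ∫ w, |w| ∂exitLaw μ (Measure.dirac 0) k)
      (fun k _ => integral_nonneg fun _ => abs_nonneg _) (Finset.mem_range.2 hn)
  have h2 : ∫ w, |w| ∂exitLaw μ (Measure.dirac 0) 0 = (∫ x, |x| ∂μ) / 2 := by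
    rw [exitLaw, alive_zero, Measure.dirac_zero_conv, ← integral_indicator measurableSet_Iic]
    have e : (Set.Iic (0 : ℝ)).indicator (fun w => |w|) = fun w => (|w| - w) / 2 := by
      ext w
      by_cases h : w ≤ 0
      · rw [Set.indicator_of_mem (by exact h), abs_of_nonpos h]; ring
      · rw [Set.indicator_of_notMem (by exact h), abs_of_pos (not_le.1 h)]; ring
    rw [e, integral_div, integral_sub (IsStdLaw.integrable_abs μ) (IsStdLaw.integrable_id μ),
      IsStdLaw.mean, sub_zero]
  have h3 := inv_le_integral_abs μ
  have h4 : 1 / (2 * thirdMoment μ) = 1 / thirdMoment μ / 2 := by ring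
  rw [h4]; linarith

end Survival

/-! ### Time reversal -/

lemma measurable_measure_Ioc_sub (ρ : Measure ℝ) [IsFiniteMeasure ρ] (a : ℝ) :
    Measurable fun w => ρ (Set.Ioc (w - a) w) := by
  have h1 : Measurable fun p : ℝ × ℝ => p.1 - a := by fun_prop
  have hset : MeasurableSet {p : ℝ × ℝ | p.2 ∈ Set.Ioc (p.1 - a) p.1} :=
    (measurableSet_lt h1 measurable_snd).inter (measurableSet_le measurable_snd measurable_fst)
  exact (measurable_measure_prodMk_left (ν := ρ) hset :)

lemma conv_Ioc_sub (μ ρ : Measure ℝ) [IsFiniteMeasure μ] [IsFiniteMeasure ρ] (a w : ℝ) :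
    (ρ ∗ μ) (Set.Ioc (w - a) w) = ∫⁻ x, ρ (Set.Ioc (w - x - a) (w - x)) ∂μ := by
  rw [Measure.conv_comm, ← lintegral_indicator_one measurableSet_Ioc,
    Measure.lintegral_conv (measurable_one.indicator measurableSet_Ioc)]
  refine lintegral_congr fun x => ?_
  rw [← lintegral_indicator_one measurableSet_Ioc]
  refine lintegral_congr fun u => ?_
  simp only [Set.indicator, Set.mem_Ioc]
  congr 1
  refine propext ⟨fun h => ⟨by linarith [h.1], by linarith [h.2]⟩,
    fun h => ⟨by linarith [h.1], by linarith [h.2]⟩⟩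

/-- A forward step of the ρ-point is the same as a reflected step of the window. Forgetting the
killing of the former only increases the integral. Killing of the latter is free: a window ending at
w ≤ 0 carries no ρ-mass. -/
lemma lintegral_kill_Ioc_le (μ ρ ν : Measure ℝ) [IsProbabilityMeasure μ] [IsFiniteMeasure ρ]
    [IsFiniteMeasure ν] (hρ : ρ (Set.Iic 0) = 0) (a : ℝ) :
    ∫⁻ w, kill μ ρ (Set.Ioc (w - a) w) ∂ν
      ≤ ∫⁻ w, ρ (Set.Ioc (w - a) w) ∂kill (reflectLaw μ) ν := by
  have : IsProbabilityMeasure (reflectLaw μ) := Measure.isProbabilityMeasure_map (by fun_prop)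
  have hm := measurable_measure_Ioc_sub ρ a
  have hind : (Set.Ioi (0 : ℝ)).indicator (fun w => ρ (Set.Ioc (w - a) w))
      = fun w => ρ (Set.Ioc (w - a) w) := by
    rw [Set.indicator_eq_self]
    intro w hw
    rw [Function.mem_support] at hw
    by_contra h
    exact hw (measure_mono_null (fun u hu => hu.2.trans (not_lt.1 h)) hρ)
  rw [kill, kill, ← lintegral_indicator measurableSet_Ioi, hind, Measure.lintegral_conv hm]
  refine lintegral_mono fun w => (Measure.restrict_apply_le _ _).trans ?_
  have hmw : Measurable fun y => ρ (Set.Ioc (w + y - a) (w + y)) :=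
    hm.comp (measurable_const_add w)
  rw [conv_Ioc_sub, reflectLaw, lintegral_map hmw (by fun_prop)]
  exact le_of_eq (lintegral_congr fun x => by rw [← sub_eq_add_neg])

/-- Reversing the walk from its exit time. -/
lemma lintegral_exitLaw_le_reversed (μ ρ : Measure ℝ) [IsProbabilityMeasure μ] [IsFiniteMeasure ρ]
    (hρ : ρ (Set.Iic 0) = 0) {φ : ℝ → ENNReal} (hφ : Monotone φ) (j : ℕ) :
    ∫⁻ w, φ |w| ∂exitLaw μ ρ j ≤ ∫⁻ x, φ |x| * ∫⁻ w, ρ (Set.Ioc (w - |x|) w)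
        ∂alive (reflectLaw μ) (Measure.dirac |x|) j ∂μ := by
  have : IsProbabilityMeasure (reflectLaw μ) := Measure.isProbabilityMeasure_map (by fun_prop)
  -- For a path u + S_i positive up to time j, with u + S_j ≤ |x| just before the jump x, the
  -- reversed walk from |x| satisfies |x| - (S_j - S_i) ≥ u + S_i > 0. At its endpoint w the
  -- condition 0 < u + S_j ≤ |x| becomes u ∈ (w - |x|, w].
  induction j generalizing ρ with
  | zero =>
    have h := sum_lintegral_exitLaw_le μ (measure_mono_null Set.Iio_subset_Iic_self hρ) hφ 1
    simp only [Finset.range_one, Finset.sum_singleton] at h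
    refine h.trans (lintegral_mono fun x => ?_)
    simp only [alive_zero]
    rw [lintegral_dirac' _ (measurable_measure_Ioc_sub ρ _), sub_self]
    refine mul_le_mul' le_rfl ?_
    calc ρ (Set.Icc 0 |x|) ≤ ρ (Set.Iic 0 ∪ Set.Ioc 0 |x|) := measure_mono fun u hu => by
          rcases le_or_gt u 0 with h | h
          · exact Or.inl h
          · exact Or.inr ⟨h, hu.2⟩
      _ ≤ ρ (Set.Iic 0) + ρ (Set.Ioc 0 |x|) := measure_union_le _ _
      _ = _ := by rw [hρ, zero_add]
  | succ j ih =>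
    have e : exitLaw μ ρ (j + 1) = exitLaw μ (kill μ ρ) j := by
      rw [add_comm, exitLaw_add]; rfl
    have : IsFiniteMeasure (kill μ ρ) := by unfold kill; infer_instance
    have h0 : kill μ ρ (Set.Iic 0) = 0 := alive_succ_Iic μ ρ 0
    rw [e]
    refine (ih (kill μ ρ) h0).trans (lintegral_mono fun x => ?_)
    refine mul_le_mul' le_rfl ?_
    refine (lintegral_kill_Ioc_le μ ρ _ hρ |x|).trans (le_of_eq ?_)
    rw [alive_succ]; rfl

/-! ### Local bounds for the exit time and the overshoot. -/

section

variable (μ : Measure ℝ) [IsStdLaw μ] {ν : Measure ℝ} [IsFiniteMeasure ν]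

lemma alive_Ioc_le {i : ℕ} (hi : 1 ≤ i) {a b : ℝ} (hab : a ≤ b) :
    alive μ ν i (Set.Ioc a b)
      ≤ ENNReal.ofReal ((b - a + 2 * beConst * thirdMoment μ) / √i * ν.real Set.univ) := by
  have h1 : alive μ ν i (Set.Ioc a b) ≤ (ν ∗ convPow μ i) (Set.Ioc a b) := by
    rw [← alive_add_sum_exitLaw_conv]
    exact Measure.le_add_right le_rfl _
  refine h1.trans ?_
  have h0 : 0 ≤ (b - a + 2 * beConst * thirdMoment μ) / √i := by
    have := one_le_beConst
    have := IsStdLaw.one_le_thirdMoment μ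
    have : 0 ≤ b - a := by linarith
    positivity
  rw [← lintegral_indicator_one measurableSet_Ioc,
    Measure.lintegral_conv (measurable_one.indicator measurableSet_Ioc), ENNReal.ofReal_mul h0,
    ofReal_measureReal, ← lintegral_const]
  refine lintegral_mono fun u => ?_
  have e : ∫⁻ x, (Set.Ioc a b).indicator 1 (u + x) ∂convPow μ i
      = convPow μ i (Set.Ioc (a - u) (b - u)) := by
    rw [← lintegral_indicator_one measurableSet_Ioc]
    refine lintegral_congr fun x => ?_
    simp only [Set.indicator, Set.mem_Ioc]
    congr 1
    refine propext ⟨fun h => ⟨by linarith [h.1], by linarith [h.2]⟩,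
      fun h => ⟨by linarith [h.1], by linarith [h.2]⟩⟩
  rw [e, ← ofReal_measureReal]
  apply ENNReal.ofReal_le_ofReal
  have := convPow_real_Ioc_le μ hi (a := a - u) (b := b - u) (by linarith)
  rwa [sub_sub_sub_cancel_right] at this

/-- Time is split at i. By concentration a window of length |x| carries mass O((|x| + L)/√i) at time
i, and the reversed walk from |x| survives the other j steps with probability O((|x| + L)/√(j + 1)).
Together with the weight L + |x| this is a cube, integrable against `μ`. -/
lemma integral_exitLaw_add_le {i : ℕ} (hi : 1 ≤ i) (j : ℕ)
    (hν : Integrable (fun x => |x|) ν) :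
    ∫ w, (thirdMoment μ + |w|) ∂exitLaw μ ν (i + j)
      ≤ 49152 * beConst ^ 2 * thirdMoment μ ^ 3 / (√i * √(j + 1)) * ν.real Set.univ := by
  set K := beConst
  have hK : 1 ≤ K := one_le_beConst
  set L := thirdMoment μ
  have hL : 1 ≤ L := IsStdLaw.one_le_thirdMoment μ
  set M := ν.real Set.univ
  have hM : 0 ≤ M := measureReal_nonneg
  have hsi : 0 < √(i : ℝ) := by positivity
  have hsj : 0 < √((j : ℝ) + 1) := by positivity
  set φ : ℝ → ENNReal := fun a => ENNReal.ofReal (L + a)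
  have hφ : Monotone φ := fun a b h => ENNReal.ofReal_le_ofReal (by linarith)
  obtain ⟨i', rfl⟩ : ∃ i', i = i' + 1 := ⟨i - 1, by omega⟩
  have h := lintegral_exitLaw_le_reversed μ (alive μ ν (i' + 1)) (alive_succ_Iic μ ν i') hφ j
  rw [← exitLaw_add] at h
  have hint : Integrable (fun w => L + |w|) (exitLaw μ ν (i' + 1 + j)) :=
    (integrable_const _).add (integrable_abs_exitLaw μ hν _)
  have e1 : ∫⁻ w, φ |w| ∂exitLaw μ ν (i' + 1 + j)
      = ENNReal.ofReal (∫ w, (L + |w|) ∂exitLaw μ ν (i' + 1 + j)) :=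
    (ofReal_integral_eq_lintegral_ofReal hint (.of_forall fun _ => by positivity)).symm
  rw [e1] at h
  set c := 6144 * K ^ 2 * M / (√((i' + 1 : ℕ) : ℝ) * √((j : ℝ) + 1))
  have hc : 0 ≤ c := by positivity
  have hcube : Integrable (fun x => 4 * (L ^ 3 + |x| ^ 3)) μ :=
    ((integrable_const _).add IsStdLaw.integrable_cube).const_mul 4
  have h2 : ∫⁻ x, φ |x| * ∫⁻ w, alive μ ν (i' + 1) (Set.Ioc (w - |x|) w)
        ∂alive (reflectLaw μ) (Measure.dirac |x|) j ∂μ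
      ≤ ENNReal.ofReal (∫ x, c * (4 * (L ^ 3 + |x| ^ 3)) ∂μ) := by
    rw [ofReal_integral_eq_lintegral_ofReal (hcube.const_mul c)
      (.of_forall fun _ => by positivity)]
    refine lintegral_mono fun x => ?_
    have hx := abs_nonneg x
    have a1 : ∫⁻ w, alive μ ν (i' + 1) (Set.Ioc (w - |x|) w)
        ∂alive (reflectLaw μ) (Measure.dirac |x|) j
        ≤ ENNReal.ofReal ((|x| + 2 * K * L) / √((i' + 1 : ℕ) : ℝ) * M
          * (3072 * K * (|x| + L) / √((j : ℝ) + 1))) := by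
      rw [ENNReal.ofReal_mul (by positivity)]
      calc _ ≤ ∫⁻ _, ENNReal.ofReal ((|x| + 2 * K * L) / √((i' + 1 : ℕ) : ℝ) * M)
            ∂alive (reflectLaw μ) (Measure.dirac |x|) j := lintegral_mono fun w => by
              have := alive_Ioc_le μ (ν := ν) hi (a := w - |x|) (b := w) (by linarith)
              rwa [sub_sub_cancel] at this
        _ ≤ _ := by
            rw [lintegral_const, ← ofReal_measureReal]
            gcongr
            have := alive_dirac_real_univ_le (reflectLaw μ) hx j
            rwa [thirdMoment_reflectLaw] at this
    calc _ ≤ φ |x| * ENNReal.ofReal ((|x| + 2 * K * L) / √((i' + 1 : ℕ) : ℝ) * M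
          * (3072 * K * (|x| + L) / √((j : ℝ) + 1))) := by gcongr
      _ ≤ _ := by
          rw [← ENNReal.ofReal_mul (by positivity)]
          apply ENNReal.ofReal_le_ofReal
          have b1 : |x| + 2 * K * L ≤ 2 * K * (|x| + L) := by nlinarith
          have b2 : (|x| + L) ^ 3 ≤ 4 * (L ^ 3 + |x| ^ 3) := by
            nlinarith [mul_nonneg (add_nonneg hx (by linarith : (0 : ℝ) ≤ L))
              (sq_nonneg (|x| - L))]
          calc _ ≤ (L + |x|) * ((2 * K * (|x| + L)) / √((i' + 1 : ℕ) : ℝ) * M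
                * (3072 * K * (|x| + L) / √((j : ℝ) + 1))) := by gcongr
            _ = c * (|x| + L) ^ 3 := by simp only [c]; field_simp; ring
            _ ≤ _ := by gcongr
  have h3 := h.trans h2
  have e2 : ∫ x, c * (4 * (L ^ 3 + |x| ^ 3)) ∂μ = c * (4 * (L ^ 3 + L)) := by
    rw [integral_const_mul, integral_const_mul, integral_add (integrable_const _)
      IsStdLaw.integrable_cube, ← thirdMoment]
    simp [L]
  rw [e2, ENNReal.ofReal_le_ofReal_iff (by positivity)] at h3
  refine h3.trans ?_
  have b3 : L ≤ L ^ 3 := by nlinarith [sq_nonneg L, sq_nonneg (L - 1)]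
  calc c * (4 * (L ^ 3 + L)) ≤ c * (4 * (L ^ 3 + L ^ 3)) := by gcongr
    _ = _ := by simp only [c]; ring

lemma sum_integral_exitLaw_le (hν : Integrable (fun x => |x|) ν) (hν0 : ν (Set.Iio 0) = 0)
    (n : ℕ) :
    ∑ k ∈ Finset.range n, ∫ w, (thirdMoment μ + |w|) ∂exitLaw μ ν k
      ≤ 49 * thirdMoment μ * ν.real Set.univ := by
  have hL : 1 ≤ thirdMoment μ := IsStdLaw.one_le_thirdMoment μ
  have e : ∀ k, ∫ w, (thirdMoment μ + |w|) ∂exitLaw μ ν k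
      = thirdMoment μ * (exitLaw μ ν k).real Set.univ + ∫ w, |w| ∂exitLaw μ ν k := fun k => by
    rw [integral_add (integrable_const _) (integrable_abs_exitLaw μ hν k), integral_const,
      smul_eq_mul, mul_comm]
  simp_rw [e]
  rw [Finset.sum_add_distrib, ← Finset.mul_sum]
  have h1 := sum_exitLaw_real_univ_le μ ν n
  have h2 := meanOvershoot_le μ hν hν0 n
  unfold meanOvershoot at h2
  nlinarith

/-- The local bound for the exit time and the overshoot. -/
lemma integral_exitLaw_le (hν : Integrable (fun x => |x|) ν) (hν0 : ν (Set.Iio 0) = 0) (k : ℕ) :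
    ∫ w, (thirdMoment μ + |w|) ∂exitLaw μ ν k
      ≤ 196608 * beConst ^ 2 * thirdMoment μ ^ 3 / (k + 1) * ν.real Set.univ := by
  set K := beConst
  have hK : 1 ≤ K := one_le_beConst
  set L := thirdMoment μ
  have hL : 1 ≤ L := IsStdLaw.one_le_thirdMoment μ
  set M := ν.real Set.univ
  have hM : 0 ≤ M := measureReal_nonneg
  rcases Nat.eq_zero_or_pos k with rfl | hk
  · have h := sum_integral_exitLaw_le μ hν hν0 1
    rw [Finset.range_one, Finset.sum_singleton] at h
    refine h.trans ?_
    simp only [CharP.cast_eq_zero, zero_add, div_one]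
    refine mul_le_mul_of_nonneg_right ?_ hM
    change 49 * L ≤ _
    have h1 : 1 ≤ K ^ 2 := one_le_pow₀ hK
    have h2 : L ≤ L ^ 3 := by nlinarith [sq_nonneg L, sq_nonneg (L - 1)]
    nlinarith
  -- Half-way splitting makes both i and j + 1 at least (k + 1)/4, which accounts for the factor 4
  -- in 196608 = 4 · 49152.
  · set i := (k + 1) / 2
    have hi : 1 ≤ i := by omega
    obtain ⟨j, hj⟩ : ∃ j, k = i + j := ⟨k - i, by omega⟩
    have h := integral_exitLaw_add_le μ hi j hν
    rw [← hj] at h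
    refine h.trans ?_
    have h1 : (k : ℝ) + 1 ≤ 4 * i := by
      have : k + 1 ≤ 4 * i := by omega
      exact_mod_cast this
    have h2 : (k : ℝ) + 1 ≤ 4 * (j + 1) := by
      have : k + 1 ≤ 4 * (j + 1) := by omega
      exact_mod_cast this
    have h3 : ((k : ℝ) + 1) / 4 ≤ √i * √(j + 1) := by
      rw [← Real.sqrt_mul (by positivity)]
      apply Real.le_sqrt_of_sq_le
      have : (0 : ℝ) ≤ (k + 1) / 4 := by positivity
      nlinarith
    gcongr ?_ * _
    calc _ ≤ 49152 * K ^ 2 * L ^ 3 / (((k : ℝ) + 1) / 4) := by gcongr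
      _ = _ := by field_simp; ring

end

/-! ### The killed walk at a fixed time -/

/-- The probability that Brownian motion started from `y`, killed at `0`, is above `z` at the time
`s ^ 2`. -/
noncomputable def killedHeat (z s y : ℝ) : ℝ := scaledCdf s (y - z) - scaledCdf s (-z - y)

lemma conv_real_Ici (ρ ν : Measure ℝ) [IsFiniteMeasure ρ] [IsFiniteMeasure ν] (z : ℝ) :
    (ρ ∗ ν).real (Set.Ici z) = ∫ w, ν.real (Set.Ici (z - w)) ∂ρ := by
  rw [← integral_indicator_one measurableSet_Ici, integral_conv]
  · congr 1; ext w
    rw [← integral_indicator_one measurableSet_Ici]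
    congr 1; ext y
    simp [Set.indicator, add_comm]
  · exact (integrable_const 1).indicator measurableSet_Ici

lemma sum_inv_sqrt_le (m : ℕ) : ∑ k ∈ Finset.range m, 1 / √((m - k : ℕ) : ℝ) ≤ 2 * √m := by
  have h : ∀ n : ℕ, ∑ k ∈ Finset.range n, 1 / √((k : ℝ) + 1) ≤ 2 * √n := fun n => by
    induction n with
    | zero => simp
    | succ n ih =>
      rw [Finset.sum_range_succ]
      push_cast
      set x := √(n : ℝ)
      set y := √((n : ℝ) + 1)
      have hx : 0 ≤ x := Real.sqrt_nonneg _
      have hy : 0 < y := by positivity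
      have hx2 : x ^ 2 = n := Real.sq_sqrt n.cast_nonneg
      have hy2 : y ^ 2 = n + 1 := Real.sq_sqrt (by positivity)
      have hxy : x ≤ y := Real.sqrt_le_sqrt (by linarith)
      have : 1 / y ≤ 2 * y - 2 * x := by
        rw [div_le_iff₀ hy]; nlinarith [sq_nonneg (y - x)]
      linarith
  refine le_trans (le_of_eq ?_) (h m)
  rw [← Finset.sum_range_reflect]
  refine Finset.sum_congr rfl fun k hk => ?_
  rw [Finset.mem_range] at hk
  rw [show m - (m - 1 - k) = k + 1 by omega]
  push_cast; rfl

section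

variable (μ : Measure ℝ) [IsStdLaw μ] {ν : Measure ℝ} [IsFiniteMeasure ν]

/-- The two half-lines are mirror images about -w, so a centred normal law gives them masses
differing by at most 2|w|/√j; Berry–Esseen adds two errors. The form √(j + 1) includes j = 0. -/
lemma abs_convPow_Ici_sub_Iic_le (j : ℕ) (z w : ℝ) :
    |(convPow μ j).real (Set.Ici (z - w)) - (convPow μ j).real (Set.Iic (-z - w))|
      ≤ 4 * beConst * (thirdMoment μ + |w|) / √(j + 1 : ℕ) := by
  set K := beConst
  have hK : 1 ≤ K := one_le_beConst
  set L := thirdMoment μ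
  have hL : 1 ≤ L := IsStdLaw.one_le_thirdMoment μ
  have hw := abs_nonneg w
  have hKL : 1 ≤ K * L := one_le_mul_of_one_le_of_one_le hK hL
  rcases Nat.eq_zero_or_pos j with rfl | hj
  · simp only [zero_add, Nat.cast_one, Real.sqrt_one, div_one]
    have h1 : |(convPow μ 0).real (Set.Ici (z - w)) - (convPow μ 0).real (Set.Iic (-z - w))| ≤ 1 :=
      abs_sub_le_iff.2
        ⟨by linarith [measureReal_le_one (μ := convPow μ 0) (s := Set.Ici (z - w)),
            measureReal_nonneg (μ := convPow μ 0) (s := Set.Iic (-z - w))],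
          by linarith [measureReal_nonneg (μ := convPow μ 0) (s := Set.Ici (z - w)),
            measureReal_le_one (μ := convPow μ 0) (s := Set.Iic (-z - w))]⟩
    nlinarith
  · have hq : 0 < √(j : ℝ) := by positivity
    have h1 := abs_le.1 (berryEsseen_Ici μ hj (z - w))
    have h2 := abs_le.1 (berryEsseen_Iic μ hj (-z - w))
    have h3 := abs_stdCdf_sub_le (-(z - w) / √j) ((-z - w) / √j)
    rw [← sub_div, show -(z - w) - (-z - w) = 2 * w by ring, abs_div, abs_of_pos hq, abs_mul,
      abs_two] at h3
    have h3 := abs_le.1 h3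
    have h4 : √((j + 1 : ℕ) : ℝ) ≤ 2 * √(j : ℝ) := by
      refine Real.sqrt_le_iff.2 ⟨by positivity, ?_⟩
      have : (1 : ℝ) ≤ j := by exact_mod_cast hj
      rw [mul_pow, Real.sq_sqrt (by positivity)]; push_cast; linarith
    have h5 : 2 * (K * L / √(j : ℝ)) + 2 * |w| / √j ≤ 4 * K * (L + |w|) / √((j + 1 : ℕ) : ℝ) := by
      calc _ = 2 * (2 * (K * L + |w|)) / (2 * √(j : ℝ)) := by field_simp
        _ ≤ 2 * (2 * (K * L + K * |w|)) / (2 * √(j : ℝ)) := by 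
            gcongr; exact le_mul_of_one_le_left hw hK
        _ ≤ 2 * (2 * (K * L + K * |w|)) / √((j + 1 : ℕ) : ℝ) := by gcongr
        _ = _ := by ring
    exact abs_le.2 ⟨by linarith, by linarith⟩

/-- The reflection principle for the killed walk, with an error that is uniform in the starting
law. -/
lemma abs_alive_real_Ici_sub_le (hν : Integrable (fun x => |x|) ν) (hν0 : ν (Set.Iio 0) = 0)
    {m : ℕ} (hm : 1 ≤ m) {z : ℝ} (hz : 0 ≤ z) :
    |(alive μ ν m).real (Set.Ici z) - ∫ y, killedHeat z (√m) y ∂ν|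
      ≤ 4000000 * beConst ^ 3 * thirdMoment μ ^ 3 / √m * ν.real Set.univ := by
  set K := beConst
  have hK : 1 ≤ K := one_le_beConst
  set L := thirdMoment μ
  have hL : 1 ≤ L := IsStdLaw.one_le_thirdMoment μ
  set M := ν.real Set.univ
  have hM : 0 ≤ M := measureReal_nonneg
  set q := √(m : ℝ)
  have hq : 0 < q := by positivity
  have hq2 : q ^ 2 = m := Real.sq_sqrt m.cast_nonneg
  have hIci : ∀ (ρ : Measure ℝ) [IsFiniteMeasure ρ] (j : ℕ),
      Integrable (fun y => (convPow μ j).real (Set.Ici (z - y))) ρ := fun ρ _ j =>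
    (integrable_const (1 : ℝ)).mono'
      (Monotone.measurable fun x y h =>
        measureReal_mono (Set.Ici_subset_Ici.2 (by linarith))).aestronglyMeasurable
      (.of_forall fun y => by
        rw [Real.norm_of_nonneg measureReal_nonneg]; exact measureReal_le_one)
  have hIic : ∀ (ρ : Measure ℝ) [IsFiniteMeasure ρ] (j : ℕ),
      Integrable (fun y => (convPow μ j).real (Set.Iic (-z - y))) ρ := fun ρ _ j =>
    (integrable_const (1 : ℝ)).mono'
      ((measurable_real_Iic _).comp (measurable_const.sub measurable_id)).aestronglyMeasurable
      (.of_forall fun y => by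
        rw [Real.norm_of_nonneg measureReal_nonneg]; exact measureReal_le_one)
  -- Antisymmetrisation: mass above z minus mass below -z. The killed walk has none of the latter,
  -- so its mass above z is the free difference minus the restarts from exit points, which are
  -- nearly symmetric.
  set δ : ℕ → ℝ → ℝ := fun j y =>
    (convPow μ j).real (Set.Ici (z - y)) - (convPow μ j).real (Set.Iic (-z - y))
  have hδ : ∀ (ρ : Measure ℝ) [IsFiniteMeasure ρ] (j : ℕ),
      (ρ ∗ convPow μ j).real (Set.Ici z) - (ρ ∗ convPow μ j).real (Set.Iic (-z))
        = ∫ y, δ j y ∂ρ := fun ρ _ j => by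
    rw [conv_real_Ici, conv_real_Iic, ← integral_sub (hIci ρ j) (hIic ρ j)]
  -- decomposition by the exit time
  have hdec : (alive μ ν m).real (Set.Ici z)
      = ∫ y, δ m y ∂ν - ∑ k ∈ Finset.range m, ∫ w, δ (m - 1 - k) w ∂exitLaw μ ν k := by
    have h1 := alive_real_add_sum μ ν m (Set.Ici z)
    have h2 := alive_real_add_sum μ ν m (Set.Iic (-z))
    have h3 : (alive μ ν m).real (Set.Iic (-z)) = 0 := by
      obtain ⟨m', rfl⟩ : ∃ m', m = m' + 1 := ⟨m - 1, by omega⟩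
      rw [Measure.real, measure_mono_null (Set.Iic_subset_Iic.2 (by linarith))
        (alive_succ_Iic μ ν m')]
      rfl
    have h4 : ∑ k ∈ Finset.range m, ∫ w, δ (m - 1 - k) w ∂exitLaw μ ν k
        = ∑ k ∈ Finset.range m, (exitLaw μ ν k ∗ convPow μ (m - 1 - k)).real (Set.Ici z)
          - ∑ k ∈ Finset.range m, (exitLaw μ ν k ∗ convPow μ (m - 1 - k)).real (Set.Iic (-z)) := by
      rw [← Finset.sum_sub_distrib]
      exact Finset.sum_congr rfl fun k _ => (hδ _ _).symm
    rw [h4, ← hδ]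
    linarith
  -- the free walk
  have hfree : |∫ y, δ m y ∂ν - ∫ y, killedHeat z q y ∂ν| ≤ 2 * (K * L / q) * M := by
    have hk : Integrable (killedHeat z q) ν := by
      refine Integrable.sub ?_ (integrable_scaledCdf_sub ν (-z))
      refine (integrable_const (1 : ℝ)).mono' ?_ (.of_forall fun _ => abs_scaledCdf_le _)
      have := continuous_scaledCdf (r := q)
      exact (by fun_prop : Continuous fun y => scaledCdf q (y - z)).aestronglyMeasurable
    have hδi : Integrable (δ m) ν := (hIci ν m).sub (hIic ν m)
    rw [← integral_sub hδi hk]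
    refine (norm_integral_le_of_norm_le_const (G := ℝ) (μ := ν) (C := 2 * (K * L / q)) (.of_forall fun y => ?_))
    have h1 := abs_le.1 (berryEsseen_Ici μ hm (z - y))
    have h2 := abs_le.1 (berryEsseen_Iic μ hm (-z - y))
    rw [neg_sub] at h1
    simp only [killedHeat, scaledCdf, Real.norm_eq_abs]
    exact abs_le.2 ⟨by linarith, by linarith⟩
  -- the exit terms
  set Cr := 196608 * K ^ 2 * L ^ 3
  have hexit : ∀ k ∈ Finset.range m, |∫ w, δ (m - 1 - k) w ∂exitLaw μ ν k|
      ≤ 4 * K * (2 / q * (∫ w, (L + |w|) ∂exitLaw μ ν k)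
        + 2 * Cr * M / m * (1 / √((m - k : ℕ) : ℝ))) := by
    intro k hk
    rw [Finset.mem_range] at hk
    have hint : Integrable (fun w => L + |w|) (exitLaw μ ν k) :=
      (integrable_const _).add (integrable_abs_exitLaw μ hν k)
    have hs : 0 < √((m - k : ℕ) : ℝ) := by
      have : 0 < m - k := by omega
      positivity
    have h1 : |∫ w, δ (m - 1 - k) w ∂exitLaw μ ν k|
        ≤ 4 * K * ((∫ w, (L + |w|) ∂exitLaw μ ν k) / √((m - k : ℕ) : ℝ)) := by
      rw [← integral_div, ← integral_const_mul]
      refine norm_integral_le_of_norm_le (G := ℝ) ((hint.div_const _).const_mul _)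
        (.of_forall fun w => ?_)
      have := abs_convPow_Ici_sub_Iic_le μ (m - 1 - k) z w
      rw [show m - 1 - k + 1 = m - k by omega] at this
      simpa only [Real.norm_eq_abs, mul_div_assoc] using this
    refine h1.trans ?_
    gcongr 4 * K * ?_
    have hI : 0 ≤ ∫ w, (L + |w|) ∂exitLaw μ ν k := integral_nonneg fun _ => by positivity
    -- After an early exit at least half the time remains, and the total mass and overshoot of the
    -- exits suffice. A late exit leaves little time, and the local bound O(1/(k + 1)) is used
    -- against the sum of 1/√(m - k).
    rcases le_or_gt (2 * (k + 1)) m with h2 | h2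
    · have h3 : q / 2 ≤ √((m - k : ℕ) : ℝ) := by
        apply Real.le_sqrt_of_sq_le
        rw [div_pow, hq2, Nat.cast_sub hk.le]
        have : (2 * (k + 1) : ℝ) ≤ m := by exact_mod_cast h2
        have : (0 : ℝ) ≤ m := m.cast_nonneg
        linarith
      have h4 : (∫ w, (L + |w|) ∂exitLaw μ ν k) / √((m - k : ℕ) : ℝ)
          ≤ 2 / q * ∫ w, (L + |w|) ∂exitLaw μ ν k := by
        calc _ ≤ (∫ w, (L + |w|) ∂exitLaw μ ν k) / (q / 2) := by gcongr
          _ = _ := by field_simp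
      have : 0 ≤ 2 * Cr * M / m * (1 / √((m - k : ℕ) : ℝ)) := by positivity
      linarith
    · have h3 := integral_exitLaw_le μ hν hν0 k
      have h4 : Cr / (k + 1) ≤ 2 * Cr / m := by
        rw [div_le_div_iff₀ (by positivity) (by positivity)]
        have : (m : ℝ) ≤ 2 * (k + 1) := by exact_mod_cast h2.le
        have : 0 ≤ Cr := by positivity
        nlinarith
      have h5 : (∫ w, (L + |w|) ∂exitLaw μ ν k) / √((m - k : ℕ) : ℝ)
          ≤ 2 * Cr * M / m * (1 / √((m - k : ℕ) : ℝ)) := by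
        rw [mul_one_div]
        gcongr
        calc _ ≤ Cr / (k + 1) * M := h3
          _ ≤ 2 * Cr / m * M := by gcongr
          _ = _ := by ring
      have : 0 ≤ 2 / q * ∫ w, (L + |w|) ∂exitLaw μ ν k := by positivity
      linarith
  have hsum : |∑ k ∈ Finset.range m, ∫ w, δ (m - 1 - k) w ∂exitLaw μ ν k|
      ≤ 4 * K * (2 / q * (49 * L * M) + 2 * Cr * M / m * (2 * q)) := by
    refine (Finset.abs_sum_le_sum_abs _ _).trans ((Finset.sum_le_sum hexit).trans ?_)
    rw [← Finset.mul_sum, Finset.sum_add_distrib, ← Finset.mul_sum, ← Finset.mul_sum]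
    have h1 := sum_integral_exitLaw_le μ hν hν0 m
    have h2 := sum_inv_sqrt_le m
    gcongr
  have hfin : 2 * (K * L / q) * M + 4 * K * (2 / q * (49 * L * M) + 2 * Cr * M / m * (2 * q))
      ≤ 4000000 * K ^ 3 * L ^ 3 / q * M := by
    have e : 2 * (K * L / q) * M + 4 * K * (2 / q * (49 * L * M) + 2 * Cr * M / m * (2 * q))
        = (394 * (K * L) + 16 * 196608 * (K ^ 3 * L ^ 3)) / q * M := by
      simp only [Cr]; rw [← hq2]; field_simp; ring
    rw [e]
    have h1 : K * L ≤ K ^ 3 * L ^ 3 := by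
      have : 1 ≤ K * L := one_le_mul_of_one_le_of_one_le hK hL
      rw [← mul_pow]
      exact le_self_pow₀ this (by norm_num)
    gcongr
    linarith [show 0 ≤ K ^ 3 * L ^ 3 by positivity]
  have h1 := abs_le.1 hfree
  have h2 := abs_le.1 hsum
  rw [hdec]
  exact abs_le.2 ⟨by linarith, by linarith⟩

end

/-! ### The mean exit position of the walk started from the origin -/

lemma meanOvershoot_add (μ ν : Measure ℝ) (i j : ℕ) :
    meanOvershoot μ ν (i + j) = meanOvershoot μ ν i + meanOvershoot μ (alive μ ν i) j := by
  unfold meanOvershoot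
  rw [Finset.sum_range_add]
  simp_rw [exitLaw_add]

/-- The modulus of the mean exit position of the walk started from the origin. -/
noncomputable def exitMean (μ : Measure ℝ) : ℝ :=
  ∑' k, ∫ w, |w| ∂exitLaw μ (Measure.dirac 0) k

section

variable (μ : Measure ℝ) [IsStdLaw μ]

lemma summable_integral_abs_exitLaw :
    Summable fun k => ∫ w, |w| ∂exitLaw μ (Measure.dirac 0) k :=
  summable_of_sum_range_le (fun _ => integral_nonneg fun _ => abs_nonneg _)
    (meanOvershoot_le μ (integrable_abs_dirac 0) (dirac_Iio_zero le_rfl))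

lemma meanOvershoot_le_exitMean (n : ℕ) : meanOvershoot μ (Measure.dirac 0) n ≤ exitMean μ :=
  (summable_integral_abs_exitLaw μ).sum_le_tsum _ fun _ _ => integral_nonneg fun _ => abs_nonneg _

/-- The walk is restarted at time i from the law of the survivors; the overshoot bound is linear in
its mass and insensitive to its position. -/
lemma meanOvershoot_sub_le {i m : ℕ} (h : i ≤ m) :
    meanOvershoot μ (Measure.dirac 0) m - meanOvershoot μ (Measure.dirac 0) i
      ≤ 48 * thirdMoment μ * (alive μ (Measure.dirac 0) i).real Set.univ := by
  obtain ⟨j, rfl⟩ := Nat.exists_eq_add_of_le h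
  rw [meanOvershoot_add, add_sub_cancel_left]
  exact meanOvershoot_le μ (integrable_abs_alive μ (integrable_abs_dirac 0) i)
    (alive_Iio μ (dirac_Iio_zero le_rfl) i) j

lemma exitMean_sub_le (m : ℕ) :
    exitMean μ - meanOvershoot μ (Measure.dirac 0) m
      ≤ 48 * thirdMoment μ * (alive μ (Measure.dirac 0) m).real Set.univ := by
  rw [sub_le_iff_le_add']
  refine Real.tsum_le_of_sum_range_le (fun _ => integral_nonneg fun _ => abs_nonneg _) fun n => ?_
  have hL : 1 ≤ thirdMoment μ := IsStdLaw.one_le_thirdMoment μ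
  have h0 : 0 ≤ (alive μ (Measure.dirac 0) m).real Set.univ := measureReal_nonneg
  change meanOvershoot μ (Measure.dirac 0) n ≤ _
  rcases le_total m n with h | h
  · linarith [meanOvershoot_sub_le μ h]
  · have : meanOvershoot μ (Measure.dirac 0) n ≤ meanOvershoot μ (Measure.dirac 0) m :=
      Finset.sum_le_sum_of_subset_of_nonneg (by simpa using h)
        fun _ _ _ => integral_nonneg fun _ => abs_nonneg _
    have : 0 ≤ 48 * thirdMoment μ * (alive μ (Measure.dirac 0) m).real Set.univ := by positivity
    linarith

lemma le_exitMean : 1 / (2 * thirdMoment μ) ≤ exitMean μ :=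
  (le_meanOvershoot_dirac μ le_rfl).trans (meanOvershoot_le_exitMean μ 1)

lemma exitMean_pos : 0 < exitMean μ := by
  have hL : 1 ≤ thirdMoment μ := IsStdLaw.one_le_thirdMoment μ
  exact lt_of_lt_of_le (by positivity) (le_exitMean μ)

lemma survival_le_exitMean {n : ℕ} (hn : 8 * beConst * thirdMoment μ ≤ √n) :
    (alive μ (Measure.dirac 0) n).real Set.univ ≤ 32 * exitMean μ / √n := by
  have h := alive_dirac_real_univ_le_meanOvershoot μ le_rfl hn
  rw [zero_add] at h
  refine h.trans ?_
  gcongr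
  exact meanOvershoot_le_exitMean μ n

/-- The point is the factor κ. For small n it is inserted into the trivial bound 1 through 1 ≤ 2Lκ,
at the price of one more factor L. -/
lemma survival_le_sq_mul_exitMean (n : ℕ) :
    (alive μ (Measure.dirac 0) n).real Set.univ
      ≤ 64 * beConst * thirdMoment μ ^ 2 * exitMean μ / √(n + 1) := by
  set K := beConst
  have hK : 1 ≤ K := one_le_beConst
  set L := thirdMoment μ
  have hL : 1 ≤ L := IsStdLaw.one_le_thirdMoment μ
  have hκ := exitMean_pos μ
  have hq1 : √((n : ℝ) + 1) ≤ √(n : ℝ) + 1 := by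
    refine Real.sqrt_le_iff.2 ⟨by positivity, ?_⟩
    nlinarith [Real.sq_sqrt (n.cast_nonneg : (0 : ℝ) ≤ n), Real.sqrt_nonneg (n : ℝ)]
  have hKL : 1 ≤ K * L := one_le_mul_of_one_le_of_one_le hK hL
  have h0 : 0 ≤ (alive μ (Measure.dirac 0) n).real Set.univ := measureReal_nonneg
  rw [le_div_iff₀ (by positivity)]
  rcases le_or_gt (8 * K * L) (√n) with h | h
  · have h1 := survival_le_exitMean μ h
    have hq : 0 < √(n : ℝ) := lt_of_lt_of_le (by positivity) h
    rw [le_div_iff₀ hq] at h1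
    have h2 : √((n : ℝ) + 1) ≤ 2 * √(n : ℝ) := by nlinarith
    have h3 : 1 ≤ K * L ^ 2 := one_le_mul_of_one_le_of_one_le hK (one_le_pow₀ hL)
    calc _ ≤ (alive μ (Measure.dirac 0) n).real Set.univ * (2 * √n) := by gcongr
      _ ≤ 64 * 1 * exitMean μ := by linarith
      _ ≤ 64 * (K * L ^ 2) * exitMean μ := by gcongr
      _ = _ := by ring
  · have h1 := le_exitMean μ
    rw [div_le_iff₀ (by positivity)] at h1
    calc _ ≤ 1 * (√n + 1) := by
          gcongr
          exact alive_dirac_real_univ_le_one μ 0 n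
      _ ≤ 9 * (K * L) * 1 := by linarith
      _ ≤ 9 * (K * L) * (exitMean μ * (2 * L)) := by gcongr
      _ ≤ _ := by nlinarith [show 0 ≤ K * L ^ 2 * exitMean μ by positivity]

lemma sum_survival_le (m : ℕ) :
    ∑ k ∈ Finset.range m, (alive μ (Measure.dirac 0) k).real Set.univ
      ≤ 128 * beConst * thirdMoment μ ^ 2 * exitMean μ * √m := by
  have hK := one_le_beConst
  have hL := IsStdLaw.one_le_thirdMoment μ
  have hκ := exitMean_pos μ
  have h := sum_inv_sqrt_le m
  rw [← Finset.sum_range_reflect] at h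
  calc _ ≤ ∑ k ∈ Finset.range m, 64 * beConst * thirdMoment μ ^ 2 * exitMean μ
        * (1 / √((m - (m - 1 - k) : ℕ) : ℝ)) := by
        refine Finset.sum_le_sum fun k hk => ?_
        rw [Finset.mem_range] at hk
        rw [show m - (m - 1 - k) = k + 1 by omega, mul_one_div]
        push_cast
        exact survival_le_sq_mul_exitMean μ k
    _ = 64 * beConst * thirdMoment μ ^ 2 * exitMean μ
        * ∑ k ∈ Finset.range m, 1 / √((m - (m - 1 - k) : ℕ) : ℝ) := by rw [Finset.mul_sum]
    _ ≤ 64 * beConst * thirdMoment μ ^ 2 * exitMean μ * (2 * √m) := by gcongr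
    _ = _ := by ring

lemma integrable_sq_exitLaw_dirac (k : ℕ) :
    Integrable (fun w : ℝ => w ^ 2) (exitLaw μ (Measure.dirac 0) k) := by
  have h := sum_lintegral_sq_exitLaw_dirac_le μ (k + 1)
  have h1 : ∫⁻ w, ENNReal.ofReal (w ^ 2) ∂exitLaw μ (Measure.dirac 0) k < ⊤ :=
    lt_of_le_of_lt ((Finset.single_le_sum
      (f := fun k => ∫⁻ w, ENNReal.ofReal (w ^ 2) ∂exitLaw μ (Measure.dirac 0) k)
      (fun _ _ => zero_le) (Finset.self_mem_range_succ k)).trans h) ENNReal.ofReal_lt_top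
  refine ⟨by fun_prop, ?_⟩
  rw [hasFiniteIntegral_iff_ofReal (.of_forall fun w => sq_nonneg w)]
  exact h1

lemma sum_integral_sq_exitLaw_dirac_le (n : ℕ) :
    ∑ k ∈ Finset.range n, ∫ w, w ^ 2 ∂exitLaw μ (Measure.dirac 0) k
      ≤ 20 * thirdMoment μ * exitMean μ := by
  have hL := IsStdLaw.one_le_thirdMoment μ
  have h := sum_lintegral_sq_exitLaw_dirac_le μ n
  simp_rw [← ofReal_integral_eq_lintegral_ofReal (integrable_sq_exitLaw_dirac μ _)
    (.of_forall fun w => sq_nonneg w)] at h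
  rw [← ENNReal.ofReal_sum_of_nonneg fun _ _ => integral_nonneg fun _ => sq_nonneg _,
    ENNReal.ofReal_le_ofReal_iff (mul_nonneg (by positivity) (meanOvershoot_nonneg μ _ n))] at h
  refine h.trans ?_
  gcongr
  exact meanOvershoot_le_exitMean μ n

/-- Summation by parts turns the weight k + 1 into a sum of overshoots collected after time i, each
bounded by restarting at i. -/
lemma sum_succ_mul_integral_abs_exitLaw_le (m : ℕ) :
    ∑ k ∈ Finset.range m, ((k : ℝ) + 1) * ∫ w, |w| ∂exitLaw μ (Measure.dirac 0) k
      ≤ 48 * thirdMoment μ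
        * ∑ k ∈ Finset.range m, (alive μ (Measure.dirac 0) k).real Set.univ := by
  have h : ∀ m : ℕ, ∑ k ∈ Finset.range m, ((k : ℝ) + 1) * ∫ w, |w| ∂exitLaw μ (Measure.dirac 0) k
      = ∑ i ∈ Finset.range m,
        (meanOvershoot μ (Measure.dirac 0) m - meanOvershoot μ (Measure.dirac 0) i) := fun m => by
    induction m with
    | zero => simp
    | succ m ih =>
      rw [Finset.sum_range_succ, ih]
      simp only [Finset.sum_sub_distrib, Finset.sum_const, Finset.card_range, nsmul_eq_mul]
      rw [Finset.sum_range_succ (fun i => meanOvershoot μ (Measure.dirac 0) i)]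
      have : meanOvershoot μ (Measure.dirac 0) (m + 1) = meanOvershoot μ (Measure.dirac 0) m
          + ∫ w, |w| ∂exitLaw μ (Measure.dirac 0) m := Finset.sum_range_succ _ _
      rw [this]; push_cast; ring
  rw [h, Finset.mul_sum]
  exact Finset.sum_le_sum fun i hi => meanOvershoot_sub_le μ (Finset.mem_range.1 hi).le

end

/-! ### The killed heat semigroup -/

section

variable {s : ℝ} (z : ℝ)

/-- The first derivative of `killedHeat` in the starting point. -/
noncomputable def killedHeat₁ (z s y : ℝ) : ℝ := scaledCdf₁ s (y - z) + scaledCdf₁ s (-z - y)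

lemma killedHeat_zero : killedHeat z s 0 = 0 := by simp [killedHeat]

lemma hasDerivAt_killedHeat (y : ℝ) : HasDerivAt (killedHeat z s) (killedHeat₁ z s y) y := by
  have h1 := (hasDerivAt_scaledCdf (r := s) (y - z)).comp_sub_const y z
  have h2 := (hasDerivAt_scaledCdf (r := s) (-z - y)).comp_const_sub (-z) y
  exact (h1.sub h2).congr_deriv (by simp [killedHeat₁])

lemma hasDerivAt_killedHeat₁ (hs : 0 < s) (y : ℝ) :
    HasDerivAt (killedHeat₁ z s) (scaledCdf₂ s (y - z) - scaledCdf₂ s (-z - y)) y := by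
  have h1 := (hasDerivAt_scaledCdf₁ hs (y - z)).comp_sub_const y z
  have h2 := (hasDerivAt_scaledCdf₁ hs (-z - y)).comp_const_sub (-z) y
  exact (h1.add h2).congr_deriv (by ring)

lemma hasDerivAt_killedHeat₂ (hs : 0 < s) (y : ℝ) :
    HasDerivAt (fun y => scaledCdf₂ s (y - z) - scaledCdf₂ s (-z - y))
      (scaledCdf₃ s (y - z) + scaledCdf₃ s (-z - y)) y := by
  have h1 := (hasDerivAt_scaledCdf₂ hs (y - z)).comp_sub_const y z
  have h2 := (hasDerivAt_scaledCdf₂ hs (-z - y)).comp_const_sub (-z) y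
  exact (h1.sub h2).congr_deriv (by ring)

lemma continuous_killedHeat : Continuous (killedHeat z s) :=
  continuous_iff_continuousAt.2 fun y => (hasDerivAt_killedHeat z y).continuousAt

lemma abs_killedHeat_le (y : ℝ) : |killedHeat z s y| ≤ 2 := by
  have h1 := abs_le.1 (abs_scaledCdf_le (r := s) (y - z))
  have h2 := abs_le.1 (abs_scaledCdf_le (r := s) (-z - y))
  unfold killedHeat
  exact abs_le.2 ⟨by linarith, by linarith⟩

lemma integrable_killedHeat (ρ : Measure ℝ) [IsFiniteMeasure ρ] :
    Integrable (killedHeat z s) ρ :=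
  (integrable_const (2 : ℝ)).mono' (continuous_killedHeat z).aestronglyMeasurable
    (.of_forall fun y => abs_killedHeat_le z y)

lemma killedHeat₁_zero : killedHeat₁ z s 0 = 2 * stdPdf (z / s) / s := by
  simp only [killedHeat₁, scaledCdf₁, zero_sub, sub_zero, neg_div]
  have : stdPdf (-(z / s)) = stdPdf (z / s) := by simp [stdPdf]
  rw [this]; ring

/-- First-order Taylor expansion at the boundary, where the function vanishes. The formula also
makes sense for w < 0, as the odd extension, so exit positions may be inserted. -/
lemma abs_killedHeat_sub_le (hs : 0 < s) (w : ℝ) :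
    |killedHeat z s w - 2 * stdPdf (z / s) / s * w| ≤ 2 / s ^ 2 * w ^ 2 := by
  have := abs_sub_taylor_one_le (hasDerivAt_killedHeat z) (hasDerivAt_killedHeat₁ z hs)
    (B := 2 / s ^ 2) (fun y => by
      refine (abs_sub _ _).trans ?_
      have h1 := abs_scaledCdf₂_le hs (y - z)
      have h2 := abs_scaledCdf₂_le hs (-z - y)
      have : 2 / s ^ 2 = 1 / s ^ 2 + 1 / s ^ 2 := by ring
      linarith) w
  rwa [killedHeat_zero, sub_zero, killedHeat₁_zero] at this

lemma integral_comp_neg_gaussianReal (f : ℝ → ℝ) :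
    ∫ x, f (-x) ∂gaussianReal 0 1 = ∫ x, f x ∂gaussianReal 0 1 := by
  rw [← integral_reflectLaw, reflectLaw, gaussianReal_map_neg, neg_zero]

/-- The function is a difference of two solutions of the free heat equation, so an unkilled normal
step simply raises the variance by one. -/
lemma integral_killedHeat_gaussianReal (hs : 0 < s) (w : ℝ) :
    ∫ x, killedHeat z s (w + x) ∂gaussianReal 0 1 = killedHeat z (√(s ^ 2 + 1)) w := by
  have i1 : Integrable (fun x => scaledCdf s (w - z + x)) (gaussianReal 0 1) := by
    refine (integrable_const (1 : ℝ)).mono' ?_ (.of_forall fun _ => abs_scaledCdf_le _)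
    exact ((continuous_scaledCdf (r := s)).comp (continuous_const_add _)).aestronglyMeasurable
  have e : ∀ x, killedHeat z s (w + x)
      = scaledCdf s (w - z + x) - scaledCdf s (-z - w - x) := fun x => by
    unfold killedHeat
    congr 2 <;> ring
  simp_rw [e]
  rw [integral_sub i1 (integrable_scaledCdf_sub _ _), scaledCdf_integral_gaussianReal_one hs,
    ← integral_comp_neg_gaussianReal]
  simp_rw [← sub_eq_add_neg]
  rw [scaledCdf_integral_gaussianReal_one hs, killedHeat]

lemma abs_integral_killedHeat_sub_le (μ : Measure ℝ) [IsStdLaw μ] (hs : 0 < s) (w : ℝ) :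
    |∫ x, killedHeat z s (w + x) ∂μ - killedHeat z (√(s ^ 2 + 1)) w|
      ≤ 2 / s ^ 3 * (thirdMoment μ + thirdMoment (gaussianReal 0 1)) := by
  rw [← integral_killedHeat_gaussianReal z hs]
  refine abs_integral_sub_integral_le_of_stdLaw μ (gaussianReal 0 1)
    (fun y => (hasDerivAt_killedHeat z (w + y)).comp_const_add w y)
    (fun y => (hasDerivAt_killedHeat₁ z hs (w + y)).comp_const_add w y)
    (fun y => (hasDerivAt_killedHeat₂ z hs (w + y)).comp_const_add w y) fun y => ?_
  refine (abs_add_le _ _).trans ?_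
  have h1 := abs_scaledCdf₃_le hs (w + y - z)
  have h2 := abs_scaledCdf₃_le hs (-z - (w + y))
  have : 2 / s ^ 3 = 1 / s ^ 3 + 1 / s ^ 3 := by ring
  linarith

/-- The boundary derivative depends on the remaining time t; freezing it at n must cost a bound
uniform in z. The prefactor and the exponential are varied separately. -/
lemma abs_stdPdf_div_sub_le {t n : ℝ} (hn : 0 < n) (ht : n / 2 ≤ t) (htn : t ≤ n) :
    |2 * stdPdf (z / √t) / √t - 2 * stdPdf (z / √n) / √n| ≤ 4 * (n - t) / (n * √n) := by
  have ht0 : 0 < t := by linarith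
  set p := √t
  set q := √n
  have hp : 0 < p := by positivity
  have hq : 0 < q := by positivity
  have hp2 : p ^ 2 = t := Real.sq_sqrt ht0.le
  have hq2 : q ^ 2 = n := Real.sq_sqrt hn.le
  have hpq : p ≤ q := Real.sqrt_le_sqrt htn
  set c := (√(2 * Real.pi))⁻¹
  have hc : c ≤ 1 / 2 := inv_sqrt_two_pi_le
  have hc0 : 0 ≤ c := by positivity
  set b := z ^ 2 / (2 * n)
  set a := z ^ 2 / (2 * t)
  have hb0 : 0 ≤ b := by positivity
  have hab : a - b = b * ((n - t) / t) := by simp only [a, b]; field_simp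
  have hnt : 0 ≤ (n - t) / t := div_nonneg (by linarith) ht0.le
  have hnt2 : (n - t) / t ≤ 2 * (n - t) / n := by
    rw [div_le_div_iff₀ ht0 hn]; nlinarith
  have e1 : stdPdf (z / p) = c * Real.exp (-a) := by
    simp only [stdPdf, c, a]
    congr 2
    rw [div_pow, hp2]; field_simp
  have e2 : stdPdf (z / q) = c * Real.exp (-b) := by
    simp only [stdPdf, c, b]
    congr 2
    rw [div_pow, hq2]; field_simp
  have hea : Real.exp (-a) ≤ 1 := Real.exp_le_one_iff.2 (by simp only [a, Left.neg_nonpos_iff]; positivity)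
  have heab : Real.exp (-a) ≤ Real.exp (-b) := Real.exp_le_exp.2 (by nlinarith)
  have h1 : Real.exp (-b) - Real.exp (-a) ≤ 2 * (n - t) / n := by
    have f1 : Real.exp (-a) = Real.exp (-b) * Real.exp (-(a - b)) := by
      rw [← Real.exp_add]; congr 1; ring
    have f2 := Real.add_one_le_exp (-(a - b))
    -- This removes z: the exponent changes by b(n - t)/t, and its unbounded factor b is absorbed by
    -- the exponential.
    have f3 : b * Real.exp (-b) ≤ 1 := by
      rw [Real.exp_neg, ← div_eq_mul_inv, div_le_one (Real.exp_pos _)]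
      linarith [Real.add_one_le_exp b]
    have f4 : Real.exp (-b) - Real.exp (-a) ≤ Real.exp (-b) * (a - b) := by
      rw [f1]; nlinarith [Real.exp_pos (-b)]
    calc _ ≤ Real.exp (-b) * (a - b) := f4
      _ = b * Real.exp (-b) * ((n - t) / t) := by rw [hab]; ring
      _ ≤ 1 * ((n - t) / t) := by gcongr
      _ ≤ _ := by linarith
  have h2 : 1 / p - 1 / q ≤ 2 * (n - t) / (n * q) := by
    have g1 : 1 / p - 1 / q ≤ (n - t) / t / q := by
      rw [div_sub_div _ _ hp.ne' hq.ne', div_div, div_le_div_iff₀ (by positivity) (by positivity),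
        ← hp2, ← hq2]
      have : p ^ 2 * q * (q - p) * p ≤ p ^ 2 * q * (q - p) * (q + p) := by
        have : 0 ≤ q - p := by linarith
        gcongr
        linarith
      nlinarith [mul_pos hp hq]
    calc _ ≤ (n - t) / t / q := g1
      _ ≤ 2 * (n - t) / n / q := by gcongr
      _ = _ := by rw [div_div]
  have h1p : 1 / q ≤ 1 / p := by gcongr
  rw [e1, e2]
  have key : 2 * (c * Real.exp (-a)) / p - 2 * (c * Real.exp (-b)) / q
      = 2 * c * (Real.exp (-a) * (1 / p - 1 / q) - (Real.exp (-b) - Real.exp (-a)) / q) := by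
    field_simp; ring
  rw [key, abs_mul, abs_of_nonneg (by positivity)]
  have hx : 0 ≤ Real.exp (-a) * (1 / p - 1 / q) := mul_nonneg (Real.exp_pos _).le (by linarith)
  have hx2 : Real.exp (-a) * (1 / p - 1 / q) ≤ 2 * (n - t) / (n * q) :=
    (mul_le_of_le_one_left (by linarith) hea).trans h2
  have hy : 0 ≤ (Real.exp (-b) - Real.exp (-a)) / q := div_nonneg (by linarith) hq.le
  have hy2 : (Real.exp (-b) - Real.exp (-a)) / q ≤ 2 * (n - t) / (n * q) := by
    rw [← div_div]; gcongr
  have e3 : 4 * (n - t) / (n * q) = 2 * (2 * (n - t) / (n * q)) := by ring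
  calc 2 * c * |Real.exp (-a) * (1 / p - 1 / q) - (Real.exp (-b) - Real.exp (-a)) / q|
      ≤ 1 * (4 * (n - t) / (n * q)) := by
        gcongr
        · linarith
        · rw [e3]; exact abs_le.2 ⟨by linarith, by linarith⟩
    _ = _ := one_mul _

end

/-! ### The asymptotics of the walk killed at the origin -/

section

variable (μ : Measure ℝ) [IsStdLaw μ]

/-- The mean over the survivors is the mean after a free step minus the part on the exits. The
former equals the old value up to a Lindeberg error; on the latter the function is its boundary
slope times w = -|w| up to w²/t, which produces the positive main term. -/
lemma killedHeat_step (z : ℝ) {n k : ℕ} (hk : k + 1 < n) :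
    |∫ w, killedHeat z (√((n : ℝ) - (k + 1 : ℕ))) w ∂alive μ (Measure.dirac 0) (k + 1)
      - ∫ w, killedHeat z (√((n : ℝ) - k)) w ∂alive μ (Measure.dirac 0) k
      - 2 * stdPdf (z / √((n : ℝ) - (k + 1 : ℕ))) / √((n : ℝ) - (k + 1 : ℕ))
        * ∫ w, |w| ∂exitLaw μ (Measure.dirac 0) k|
    ≤ 2 / √((n : ℝ) - (k + 1 : ℕ)) ^ 3 * (thirdMoment μ + thirdMoment (gaussianReal 0 1))
        * (alive μ (Measure.dirac 0) k).real Set.univ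
      + 2 / ((n : ℝ) - (k + 1 : ℕ)) * ∫ w, w ^ 2 ∂exitLaw μ (Measure.dirac 0) k := by
  have hkn : ((k + 1 : ℕ) : ℝ) < n := by exact_mod_cast hk
  set t : ℝ := (n : ℝ) - (k + 1 : ℕ)
  have ht : 0 < t := by simp only [t]; linarith
  have ht1 : (n : ℝ) - k = t + 1 := by simp only [t]; push_cast; ring
  set s := √t
  have hs : 0 < s := Real.sqrt_pos.2 ht
  have hs2 : s ^ 2 = t := Real.sq_sqrt ht.le
  set A := alive μ (Measure.dirac 0) k
  set E := exitLaw μ (Measure.dirac 0) k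
  set D := 2 * stdPdf (z / s) / s
  have h1 := integral_alive_succ_add_exitLaw μ (ν := Measure.dirac 0) (n := k)
    (integrable_killedHeat (s := s) z (alive μ (Measure.dirac 0) k ∗ μ))
  have h2 : |∫ w, ∫ x, killedHeat z s (w + x) ∂μ ∂A - ∫ w, killedHeat z (√(t + 1)) w ∂A|
      ≤ 2 / s ^ 3 * (thirdMoment μ + thirdMoment (gaussianReal 0 1)) * A.real Set.univ := by
    have hi : Integrable (fun w => ∫ x, killedHeat z s (w + x) ∂μ) A := by
      have := integrable_killedHeat (s := s) z (A ∗ μ)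
      rw [Measure.conv, integrable_map_measure (continuous_killedHeat z).aestronglyMeasurable
        (by fun_prop)] at this
      exact this.integral_prod_left
    rw [← integral_sub hi (integrable_killedHeat z A)]
    refine norm_integral_le_of_norm_le_const (G := ℝ) (μ := A) (.of_forall fun w => ?_)
    have := abs_integral_killedHeat_sub_le z μ hs w
    rwa [hs2] at this
  have h3 : |∫ w, killedHeat z s w ∂E + D * ∫ w, |w| ∂E| ≤ 2 / t * ∫ w, w ^ 2 ∂E := by
    have hid : Integrable (fun w : ℝ => w) E :=
      (integrable_abs_exitLaw μ (integrable_abs_dirac 0) k).mono' (by fun_prop)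
        (.of_forall fun _ => le_rfl)
    rw [integral_abs_exitLaw, mul_neg, ← sub_eq_add_neg, ← integral_const_mul,
      ← integral_sub (integrable_killedHeat z E) (hid.const_mul D), ← integral_const_mul]
    refine norm_integral_le_of_norm_le (G := ℝ) ((integrable_sq_exitLaw_dirac μ k).const_mul _)
      (.of_forall fun w => ?_)
    have := abs_killedHeat_sub_le z hs w
    rwa [hs2] at this
  rw [ht1]
  have h2 := abs_le.1 h2
  have h3 := abs_le.1 h3
  exact abs_le.2 ⟨by linarith, by linarith⟩

lemma two_mul_stdPdf_le (x : ℝ) : 2 * stdPdf x ≤ 1 := by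
  have h1 : stdPdf x ≤ 1 / 2 * 1 :=
    mul_le_mul inv_sqrt_two_pi_le
      (Real.exp_le_one_iff.2 (by have := sq_nonneg x; linarith)) (Real.exp_pos _).le (by norm_num)
  linarith

/-- The one-step identities telescope from the value 0 at the origin. Since 2m ≤ n, every remaining
time is comparable to n, and the three errors are governed by Σ P(τ > k), the overshoot weighted by
k + 1, and the second moment of the overshoot. Each carries a factor κ. -/
lemma abs_integral_killedHeat_alive_sub_le (z : ℝ) {n m : ℕ} (hm : 1 ≤ m) (hmn : 2 * m ≤ n) :
    |∫ w, killedHeat z (√((n : ℝ) - m)) w ∂alive μ (Measure.dirac 0) m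
      - 2 * stdPdf (z / √n) / √n * meanOvershoot μ (Measure.dirac 0) m|
    ≤ (130 * beConst * (198 + 6 * thirdMoment (gaussianReal 0 1)) + 80) * thirdMoment μ ^ 3
        * exitMean μ / n := by
  set K := beConst
  have hK : 1 ≤ K := one_le_beConst
  set L := thirdMoment μ
  have hL : 1 ≤ L := IsStdLaw.one_le_thirdMoment μ
  set G := thirdMoment (gaussianReal 0 1)
  have hG : 1 ≤ G := IsStdLaw.one_le_thirdMoment _
  set κ := exitMean μ
  have hκ : 0 < κ := exitMean_pos μ
  have hn0 : (0 : ℝ) < n := by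
    have : 0 < n := by omega
    exact_mod_cast this
  set q := √(n : ℝ)
  have hq : 0 < q := by positivity
  have hq2 : q ^ 2 = n := Real.sq_sqrt hn0.le
  set p : ℕ → ℝ := fun k => (alive μ (Measure.dirac 0) k).real Set.univ
  have hp0 : ∀ k, 0 ≤ p k := fun k => measureReal_nonneg
  set e : ℕ → ℝ := fun k => ∫ w, |w| ∂exitLaw μ (Measure.dirac 0) k
  have he0 : ∀ k, 0 ≤ e k := fun k => integral_nonneg fun _ => abs_nonneg _
  set r : ℕ → ℝ := fun k => ∫ w, w ^ 2 ∂exitLaw μ (Measure.dirac 0) k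
  have hr0 : ∀ k, 0 ≤ r k := fun k => integral_nonneg fun _ => sq_nonneg _
  set H : ℕ → ℝ := fun k => ∫ w, killedHeat z (√((n : ℝ) - k)) w ∂alive μ (Measure.dirac 0) k
  have hH0 : H 0 = 0 := by
    simp only [H, alive_zero]
    rw [integral_dirac, killedHeat_zero]
  set D := 2 * stdPdf (z / q) / q
  have hterm : ∀ k ∈ Finset.range m, |H (k + 1) - H k - D * e k|
      ≤ 6 * (L + G) / (n * q) * p k + 4 / (n * q) * ((k + 1) * e k) + 4 / n * r k := by
    intro k hk
    rw [Finset.mem_range] at hk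
    have h1 := killedHeat_step μ z (n := n) (k := k) (by omega)
    have ht : (n : ℝ) / 2 ≤ (n : ℝ) - (k + 1 : ℕ) := by
      have : 2 * (k + 1) ≤ n := by omega
      have : (2 * (k + 1 : ℕ) : ℝ) ≤ n := by exact_mod_cast this
      linarith
    have h2 := abs_stdPdf_div_sub_le z hn0 ht (by linarith [(k + 1).cast_nonneg (α := ℝ)])
    rw [sub_sub_cancel] at h2
    set t : ℝ := (n : ℝ) - (k + 1 : ℕ)
    have ht0 : 0 < t := by linarith
    have h3 : q * 0.7 ≤ √t := by
      apply Real.le_sqrt_of_sq_le; nlinarith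
    have h4 : 2 / √t ^ 3 ≤ 6 / (n * q) := by
      have h5 : (q * 0.7) ^ 3 ≤ √t ^ 3 := by gcongr
      rw [div_le_div_iff₀ (by positivity) (by positivity), ← hq2]
      have : 0 < q ^ 3 := by positivity
      nlinarith
    have h5 : 2 / t ≤ 4 / n := by
      rw [div_le_div_iff₀ ht0 hn0]; linarith
    have h6 : 2 / √t ^ 3 * (L + G) * p k ≤ 6 * (L + G) / (n * q) * p k := by
      calc _ ≤ 6 / (n * q) * (L + G) * p k := by gcongr
        _ = _ := by ring
    have h7 : 2 / t * r k ≤ 4 / n * r k := by gcongr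
    have h8 : |(2 * stdPdf (z / √t) / √t - D) * e k| ≤ 4 / (n * q) * ((k + 1) * e k) := by
      rw [abs_mul, abs_of_nonneg (he0 k)]
      calc _ ≤ 4 * ((k + 1 : ℕ) : ℝ) / (n * q) * e k := by gcongr
        _ = _ := by push_cast; ring
    have h1 := abs_le.1 h1
    have h8 := abs_le.1 h8
    simp only [H]
    simp only [p, e, r] at h6 h7 h8 ⊢
    exact abs_le.2 ⟨by linarith, by linarith⟩
  have hsum : H m - D * meanOvershoot μ (Measure.dirac 0) m
      = ∑ k ∈ Finset.range m, (H (k + 1) - H k - D * e k) := by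
    rw [Finset.sum_sub_distrib, Finset.sum_range_sub, hH0, sub_zero, ← Finset.mul_sum]
    rfl
  change |H m - D * meanOvershoot μ (Measure.dirac 0) m| ≤ _
  rw [hsum]
  refine (Finset.abs_sum_le_sum_abs _ _).trans ((Finset.sum_le_sum hterm).trans ?_)
  rw [Finset.sum_add_distrib, Finset.sum_add_distrib, ← Finset.mul_sum, ← Finset.mul_sum,
    ← Finset.mul_sum]
  have s1 := sum_survival_le μ m
  have s2 := sum_succ_mul_integral_abs_exitLaw_le μ m
  have s3 := sum_integral_sq_exitLaw_dirac_le μ m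
  have hmq : √(m : ℝ) ≤ q := Real.sqrt_le_sqrt (by
    have : m ≤ n := by omega
    exact_mod_cast this)
  have s1' : ∑ k ∈ Finset.range m, p k ≤ 128 * K * L ^ 2 * κ * q :=
    s1.trans (by gcongr)
  have s0 : 0 ≤ ∑ k ∈ Finset.range m, p k := Finset.sum_nonneg fun k _ => hp0 k
  calc _ ≤ 6 * (L + G) / (n * q) * ∑ k ∈ Finset.range m, p k
        + 4 / (n * q) * (48 * L * ∑ k ∈ Finset.range m, p k) + 4 / n * (20 * L * κ) := by
        gcongr
    _ = (6 * (L + G) + 192 * L) / (n * q) * ∑ k ∈ Finset.range m, p k + 80 * L * κ / n := by ring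
    _ ≤ (6 * (L + G) + 192 * L) / (n * q) * (128 * K * L ^ 2 * κ * q) + 80 * L * κ / n := by
        gcongr
    _ = (128 * K * L ^ 2 * (198 * L + 6 * G) + 80 * L) * κ / n := by field_simp; ring
    _ ≤ _ := by
        gcongr
        have b1 : G ≤ G * L := le_mul_of_one_le_right (by linarith) hL
        have b2 : L ≤ L ^ 3 := le_self_pow₀ hL (by norm_num)
        calc 128 * K * L ^ 2 * (198 * L + 6 * G) + 80 * L
            ≤ 130 * K * L ^ 2 * (198 * L + 6 * (G * L)) + 80 * L ^ 3 := by gcongr; norm_num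
          _ = _ := by ring

/-- A constant for the error in the asymptotics of the killed walk. -/
noncomputable def killedConst : ℝ :=
  400000000 * beConst ^ 3 + (130 * beConst * (198 + 6 * thirdMoment (gaussianReal 0 1)) + 80)
    + 5000

/-- At m = n/2 the reflection estimate is applied to the law of the survivors, of mass O(κ/√n), and
the telescoped estimate evaluates the resulting integral. The overshoot still missing after time m
is O(L) times that same mass. -/
lemma abs_alive_dirac_real_Ici_sub_le {n : ℕ}
    (hn : 8 * beConst * thirdMoment μ ≤ √((n / 2 : ℕ) : ℝ)) {z : ℝ} (hz : 0 ≤ z) :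
    |(alive μ (Measure.dirac 0) n).real (Set.Ici z) - 2 * stdPdf (z / √n) / √n * exitMean μ|
      ≤ killedConst * thirdMoment μ ^ 3 * exitMean μ / n := by
  set K := beConst
  have hK : 1 ≤ K := one_le_beConst
  set L := thirdMoment μ
  have hL : 1 ≤ L := IsStdLaw.one_le_thirdMoment μ
  set G := thirdMoment (gaussianReal 0 1)
  have hG : 1 ≤ G := IsStdLaw.one_le_thirdMoment _
  set κ := exitMean μ
  have hκ : 0 < κ := exitMean_pos μ
  set m := n / 2
  have hsm : 0 < √(m : ℝ) := lt_of_lt_of_le (by positivity) hn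
  have hm0 : (0 : ℝ) < m := Real.sqrt_pos.1 hsm
  have hm : 1 ≤ m := by exact_mod_cast hm0
  have hmn : 2 * m ≤ n := by omega
  have hnm : n ≤ 3 * m := by omega
  have hnm' : (n : ℝ) ≤ 3 * m := by exact_mod_cast hnm
  have hmn' : (2 * m : ℝ) ≤ n := by exact_mod_cast hmn
  have hn0 : (0 : ℝ) < n := by linarith
  set m' := n - m
  have hm' : 1 ≤ m' := by omega
  have hcast : (m' : ℝ) = (n : ℝ) - m := by simp only [m']; rw [Nat.cast_sub (by omega)]
  have hadd : m + m' = n := by omega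
  set q := √(n : ℝ)
  have hq : 0 < q := by positivity
  have hq2 : q ^ 2 = n := Real.sq_sqrt hn0.le
  set p := (alive μ (Measure.dirac 0) m).real Set.univ
  have hp0 : 0 ≤ p := measureReal_nonneg
  have hp : p ≤ 32 * κ / √m := survival_le_exitMean μ hn
  have h1 := abs_alive_real_Ici_sub_le μ
    (integrable_abs_alive μ (integrable_abs_dirac 0) m)
    (alive_Iio μ (dirac_Iio_zero le_rfl) m) hm' hz
  rw [← alive_add, hadd, hcast] at h1
  have h2 := abs_integral_killedHeat_alive_sub_le μ z hm hmn
  have h3 := exitMean_sub_le μ m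
  have h3' := meanOvershoot_le_exitMean μ m
  -- the three errors
  have hms : (n : ℝ) / 3 ≤ √((n : ℝ) - m) * √m := by
    rw [← Real.sqrt_mul (by linarith)]
    apply Real.le_sqrt_of_sq_le
    nlinarith
  have hms2 : (n : ℝ) / 3 ≤ q * √m := hms.trans (by
    gcongr
    exact Real.sqrt_le_sqrt (by linarith))
  have hs : 0 < √((n : ℝ) - m) := Real.sqrt_pos.2 (by linarith)
  have e1 : 4000000 * K ^ 3 * L ^ 3 / √((n : ℝ) - m) * p
      ≤ 400000000 * K ^ 3 * L ^ 3 * κ / n := by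
    calc _ ≤ 4000000 * K ^ 3 * L ^ 3 / √((n : ℝ) - m) * (32 * κ / √m) := by gcongr
      _ = 128000000 * K ^ 3 * L ^ 3 * κ / (√((n : ℝ) - m) * √m) := by ring
      _ ≤ 128000000 * K ^ 3 * L ^ 3 * κ / (n / 3) := by gcongr
      _ = 384000000 * K ^ 3 * L ^ 3 * κ / n := by field_simp; ring
      _ ≤ _ := by gcongr; norm_num
  have hD0 : 0 ≤ 2 * stdPdf (z / q) / q := by have := stdPdf_nonneg (z / q); positivity
  have hD1 : 2 * stdPdf (z / q) / q ≤ 1 / q := by gcongr; exact two_mul_stdPdf_le _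
  have e3 : 2 * stdPdf (z / q) / q * (κ - meanOvershoot μ (Measure.dirac 0) m)
      ≤ 5000 * L ^ 3 * κ / n := by
    have b2 : L ≤ L ^ 3 := le_self_pow₀ hL (by norm_num)
    calc _ ≤ 1 / q * (48 * L * p) := by
          gcongr
      _ ≤ 1 / q * (48 * L * (32 * κ / √m)) := by gcongr
      _ = 1536 * L * κ / (q * √m) := by field_simp; ring
      _ ≤ 1536 * L * κ / (n / 3) := by gcongr
      _ = 4608 * L * κ / n := by field_simp; ring
      _ ≤ 5000 * L ^ 3 * κ / n := by gcongr; norm_num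
  have e3' : 0 ≤ 2 * stdPdf (z / q) / q * (κ - meanOvershoot μ (Measure.dirac 0) m) :=
    mul_nonneg hD0 (by linarith)
  have htot : killedConst * L ^ 3 * κ / n = 400000000 * K ^ 3 * L ^ 3 * κ / n
      + (130 * K * (198 + 6 * G) + 80) * L ^ 3 * κ / n + 5000 * L ^ 3 * κ / n := by
    simp only [killedConst]; ring
  rw [htot]
  have h1 := abs_le.1 (h1.trans e1)
  have h2 := abs_le.1 h2
  exact abs_le.2 ⟨by linarith, by linarith⟩

end

/-! ### Conditional limit theorem and survival probability in terms of the killed walk -/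

lemma alive_real_Ici_zero (μ : Measure ℝ) {ν : Measure ℝ} (hν : ν (Set.Iio 0) = 0) (n : ℕ) :
    (alive μ ν n).real (Set.Ici 0) = (alive μ ν n).real Set.univ :=
  measureReal_congr ((ae_alive_nonneg μ hν n).mono fun w hw => eq_true (p := w ∈ Set.Ici 0) hw)

section

variable (μ : Measure ℝ) [IsStdLaw μ]

lemma two_mul_stdPdf_eq (x : ℝ) : 2 * stdPdf x = √(2 / Real.pi) * Real.exp (-x ^ 2 / 2) := by
  have h : 2 * (√(2 * Real.pi))⁻¹ = √(2 / Real.pi) := by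
    rw [Real.sqrt_mul two_pos.le, Real.sqrt_div two_pos.le]
    have h2 : √2 * √2 = 2 := Real.mul_self_sqrt two_pos.le
    have : 0 < √Real.pi := Real.sqrt_pos.2 Real.pi_pos
    field_simp
    linarith
  rw [stdPdf, ← mul_assoc, h]

lemma half_le_sqrt_two_div_pi : 1 / 2 ≤ √(2 / Real.pi) := by
  refine Real.le_sqrt_of_sq_le ?_
  rw [div_pow, one_pow, div_le_div_iff₀ (by norm_num) Real.pi_pos]
  linarith [Real.pi_le_four]

lemma killedConst_ge : 400000000 * beConst ^ 3 ≤ killedConst := by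
  have hK := one_le_beConst
  have hG := IsStdLaw.one_le_thirdMoment (gaussianReal 0 1)
  have : 0 ≤ 130 * beConst * (198 + 6 * thirdMoment (gaussianReal 0 1)) + 80 := by positivity
  unfold killedConst; linarith

/-- The killed walk, normalised by its asymptotic total mass. -/
lemma abs_alive_dirac_real_Ici_div_sub_le {n : ℕ}
    (hn : 8 * beConst * thirdMoment μ ≤ √((n / 2 : ℕ) : ℝ)) {x : ℝ} (hx : 0 ≤ x) :
    |(alive μ (Measure.dirac 0) n).real (Set.Ici (x * √n))
        / (√(2 / Real.pi) * exitMean μ / √n) - Real.exp (-x ^ 2 / 2)|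
      ≤ 2 * killedConst * thirdMoment μ ^ 3 / √n := by
  have hK := one_le_beConst
  have hL : 1 ≤ thirdMoment μ := IsStdLaw.one_le_thirdMoment μ
  have hκ := exitMean_pos μ
  have hC : 0 < killedConst := lt_of_lt_of_le (by positivity) killedConst_ge
  have hn1 : (0 : ℝ) < n := by
    have h : 0 < √((n / 2 : ℕ) : ℝ) := lt_of_lt_of_le (by positivity) hn
    have h1 : 0 < n / 2 := by exact_mod_cast Real.sqrt_pos.1 h
    exact_mod_cast (by omega : 0 < n)
  have hq : 0 < √(n : ℝ) := Real.sqrt_pos.2 hn1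
  have hq2 : √(n : ℝ) * √n = n := Real.mul_self_sqrt hn1.le
  have h := abs_alive_dirac_real_Ici_sub_le μ hn (z := x * √n) (by positivity)
  rw [mul_div_cancel_right₀ _ hq.ne', two_mul_stdPdf_eq] at h
  have hc := half_le_sqrt_two_div_pi
  set c := √(2 / Real.pi)
  set κ := exitMean μ
  set e := Real.exp (-x ^ 2 / 2)
  set a := (alive μ (Measure.dirac 0) n).real (Set.Ici (x * √n))
  have hc0 : 0 < c := by linarith
  have hB : 0 < c * κ / √n := by positivity
  have e1 : a / (c * κ / √n) - e = (a - c * e / √n * κ) / (c * κ / √n) := by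
    field_simp
  rw [e1, abs_div, abs_of_pos hB, div_le_iff₀ hB]
  refine h.trans ?_
  have e2 : 2 * killedConst * thirdMoment μ ^ 3 / √n * (c * κ / √n)
      = (2 * c) * (killedConst * thirdMoment μ ^ 3 * κ / n) := by
    have : (n : ℝ)⁻¹ = (√(n : ℝ))⁻¹ * (√(n : ℝ))⁻¹ := by rw [← mul_inv, hq2]
    simp only [div_eq_mul_inv, this]
    ring
  rw [e2]
  exact le_mul_of_one_le_left (by positivity) (by linarith)

/-- The survival probability decreases in n, and the asymptotics exclude the value zero at a
sufficiently large time. -/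
lemma alive_dirac_real_univ_pos (n : ℕ) : 0 < (alive μ (Measure.dirac 0) n).real Set.univ := by
  have hK := one_le_beConst
  have hL : 1 ≤ thirdMoment μ := IsStdLaw.one_le_thirdMoment μ
  have hκ := exitMean_pos μ
  have hC : 0 < killedConst := lt_of_lt_of_le (by positivity) killedConst_ge
  obtain ⟨M, hM⟩ := exists_nat_gt ((8 * beConst * thirdMoment μ) ^ 2
    + (2 * killedConst * thirdMoment μ ^ 3) ^ 2)
  have hM1 : 8 * beConst * thirdMoment μ ≤ √(M : ℝ) := by
    refine Real.le_sqrt_of_sq_le ?_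
    have := sq_nonneg (2 * killedConst * thirdMoment μ ^ 3)
    linarith
  have hM2 : 2 * killedConst * thirdMoment μ ^ 3 < √(M : ℝ) := by
    refine Real.lt_sqrt_of_sq_lt ?_
    have := sq_nonneg (8 * beConst * thirdMoment μ)
    linarith
  have hsM : 0 < √(M : ℝ) := lt_of_lt_of_le (by positivity) hM1
  set N := max n (2 * M)
  refine lt_of_lt_of_le ?_ (alive_real_univ_antitone μ (Measure.dirac 0) (le_max_left n (2 * M)))
  have hMN : M ≤ N / 2 := by omega
  have h := abs_alive_dirac_real_Ici_div_sub_le μ (n := N)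
    (hM1.trans (Real.sqrt_le_sqrt (by exact_mod_cast hMN))) le_rfl
  have hMN' : √(M : ℝ) ≤ √(N : ℝ) := Real.sqrt_le_sqrt (by exact_mod_cast (by omega : M ≤ N))
  have hlt : 2 * killedConst * thirdMoment μ ^ 3 / √(N : ℝ) < 1 := by
    rw [div_lt_one (by linarith)]; linarith
  rw [zero_mul, alive_real_Ici_zero μ (dirac_Iio_zero le_rfl)] at h
  by_contra! h0
  have h0' : (alive μ (Measure.dirac 0) N).real Set.univ = 0 := le_antisymm h0 measureReal_nonneg
  rw [h0'] at h
  norm_num at h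
  linarith

lemma sqrt_le_of_sqrt_half_lt {n : ℕ} {a : ℝ} (ha : 1 ≤ a) (hn : √((n / 2 : ℕ) : ℝ) < a) :
    √(n : ℝ) ≤ 2 * a := by
  have h : ((n / 2 : ℕ) : ℝ) < a ^ 2 := (Real.sqrt_lt' (by linarith)).1 hn
  have h1 : (n : ℝ) ≤ 2 * ((n / 2 : ℕ) : ℝ) + 1 := by exact_mod_cast (by omega)
  refine Real.sqrt_le_iff.2 ⟨by linarith, ?_⟩
  nlinarith

/-- Outside the range of the asymptotics √n ≤ 16KL. There the ratio is at most 128KL², which the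
claimed bound exceeds; the factor κ in the survival bound has cancelled. -/
lemma abs_survival_div_sub_one_le {n : ℕ} (hn : 1 ≤ n) :
    |(alive μ (Measure.dirac 0) n).real Set.univ / (√(2 / Real.pi) * exitMean μ / √n) - 1|
      ≤ 8 * killedConst * thirdMoment μ ^ 3 / √n := by
  have hK := one_le_beConst
  have hL : 1 ≤ thirdMoment μ := IsStdLaw.one_le_thirdMoment μ
  have hκ := exitMean_pos μ
  have hC := killedConst_ge
  have hC0 : 0 < killedConst := lt_of_lt_of_le (by positivity) hC
  have hn0 : (0 : ℝ) < n := by exact_mod_cast hn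
  have hq : 0 < √(n : ℝ) := Real.sqrt_pos.2 hn0
  by_cases h : 8 * beConst * thirdMoment μ ≤ √((n / 2 : ℕ) : ℝ)
  · have h1 := abs_alive_dirac_real_Ici_div_sub_le μ h le_rfl
    rw [zero_mul, alive_real_Ici_zero μ (dirac_Iio_zero le_rfl)] at h1
    norm_num at h1 ⊢
    refine h1.trans ?_
    gcongr
    norm_num
  · have hs := survival_le_sq_mul_exitMean μ n
    have hp := alive_dirac_real_univ_pos μ n
    have hc := half_le_sqrt_two_div_pi
    set c := √(2 / Real.pi)
    set κ := exitMean μ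
    set K := beConst
    set L := thirdMoment μ
    have hKL : 1 ≤ K * L := one_le_mul_of_one_le_of_one_le hK hL
    have hn2 := sqrt_le_of_sqrt_half_lt (by linarith) (not_le.1 h)
    have hc0 : 0 < c := by linarith
    have hB : 0 < c * κ / √n := by positivity
    have hr : (alive μ (Measure.dirac 0) n).real Set.univ / (c * κ / √n) ≤ 128 * K * L ^ 2 := by
      rw [div_le_iff₀ hB]
      calc _ ≤ _ := hs
        _ ≤ 64 * K * L ^ 2 * κ / √n := by gcongr; linarith
        _ = 128 * K * L ^ 2 * (1 / 2 * κ / √n) := by ring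
        _ ≤ _ := by gcongr
    have hr0 : 0 < (alive μ (Measure.dirac 0) n).real Set.univ / (c * κ / √n) := by positivity
    have hb : 128 * K * L ^ 2 ≤ 8 * killedConst * L ^ 3 / √n := by
      rw [le_div_iff₀ hq]
      have hK3 : K ^ 2 ≤ K ^ 3 := pow_le_pow_right₀ hK (by norm_num)
      calc _ ≤ 128 * K * L ^ 2 * (2 * (8 * K * L)) := by gcongr
        _ = 2048 * K ^ 2 * L ^ 3 := by ring
        _ ≤ 8 * killedConst * L ^ 3 := by
          have : 0 ≤ K ^ 3 := by positivity
          gcongr ?_ * L ^ 3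
          linarith
    have hb1 : 1 ≤ 128 * K * L ^ 2 := by
      have : 1 ≤ L ^ 2 := one_le_pow₀ hL
      nlinarith
    rw [abs_le]
    constructor <;> linarith

lemma abs_alive_dirac_real_Ici_div_survival_sub_le {n : ℕ} (hn : 1 ≤ n) {x : ℝ} (hx : 0 ≤ x) :
    |(alive μ (Measure.dirac 0) n).real (Set.Ici (x * √n))
        / (alive μ (Measure.dirac 0) n).real Set.univ - Real.exp (-x ^ 2 / 2)|
      ≤ 8 * killedConst * thirdMoment μ ^ 3 / √n := by
  have hK := one_le_beConst
  have hL : 1 ≤ thirdMoment μ := IsStdLaw.one_le_thirdMoment μ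
  have hκ := exitMean_pos μ
  have hC := killedConst_ge
  have hC0 : 0 < killedConst := lt_of_lt_of_le (by positivity) hC
  have hn0 : (0 : ℝ) < n := by exact_mod_cast hn
  have hq : 0 < √(n : ℝ) := Real.sqrt_pos.2 hn0
  have hp := alive_dirac_real_univ_pos μ n
  set p := (alive μ (Measure.dirac 0) n).real Set.univ
  set a := (alive μ (Measure.dirac 0) n).real (Set.Ici (x * √n))
  have ha0 : 0 ≤ a := measureReal_nonneg
  have hap : a ≤ p := measureReal_mono (Set.subset_univ _)
  set e := Real.exp (-x ^ 2 / 2)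
  have he0 : 0 < e := Real.exp_pos _
  have he1 : e ≤ 1 := Real.exp_le_one_iff.2 (by have := sq_nonneg x; linarith)
  have htriv : |a / p - e| ≤ 1 := by
    have h1 : 0 ≤ a / p := by positivity
    have h2 : a / p ≤ 1 := (div_le_one hp).2 hap
    rw [abs_le]; constructor <;> linarith
  by_cases h : 8 * beConst * thirdMoment μ ≤ √((n / 2 : ℕ) : ℝ)
  · have h0 := abs_alive_dirac_real_Ici_div_sub_le μ h le_rfl
    have h1 := abs_alive_dirac_real_Ici_div_sub_le μ h hx
    rw [zero_mul, alive_real_Ici_zero μ (dirac_Iio_zero le_rfl)] at h0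
    norm_num at h0
    have hc := half_le_sqrt_two_div_pi
    have hB : 0 < √(2 / Real.pi) * exitMean μ / √n := by
      have : 0 < √(2 / Real.pi) := by linarith
      positivity
    have h0 : |p / (√(2 / Real.pi) * exitMean μ / √n) - 1|
        ≤ 2 * killedConst * thirdMoment μ ^ 3 / √n := by simpa using h0
    set B := √(2 / Real.pi) * exitMean μ / √n
    set η := 2 * killedConst * thirdMoment μ ^ 3 / √n with hη
    have e8 : 8 * killedConst * thirdMoment μ ^ 3 / √n = 4 * η := by rw [hη]; ring
    rw [e8]
    -- A quotient of two approximations: if η ≤ 1/2 the denominator is at least 1/2 and the error at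
    -- most 2η/(1/2) = 4η; otherwise 4η exceeds the trivial bound 1.
    by_cases hη2 : η ≤ 1 / 2
    · have hr : 1 / 2 ≤ p / B := by have := (abs_le.1 h0).1; linarith
      have hr0 : 0 < p / B := by linarith
      have e3 : a / p - e = ((a / B - e) - e * (p / B - 1)) / (p / B) := by
        field_simp
        ring
      rw [e3, abs_div, abs_of_pos hr0, div_le_iff₀ hr0]
      have hη0 : 0 ≤ η := by positivity
      calc _ ≤ |a / B - e| + |e * (p / B - 1)| := abs_sub _ _
        _ ≤ η + 1 * η := by
          rw [abs_mul, abs_of_pos he0]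
          gcongr
        _ = 4 * η * (1 / 2) := by ring
        _ ≤ _ := by gcongr
    · linarith
  · refine htriv.trans ?_
    set K := beConst
    set L := thirdMoment μ
    have hKL : 1 ≤ K * L := one_le_mul_of_one_le_of_one_le hK hL
    have hn2 := sqrt_le_of_sqrt_half_lt (by linarith) (not_le.1 h)
    rw [le_div_iff₀ hq, one_mul]
    have hK3 : K ≤ K ^ 3 := le_self_pow₀ hK (by norm_num)
    have hL3 : L ≤ L ^ 3 := le_self_pow₀ hL (by norm_num)
    calc _ ≤ _ := hn2
      _ = 16 * K * L := by ring
      _ ≤ 8 * killedConst * L ^ 3 := by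
        gcongr ?_ * ?_
        linarith

lemma tendsto_survival :
    Filter.Tendsto (fun n => (alive μ (Measure.dirac 0) n).real Set.univ) Filter.atTop (nhds 0) := by
  refine squeeze_zero (fun n => measureReal_nonneg) (alive_dirac_real_univ_le μ le_rfl) ?_
  refine Filter.Tendsto.const_div_atTop ?_ _
  exact Real.tendsto_sqrt_atTop.comp
    (Filter.tendsto_atTop_add_const_right _ _ tendsto_natCast_atTop_atTop)

end

/-! ### The random walk and its killed laws -/

section

variable {Ω : Type*} {X : ℕ → Ω → ℝ}

lemma lt_exitTime_iff (n : ℕ) (ω : Ω) :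
    (n : WithTop ℕ) < exitTime X ω ↔ ∀ i, 1 ≤ i → i ≤ n → 0 < walk X i ω := by
  have h := hittingAfter_le_iff (u := walk X) (s := Set.Iic 0) (n := 1) (i := n) (ω := ω)
  rw [← not_le]
  refine (not_congr h).trans ?_
  simp only [Set.mem_Icc, Set.mem_Iic, not_exists, not_and, not_le, and_imp]

lemma setOf_lt_exitTime_succ (n : ℕ) :
    {ω | ((n + 1 : ℕ) : WithTop ℕ) < exitTime X ω}
      = {ω | (n : WithTop ℕ) < exitTime X ω} ∩ walk X (n + 1) ⁻¹' Set.Ioi 0 := by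
  ext ω
  simp only [Set.mem_ofPred_eq, lt_exitTime_iff, Set.mem_inter_iff, Set.mem_preimage, Set.mem_Ioi]
  refine ⟨fun h => ⟨fun i h1 h2 => h i h1 (by omega), h _ (by omega) le_rfl⟩, fun h i h1 h2 => ?_⟩
  rcases Nat.lt_or_eq_of_le h2 with h3 | rfl
  · exact h.1 i h1 (by omega)
  · exact h.2

lemma exitTime_eq_succ_iff (k : ℕ) (ω : Ω) :
    exitTime X ω = ((k + 1 : ℕ) : WithTop ℕ)
      ↔ (k : WithTop ℕ) < exitTime X ω ∧ walk X (k + 1) ω ≤ 0 := by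
  have h : exitTime X ω = ((k + 1 : ℕ) : WithTop ℕ)
      ↔ (k : WithTop ℕ) < exitTime X ω ∧ ¬((k + 1 : ℕ) : WithTop ℕ) < exitTime X ω := by
    rw [not_lt]
    constructor
    · intro h
      rw [h]
      exact ⟨by exact_mod_cast k.lt_succ_self, le_rfl⟩
    · rintro ⟨h1, h2⟩
      refine le_antisymm h2 ?_
      cases h3 : exitTime X ω with
      | top => exact le_top
      | coe m =>
        rw [h3] at h1
        exact WithTop.coe_le_coe.2 (Nat.succ_le_of_lt (WithTop.coe_lt_coe.1 h1))
  rw [h]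
  have := Set.ext_iff.1 (setOf_lt_exitTime_succ (X := X) k) ω
  simp only [Set.mem_ofPred_eq, Set.mem_inter_iff, Set.mem_preimage, Set.mem_Ioi] at this
  rw [this]
  constructor
  · rintro ⟨h1, h2⟩
    exact ⟨h1, not_lt.1 fun h3 => h2 ⟨h1, h3⟩⟩
  · rintro ⟨h1, h2⟩
    exact ⟨h1, fun h3 => absurd h3.2 (not_lt.2 h2)⟩

lemma exitValue_of_exitTime_eq {n : ℕ} {ω : Ω} (h : exitTime X ω = (n : WithTop ℕ)) :
    exitValue X ω = walk X n ω := by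
  rw [exitValue, stoppedValue, h]
  rfl

lemma measurable_walk_of_le {m : MeasurableSpace Ω} {n : ℕ} (h : ∀ i < n, Measurable (X i)) {i : ℕ}
    (hi : i ≤ n) : Measurable (walk X i) :=
  Finset.measurable_fun_sum _ fun j hj => h j (lt_of_lt_of_le (Finset.mem_range.1 hj) hi)

lemma measurableSet_lt_exitTime {m : MeasurableSpace Ω} {n : ℕ} (h : ∀ i < n, Measurable (X i)) :
    MeasurableSet {ω | (n : WithTop ℕ) < exitTime X ω} := by
  have : {ω | (n : WithTop ℕ) < exitTime X ω}
      = ⋂ i ∈ Set.Icc 1 n, walk X i ⁻¹' Set.Ioi 0 := by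
    ext ω
    simp [lt_exitTime_iff]
  rw [this]
  exact MeasurableSet.biInter (Set.to_countable _) fun i hi =>
    measurable_walk_of_le h hi.2 measurableSet_Ioi

lemma walk_div (σ : ℝ) (n : ℕ) (ω : Ω) : walk (fun i ω => X i ω / σ) n ω = walk X n ω / σ := by
  simp only [walk, Finset.sum_div]

lemma exitTime_div {σ : ℝ} (hσ : 0 < σ) : exitTime (fun i ω => X i ω / σ) = exitTime X := by
  have h : ∀ i ω, walk (fun i ω => X i ω / σ) i ω ∈ Set.Iic (0 : ℝ) ↔ walk X i ω ∈ Set.Iic 0 := by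
    intro i ω
    rw [walk_div, Set.mem_Iic, Set.mem_Iic, div_le_iff₀ hσ, zero_mul]
  funext ω
  simp only [exitTime, hittingAfter]
  by_cases hex : ∃ j, 1 ≤ j ∧ walk X j ω ∈ Set.Iic 0
  · rw [if_pos hex, if_pos (by simpa only [h] using hex)]
    simp only [h]
  · rw [if_neg hex, if_neg (by simpa only [h] using hex)]

lemma exitValue_div {σ : ℝ} (hσ : 0 < σ) (ω : Ω) :
    exitValue (fun i ω => X i ω / σ) ω = exitValue X ω / σ := by
  simp only [exitValue, stoppedValue, exitTime_div hσ, walk_div]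

lemma measurable_iSup_comap_lt (n : ℕ) : ∀ i < n,
    Measurable[⨆ j ∈ Set.Iio n, MeasurableSpace.comap (X j) inferInstance] (X i) :=
  fun i hi => Measurable.of_comap_le (le_iSup₂_of_le (f := fun i (_ : i ∈ Set.Iio n) =>
    MeasurableSpace.comap (X i) inferInstance) i hi le_rfl)

lemma indep_comap_lt [MeasurableSpace Ω] {P : Measure Ω}
    (hX : ∀ i, Measurable (X i))
    (hind : iIndepFun X P) (n : ℕ) :
    Indep (⨆ j ∈ Set.Iio n, MeasurableSpace.comap (X j) inferInstance)
      (MeasurableSpace.comap (X n) inferInstance) P := by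
  have h := indep_iSup_of_disjoint (S := Set.Iio n) (T := {n}) (fun i => (hX i).comap_le) hind
    (by simp)
  rwa [iSup_singleton] at h

variable [MeasurableSpace Ω] {P : Measure Ω} [IsProbabilityMeasure P]

/-- The future increment is independent of the walk on the event that it is alive. -/
lemma map_walk_succ_restrict (hX : ∀ i, Measurable (X i)) (hind : iIndepFun X P)
    (hid : ∀ i, IdentDistrib (X i) (X 0) P P) (n : ℕ) :
    (P.restrict {ω | (n : WithTop ℕ) < exitTime X ω}).map (walk X (n + 1))
      = (P.restrict {ω | (n : WithTop ℕ) < exitTime X ω}).map (walk X n) ∗ P.map (X 0) := by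
  set E := {ω | (n : WithTop ℕ) < exitTime X ω}
  have hw : ∀ i, Measurable (walk X i) := fun i => measurable_walk_of_le (fun j _ => hX j) le_rfl
  have : IsProbabilityMeasure (P.map (X 0)) := Measure.isProbabilityMeasure_map (hX 0).aemeasurable
  have hprod : (P.restrict E).map (fun ω => (walk X n ω, X n ω))
      = ((P.restrict E).map (walk X n)).prod (P.map (X 0)) := by
    refine (Measure.prod_eq fun s t hs ht => ?_).symm
    rw [Measure.map_apply ((hw n).prodMk (hX n)) (hs.prod ht), Measure.map_apply (hw n) hs,
      ← (hid n).map_eq, Measure.map_apply (hX n) ht, Set.mk_preimage_prod,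
      Measure.restrict_apply ((hw n hs).inter (hX n ht)), Measure.restrict_apply (hw n hs),
      Set.inter_right_comm]
    refine (Indep_iff _ _ _).1 (indep_comap_lt hX hind n) _ _ ?_ ⟨t, ht, rfl⟩
    exact (measurable_walk_of_le (measurable_iSup_comap_lt n) le_rfl hs).inter
      (measurableSet_lt_exitTime (measurable_iSup_comap_lt n))
  have hadd : walk X (n + 1) = (fun p : ℝ × ℝ => p.1 + p.2) ∘ fun ω => (walk X n ω, X n ω) := by
    funext ω
    simp [walk, Finset.sum_range_succ]
  rw [hadd, ← Measure.map_map (by fun_prop) ((hw n).prodMk (hX n)), hprod, Measure.conv]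

lemma map_walk_restrict_lt_exitTime (hX : ∀ i, Measurable (X i)) (hind : iIndepFun X P)
    (hid : ∀ i, IdentDistrib (X i) (X 0) P P) (n : ℕ) :
    (P.restrict {ω | (n : WithTop ℕ) < exitTime X ω}).map (walk X n)
      = alive (P.map (X 0)) (Measure.dirac 0) n := by
  induction n with
  | zero =>
    have h : {ω | ((0 : ℕ) : WithTop ℕ) < exitTime X ω} = Set.univ := by
      ext ω
      simp only [Set.mem_ofPred_eq, lt_exitTime_iff, Set.mem_univ, iff_true]
      intro i h1 h2; omega
    have h0 : walk X 0 = fun _ => 0 := by funext ω; simp [walk]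
    rw [h, Measure.restrict_univ, h0, Measure.map_const, measure_univ, one_smul, alive_zero]
  | succ n ih =>
    have hw : Measurable (walk X (n + 1)) := measurable_walk_of_le (fun j _ => hX j) le_rfl
    rw [setOf_lt_exitTime_succ, Set.inter_comm, ← Measure.restrict_restrict (hw measurableSet_Ioi),
      ← Measure.restrict_map hw measurableSet_Ioi, map_walk_succ_restrict hX hind hid, ih,
      alive_succ]

lemma map_walk_restrict_exitTime_eq (hX : ∀ i, Measurable (X i)) (hind : iIndepFun X P)
    (hid : ∀ i, IdentDistrib (X i) (X 0) P P) (k : ℕ) :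
    (P.restrict {ω | exitTime X ω = ((k + 1 : ℕ) : WithTop ℕ)}).map (walk X (k + 1))
      = exitLaw (P.map (X 0)) (Measure.dirac 0) k := by
  have hw : Measurable (walk X (k + 1)) := measurable_walk_of_le (fun j _ => hX j) le_rfl
  have h : {ω | exitTime X ω = ((k + 1 : ℕ) : WithTop ℕ)}
      = walk X (k + 1) ⁻¹' Set.Iic 0 ∩ {ω | (k : WithTop ℕ) < exitTime X ω} := by
    ext ω
    simp only [Set.mem_ofPred_eq, exitTime_eq_succ_iff, Set.mem_inter_iff, Set.mem_preimage,
      Set.mem_Iic]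
    exact and_comm
  rw [h, ← Measure.restrict_restrict (hw measurableSet_Iic),
    ← Measure.restrict_map hw measurableSet_Iic, map_walk_succ_restrict hX hind hid,
    map_walk_restrict_lt_exitTime hX hind hid, exitLaw]

lemma real_lt_exitTime_inter (hX : ∀ i, Measurable (X i)) (hind : iIndepFun X P)
    (hid : ∀ i, IdentDistrib (X i) (X 0) P P) (n : ℕ) {s : Set ℝ} (hs : MeasurableSet s) :
    P.real ({ω | (n : WithTop ℕ) < exitTime X ω} ∩ walk X n ⁻¹' s)
      = (alive (P.map (X 0)) (Measure.dirac 0) n).real s := by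
  have hw : Measurable (walk X n) := measurable_walk_of_le (fun j _ => hX j) le_rfl
  rw [← map_walk_restrict_lt_exitTime hX hind hid, map_measureReal_apply hw hs,
    measureReal_restrict_apply (hw hs), Set.inter_comm]

lemma real_lt_exitTime (hX : ∀ i, Measurable (X i)) (hind : iIndepFun X P)
    (hid : ∀ i, IdentDistrib (X i) (X 0) P P) (n : ℕ) :
    P.real {ω | (n : WithTop ℕ) < exitTime X ω}
      = (alive (P.map (X 0)) (Measure.dirac 0) n).real Set.univ := by
  rw [← real_lt_exitTime_inter hX hind hid n .univ, Set.preimage_univ, Set.inter_univ]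

lemma ae_exitTime_ne_top (hX : ∀ i, Measurable (X i)) (hind : iIndepFun X P)
    (hid : ∀ i, IdentDistrib (X i) (X 0) P P) [IsStdLaw (P.map (X 0))] :
    ∀ᵐ ω ∂P, exitTime X ω ≠ ⊤ := by
  rw [ae_iff]
  simp only [not_not]
  rw [← measureReal_eq_zero_iff]
  refine le_antisymm (ge_of_tendsto' (tendsto_survival (P.map (X 0))) fun n => ?_)
    measureReal_nonneg
  rw [← real_lt_exitTime hX hind hid]
  exact measureReal_mono fun ω (hω : exitTime X ω = ⊤) => by
    simp [hω]

/-- The events τ = k + 1 partition the space up to a null set, and on each of them the exit position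
has the law `exitLaw` at k. Summability of the overshoots gives integrability; the sign appears
because exit positions are non-positive. -/
lemma exitValue_integral (hX : ∀ i, Measurable (X i)) (hind : iIndepFun X P)
    (hid : ∀ i, IdentDistrib (X i) (X 0) P P) [IsStdLaw (P.map (X 0))] :
    Integrable (exitValue X) P ∧ ∫ ω, exitValue X ω ∂P = -exitMean (P.map (X 0)) := by
  set μ := P.map (X 0)
  set F : ℕ → Set Ω := fun k => {ω | exitTime X ω = ((k + 1 : ℕ) : WithTop ℕ)}
  have hw : ∀ i, Measurable (walk X i) := fun i => measurable_walk_of_le (fun j _ => hX j) le_rfl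
  have hF : ∀ k, MeasurableSet (F k) := fun k => by
    have : F k = {ω | (k : WithTop ℕ) < exitTime X ω} ∩ walk X (k + 1) ⁻¹' Set.Iic 0 := by
      ext ω
      exact exitTime_eq_succ_iff k ω
    rw [this]
    exact (measurableSet_lt_exitTime fun i _ => hX i).inter (hw _ measurableSet_Iic)
  have hd : Pairwise (Function.onFun Disjoint F) := fun i j hij =>
    Set.disjoint_left.2 fun ω (h1 : _ = _) (h2 : _ = _) => hij <| by
      have := h1.symm.trans h2
      have : i + 1 = j + 1 := by exact_mod_cast this
      omega
  have hU : (⋃ k, F k) =ᵐ[P] Set.univ := by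
    refine (ae_exitTime_ne_top hX hind hid).mono fun ω hω => eq_true ?_
    obtain ⟨m, hm⟩ := WithTop.ne_top_iff_exists.1 hω
    have h1 : WithTop.some 1 ≤ exitTime X ω := le_hittingAfter ω
    rw [← hm] at h1
    have h1 : 1 ≤ m := WithTop.coe_le_coe.1 h1
    refine Set.mem_iUnion.2 ⟨m - 1, ?_⟩
    change exitTime X ω = _
    rw [← hm, Nat.sub_add_cancel h1]
    rfl
  have hmap : ∀ k, (P.restrict (F k)).map (walk X (k + 1)) = exitLaw μ (Measure.dirac 0) k :=
    map_walk_restrict_exitTime_eq hX hind hid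
  have hval : ∀ k, ∀ᵐ ω ∂P.restrict (F k), walk X (k + 1) ω = exitValue X ω := fun k =>
    (ae_restrict_mem (hF k)).mono fun ω hω => (exitValue_of_exitTime_eq hω).symm
  have hint : ∀ k, IntegrableOn (exitValue X) (F k) P := fun k => by
    have h := (integrable_norm_iff (f := fun x : ℝ => x) (by fun_prop)).1
      (integrable_abs_exitLaw μ (integrable_abs_dirac 0) k)
    rw [← hmap, integrable_map_measure (by fun_prop) (hw _).aemeasurable] at h
    exact h.congr (hval k)
  have hnorm : ∀ k, ∫ ω in F k, ‖exitValue X ω‖ ∂P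
      = ∫ w, |w| ∂exitLaw μ (Measure.dirac 0) k := fun k => by
    rw [← hmap, integral_map (hw _).aemeasurable (by fun_prop)]
    exact integral_congr_ae ((hval k).mono fun ω hω => by simp [hω])
  have hI : IntegrableOn (exitValue X) (⋃ k, F k) P := by
    refine integrableOn_iUnion_of_summable_integral_norm hint ?_
    simp only [hnorm]
    exact summable_integral_abs_exitLaw μ
  have hsum := integral_iUnion hF hd hI
  have hterm : ∀ k, ∫ ω in F k, exitValue X ω ∂P = -∫ w, |w| ∂exitLaw μ (Measure.dirac 0) k :=
    fun k => by
      rw [integral_abs_exitLaw, neg_neg, ← hmap, integral_map (hw _).aemeasurable (by fun_prop)]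
      exact integral_congr_ae ((hval k).mono fun ω hω => hω.symm)
  simp only [hterm] at hsum
  rw [tsum_neg, setIntegral_congr_set hU, setIntegral_univ] at hsum
  refine ⟨?_, hsum⟩
  rwa [IntegrableOn, Measure.restrict_congr_set hU, Measure.restrict_univ] at hI

end

/-! ### Reduction to unit variance and the main theorem. -/

lemma isStdLaw_map_div {Ω : Type*} [MeasurableSpace Ω] {P : Measure Ω} [IsProbabilityMeasure P]
    {X : Ω → ℝ} {σ : ℝ} (hX : Measurable X) (hσ : 0 < σ) (hmean : ∫ ω, X ω ∂P = 0)
    (hsq : ∫ ω, |X ω| ^ 2 ∂P = σ ^ 2) (hcube : Integrable (fun ω => |X ω| ^ 3) P) :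
    IsStdLaw (P.map fun ω => X ω / σ) := by
  have hm : Measurable fun ω => X ω / σ := hX.div_const σ
  have : IsProbabilityMeasure (P.map fun ω => X ω / σ) :=
    Measure.isProbabilityMeasure_map hm.aemeasurable
  refine { integrable_cube := ?_, mean := ?_, sq := ?_ }
  · rw [integrable_map_measure (by fun_prop) hm.aemeasurable]
    refine (hcube.div_const (σ ^ 3)).congr (.of_forall fun ω => ?_)
    simp [abs_div, div_pow, abs_of_pos hσ]
  · rw [integral_map hm.aemeasurable (by fun_prop), integral_div, hmean, zero_div]
  · rw [integral_map hm.aemeasurable (by fun_prop)]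
    simp only [sq_abs] at hsq
    simp only [div_pow]
    rw [integral_div, hsq, div_self (by positivity)]

lemma thirdMoment_map_div {Ω : Type*} [MeasurableSpace Ω] {P : Measure Ω} {X : Ω → ℝ} {σ : ℝ}
    (hX : Measurable X) (hσ : 0 < σ) :
    thirdMoment (P.map fun ω => X ω / σ) = (∫ ω, |X ω| ^ 3 ∂P) / σ ^ 3 := by
  rw [thirdMoment, integral_map (hX.div_const σ).aemeasurable (by fun_prop)]
  simp only [abs_div, div_pow, abs_of_pos hσ]
  rw [integral_div]

theorem theorem1 :
    ∃ A : ℝ, ∀ (Ω : Type*) [MeasurableSpace Ω] (P : Measure Ω) [IsProbabilityMeasure P]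
      (X : ℕ → Ω → ℝ) (σ : ℝ),
      (∀ i, Measurable (X i)) →
      iIndepFun X P →
      (∀ i, IdentDistrib (X i) (X 0) P P) →
      0 < σ →
      ∫ ω, X 0 ω ∂P = 0 →
      ∫ ω, |X 0 ω| ^ 2 ∂P = σ ^ 2 →
      Integrable (fun ω => |X 0 ω| ^ 3) P →
      -- the exit position is defined almost surely, and its mean exists and does not vanish
      (∀ᵐ ω ∂P, exitTime X ω ≠ ⊤) ∧
      Integrable (exitValue X) P ∧
      ∫ ω, exitValue X ω ∂P ≠ 0 ∧
      ∀ n : ℕ, 1 ≤ n →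
        -- the conditioning event has positive probability
        0 < P.real {ω | (n : WithTop ℕ) < exitTime X ω} ∧
        (∀ x : ℝ, 0 ≤ x →
          |(P[|{ω | (n : WithTop ℕ) < exitTime X ω}]).real
                {ω | x ≤ walk X n ω / (σ * √(n : ℝ))} - Real.exp (-x ^ 2 / 2)|
            ≤ A * (∫ ω, |X 0 ω| ^ 3 ∂P) ^ 3 / (σ ^ 9 * √(n : ℝ))) ∧
        |P.real {ω | (n : WithTop ℕ) < exitTime X ω} /
              (√(2 / Real.pi) * |∫ ω, exitValue X ω ∂P| / (σ * √(n : ℝ))) - 1|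
          ≤ A * (∫ ω, |X 0 ω| ^ 3 ∂P) ^ 3 / (σ ^ 9 * √(n : ℝ)) := by
  refine ⟨8 * killedConst, fun Ω _ P _ X σ hX hind hid hσ hmean hsq hcube => ?_⟩
  -- Scaling leaves the exit time unchanged and multiplies the exit position by 1/σ. The third
  -- moment becomes E|X|³/σ³, so its cube accounts for σ⁹.
  set Y : ℕ → Ω → ℝ := fun i ω => X i ω / σ
  have hY : ∀ i, Measurable (Y i) := fun i => (hX i).div_const σ
  have hindY : iIndepFun Y P := hind.comp (fun _ x => x / σ) fun _ => by fun_prop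
  have hidY : ∀ i, IdentDistrib (Y i) (Y 0) P P := fun i =>
    (hid i).comp (u := fun x => x / σ) (by fun_prop)
  have hstd : IsStdLaw (P.map (Y 0)) := isStdLaw_map_div (hX 0) hσ hmean hsq hcube
  have hL : thirdMoment (P.map (Y 0)) = _ := thirdMoment_map_div (hX 0) hσ
  have hτ : exitTime Y = exitTime X := exitTime_div hσ
  have hv : ∀ ω, exitValue X ω = σ * exitValue Y ω := fun ω => by
    rw [exitValue_div hσ, mul_div_cancel₀ _ hσ.ne']
  have hκ := exitMean_pos (P.map (Y 0))
  have hv1 := exitValue_integral hY hindY hidY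
  have hv2 : ∫ ω, exitValue X ω ∂P = -(σ * exitMean (P.map (Y 0))) := by
    simp only [hv]
    rw [integral_const_mul, hv1.2, mul_neg]
  have hpos : 0 < σ * exitMean (P.map (Y 0)) := mul_pos hσ hκ
  refine ⟨hτ ▸ ae_exitTime_ne_top hY hindY hidY, ?_, ?_, fun n hn => ?_⟩
  · exact (hv1.1.const_mul σ).congr (.of_forall fun ω => (hv ω).symm)
  · rw [hv2]; exact (neg_neg_of_pos hpos).ne
  have hn0 : (0 : ℝ) < n := by exact_mod_cast hn
  have hq : 0 < √(n : ℝ) := Real.sqrt_pos.2 hn0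
  have hsurv := real_lt_exitTime hY hindY hidY n
  rw [hτ] at hsurv
  have hbound : 8 * killedConst * (∫ ω, |X 0 ω| ^ 3 ∂P) ^ 3 / (σ ^ 9 * √(n : ℝ))
      = 8 * killedConst * thirdMoment (P.map (Y 0)) ^ 3 / √n := by
    rw [hL]; field_simp
  rw [hbound, hsurv]
  refine ⟨alive_dirac_real_univ_pos _ n, fun x hx => ?_, ?_⟩
  · have hset : {ω | x ≤ walk X n ω / (σ * √(n : ℝ))} = walk Y n ⁻¹' Set.Ici (x * √n) := by
      ext ω
      rw [Set.mem_ofPred_eq, Set.mem_preimage, Set.mem_Ici, walk_div, le_div_iff₀ (by positivity),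
        le_div_iff₀ hσ]
      ring_nf
    have hm : MeasurableSet {ω | (n : WithTop ℕ) < exitTime X ω} :=
      measurableSet_lt_exitTime fun i _ => hX i
    have hinter := real_lt_exitTime_inter hY hindY hidY n (measurableSet_Ici (a := x * √n))
    rw [hτ] at hinter
    rw [Measure.real, cond_apply hm, ENNReal.toReal_mul, ENNReal.toReal_inv, ← Measure.real,
      ← Measure.real, hset, hinter, hsurv, inv_mul_eq_div]
    exact abs_alive_dirac_real_Ici_div_survival_sub_le _ hn hx
  · have e : √(2 / Real.pi) * |∫ ω, exitValue X ω ∂P| / (σ * √(n : ℝ))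
        = √(2 / Real.pi) * exitMean (P.map (Y 0)) / √n := by
      rw [hv2, abs_neg, abs_of_pos hpos]
      field_simp
    rw [e]
    exact abs_survival_div_sub_one_le _ hn
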